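/- **Setting.** A network has physical entities $P_1,\dots,P_n$ with capacities $\mathbf C_{phys}\in\mathbb R^n$; logical entities $1,\dots,m$, each a set of physical entities, with $m\times n$ incidence matrix $S$ ($s_{jk}=1$ if logical entity $j$ uses $P_k$, and $0$ otherwise); and flows $1,\dots,R$ with offered loads $\nu_r\ge 0$ and demands $A_{jr}\in\{0,1,2,\dots\}$ of flow $r$ on entity $j$. Logical entity $j$ has a loss function $F_j(\rho,c)\in[0,1]$ (the lost fraction at offered load $\rho\ge0$ and capacity $c\ge 0$), which is continuous on $[0,\infty)^2\setminus\{(0,0)\}$, nondecreasing in $\rho$ and nonincreasing in $c$. The utilization is assumed to increase with the loss, that is, the carried load $\rho\,(1-F_j(\rho,c))$ is nondecreasing in $\rho$. The utilization function $U_j$ is given by $U_j(-\log(1-F_j(\rho,c)),c)=\rho\,(1-F_j(\rho,c))$. In general (when losses are skipped or repeated) it is $U_j(y,c)=\sup\{\rho(1-F_j(\rho,c)):\rho\ge 0,\ F_j(\rho,c)\le 1-e^{-y}\}\in[0,\infty]$, with $\sup\emptyset=0$. Under the independence assumptions (losses on different logical entities are independent, and each unit of capacity is grabbed independently) the total carried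 traffic is $T(\mathbf C,\rho)=\sum_r\nu_r\prod_j(1-F_j(\rho_j,C_j))^{A_{jr}}$. The *modified problem* is to maximize, over capacities $\mathbf C$ and offered loads $\rho$, $$\widetilde T(\mathbf C,\rho)=T(\mathbf C,\rho)+\sum_j\int_0^{-\log(1-F_j(\rho_j,C_j))}U_j(z,C_j)\,dz$$ subject to $\rho\ge0$, the fixed-point equations $\rho_i(1-F_i(\rho_i,C_i))=\sum_r A_{ir}\nu_r\prod_j(1-F_j(\rho_j,C_j))^{A_{jr}}$ for $i=1,\dots,m$, and the linear constraints $S^{\mathsf T}\mathbf C\le\mathbf C_{phys}$, $\mathbf C\ge0$. **Theorem 2.** Let $$\phi(\mathbf C)=\min_{y\ge0}\Big\{\sum_r\nu_re^{-\sum_jy_jA_{jr}}+\sum_j\int_0^{y_j}U_j(z,C_j)\,dz\Big\},$$ where the minimum is attained if for every $j$ there is $\rho>0$ with $F_j(\rho,C_j)<1$, and is read as an infimum otherwise. Then: (i) $\phi$ is asymptotically concave: for every $x\in\mathbb R^m$ with all coordinates $\ge1$ the limit $\tilde\phi(x)=\lim_{k\to\infty}\frac1k\phi(kx)$ exists, and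 $\tilde\phi$ is concave on this set. (ii) $\phi$ can be computed in polynomial time: there is one program for a real-number machine (unit-cost arithmetic, comparisons, $\exp$ and $\log$ on reals, and unit-cost evaluation of the functions $U_j(y,c)$ and $\int_0^yU_j(z,c)\,dz$) that, given $\nu$, $A$, $\mathbf C\ge0$ and $\varepsilon>0$, returns $\phi(\mathbf C)$ up to an error of at most $\varepsilon$ after a number of steps bounded by a fixed polynomial in $m+R+\sum_r\log(1+\nu_r)+\sum_{j,r}\log(1+A_{jr})+\log(1+1/\varepsilon)$. (iii) If $\mathbf C^*$ maximizes $\phi$ subject to $S^{\mathsf T}\mathbf C\le\mathbf C_{phys}$, $\mathbf C\ge0$, then $\mathbf C^*$ is an optimal solution of the modified problem: the fixed-point equations have a solution $\rho^*\geq 0$ at $\mathbf C^*$, and for every such $\rho^*$ the pair $(\mathbf C^*,\rho^*)$ maximizes $\widetilde T$ over all feasible pairs. -/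

import Mathlib

open Set Filter Topology MeasureTheory
open scoped ENNReal

noncomputable section

namespace VirtNet

/-! ## Loss functions and utilization -/

/-- The requirements on a loss function `F ρ c` (offered load `ρ ≥ 0`, capacity `c ≥ 0`).
Continuity is not asked for at the origin: a loss function with `F 0 c = 0` for `c > 0` and
`F ρ 0 = 1` for `ρ > 0` is never continuous there. -/
structure IsLossFunction (F : ℝ → ℝ → ℝ) : Prop where
  nonneg : ∀ ρ c, 0 ≤ ρ → 0 ≤ c → 0 ≤ F ρ c
  le_one : ∀ ρ c, 0 ≤ ρ → 0 ≤ c → F ρ c ≤ 1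
  continuousOn : ContinuousOn (fun p : ℝ × ℝ => F p.1 p.2) {p | 0 ≤ p.1 ∧ 0 ≤ p.2 ∧ p ≠ (0, 0)}
  increasing : ∀ c, 0 ≤ c → MonotoneOn (fun ρ => F ρ c) (Ici 0)
  decreasing : ∀ ρ, 0 ≤ ρ → AntitoneOn (fun c => F ρ c) (Ici 0)

/-- The carried load (utilization) `ρ (1 - F(ρ, c))` of an entity with offered load `ρ`. -/
def carriedLoad (F : ℝ → ℝ → ℝ) (c ρ : ℝ) : ℝ := ρ * (1 - F ρ c)

/-- Utilization is a nondecreasing function of the logarithmic loss `y = -log (1 - F(ρ, c))`.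
As `y` is nondecreasing in `ρ`, and the carried load is proportional to `ρ` where `y` is constant,
this says that the carried load is nondecreasing in `ρ`. -/
def UtilizationIncreasing (F : ℝ → ℝ → ℝ) : Prop :=
  ∀ c, 0 ≤ c → MonotoneOn (carriedLoad F c) (Ici 0)

/-- The utilization function `U(y, c)`: the carried load when the loss is `1 - exp (-y)`.
If the loss skips or repeats values, `U` is the monotone envelope: `0` below the smallest
attained loss, the largest carried load on a stretch of constant loss (this affects `U` only at
jumps), and the supremum of the carried load (possibly `∞`) above all attained losses. -/
def util (F : ℝ → ℝ → ℝ) (y c : ℝ) : ℝ≥0∞ :=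
  ⨆ ρ ∈ {ρ : ℝ | 0 ≤ ρ ∧ F ρ c ≤ 1 - Real.exp (-y)}, ENNReal.ofReal (carriedLoad F c ρ)

/-- The defining implicit relation `U(-log (1 - F(ρ, c)), c) = ρ (1 - F(ρ, c))` of the
utilization function. -/
theorem util_implicit {F : ℝ → ℝ → ℝ} {c ρ : ℝ} (hF : StrictMonoOn (fun ρ => F ρ c) (Ici 0))
    (hU : MonotoneOn (carriedLoad F c) (Ici 0)) (hρ : 0 ≤ ρ) (h1 : F ρ c < 1) :
    util F (-Real.log (1 - F ρ c)) c = ENNReal.ofReal (ρ * (1 - F ρ c)) := by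
  have he : 1 - Real.exp (- -Real.log (1 - F ρ c)) = F ρ c := by
    rw [neg_neg, Real.exp_log (by linarith)]; ring
  unfold util
  rw [he]
  apply le_antisymm
  · refine iSup₂_le fun σ hσ => ENNReal.ofReal_le_ofReal ?_
    exact hU hσ.1 hρ ((hF.le_iff_le hσ.1 hρ).1 hσ.2)
  · exact le_iSup₂ (f := fun σ (_ : σ ∈ {σ : ℝ | 0 ≤ σ ∧ F σ c ≤ F ρ c}) =>
      ENNReal.ofReal (carriedLoad F c σ)) ρ ⟨hρ, le_rfl⟩

/-- `∫_0^y U(z, c) dz`. -/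
def utilIntegral (F : ℝ → ℝ → ℝ) (y c : ℝ) : ℝ≥0∞ := ∫⁻ z in Ioc 0 y, util F z c

open Classical in
/-- The utilization measure `∫_0^{-log (1-B)} U(z, c) dz`; the upper limit is `∞` for `B = 1`. -/
def utilMeasure (F : ℝ → ℝ → ℝ) (B c : ℝ) : ℝ≥0∞ :=
  if B = 1 then ∫⁻ z in Ioi 0, util F z c else utilIntegral F (-Real.log (1 - B)) c

/-! ## Networks -/

/-- The data of the model: `m` logical entities, each a set of some of the `n` physical entities,
the physical capacities, the demands `A j r` of the `R` flows, their offered loads `ν r`, and the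
loss functions of the logical entities. -/
structure Network (m n R : ℕ) where
  entity : Fin m → Finset (Fin n)
  physCap : Fin n → ℝ
  A : Fin m → Fin R → ℕ
  ν : Fin R → ℝ
  F : Fin m → ℝ → ℝ → ℝ

namespace Network

variable {m n R : ℕ} (N : Network m n R)

/-- The standing assumptions on the data. -/
structure Valid : Prop where
  load_nonneg : ∀ r, 0 ≤ N.ν r
  loss : ∀ j, IsLossFunction (N.F j)
  util_increasing : ∀ j, UtilizationIncreasing (N.F j)

/-- The `m × n` incidence matrix of logical and physical entities. -/
def S : Matrix (Fin m) (Fin n) ℝ := fun i k => if k ∈ N.entity i then 1 else 0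

/-- Capacity vectors that satisfy the linear constraints: the capacities of the logical entities
that use a physical entity add up to at most its capacity. As the rows of `S` are the logical
entities, this is multiplication by the transpose. -/
def polytope : Set (Fin m → ℝ) := {C | N.S.transpose.mulVec C ≤ N.physCap ∧ 0 ≤ C}

/-- The carried load of flow `r`, under the independence assumptions. -/
def flowCarried (C ρ : Fin m → ℝ) (r : Fin R) : ℝ :=
  N.ν r * ∏ j, (1 - N.F j (ρ j) (C j)) ^ N.A j r

/-- The total carried traffic. -/
def T (C ρ : Fin m → ℝ) : ℝ := ∑ r, N.flowCarried C ρ r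

/-- The fixed-point equations for the offered loads of the logical entities, in the form without
division. -/
def FixedPoint (C ρ : Fin m → ℝ) : Prop :=
  ∀ i, ρ i * (1 - N.F i (ρ i) (C i)) = ∑ r, (N.A i r : ℝ) * N.flowCarried C ρ r

/-- The modified objective: total carried traffic plus the sum of the utilization measures. -/
def modifiedT (C ρ : Fin m → ℝ) : ℝ≥0∞ :=
  ENNReal.ofReal (N.T C ρ) + ∑ j, utilMeasure (N.F j) (N.F j (ρ j) (C j)) (C j)

/-- Feasibility for the modified problem. -/
def ModifiedFeasible (C ρ : Fin m → ℝ) : Prop := C ∈ N.polytope ∧ 0 ≤ ρ ∧ N.FixedPoint C ρ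

/-- `C` is an optimal solution of the modified problem: there are offered loads that make it
feasible, and with any such offered loads it has the largest modified objective among all feasible
points. -/
def IsModifiedOptimal (C : Fin m → ℝ) : Prop :=
  (∃ ρ, N.ModifiedFeasible C ρ) ∧
    ∀ ρ, N.ModifiedFeasible C ρ →
      ∀ C' ρ', N.ModifiedFeasible C' ρ' → N.modifiedT C' ρ' ≤ N.modifiedT C ρ

/-- The expression that is minimized over `y ≥ 0` in the definition of `φ`. -/
def innerObjective (C y : Fin m → ℝ) : ℝ≥0∞ :=
  ENNReal.ofReal (∑ r, N.ν r * Real.exp (-∑ j, y j * N.A j r)) +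
    ∑ j, utilIntegral (N.F j) (y j) (C j)

/-- The function `φ`. The infimum is finite, as `y = 0` gives the value `∑ r, ν r`. -/
def phi (C : Fin m → ℝ) : ℝ := (⨅ y ∈ Ici (0 : Fin m → ℝ), N.innerObjective C y).toReal

end Network

/-- Asymptotic concavity: `f (n x) / n` converges, for every vector `x ≥ 1`, to a concave
function. -/
def AsymptoticallyConcave {m : ℕ} (f : (Fin m → ℝ) → ℝ) : Prop :=
  ∃ g : (Fin m → ℝ) → ℝ,
    (∀ x, 1 ≤ x → Tendsto (fun k : ℕ => (1 / (k : ℝ)) * f ((k : ℝ) • x)) atTop (𝓝 (g x))) ∧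
    ConcaveOn ℝ (Ici 1) g

/-! ## A real-number machine with a step count

Programs act on natural-number index registers and on two-dimensional arrays of real numbers. -/

/-- A memory state. -/
structure State where
  idx : ℕ → ℕ
  arr : ℕ → ℕ → ℕ → ℝ

/-- The cell of array `name` whose coordinates are the contents of index registers `i`, `j`. -/
structure Ref where
  name : ℕ
  i : ℕ
  j : ℕ

namespace State

/-- Read a cell. -/
def get (s : State) (x : Ref) : ℝ := s.arr x.name (s.idx x.i) (s.idx x.j)

/-- Write a cell. -/
def set (s : State) (x : Ref) (v : ℝ) : State :=
  { s with arr := fun a p q =>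
      if a = x.name ∧ p = s.idx x.i ∧ q = s.idx x.j then v else s.arr a p q }

/-- Write an index register. -/
def setIdx (s : State) (i v : ℕ) : State := { s with idx := Function.update s.idx i v }

end State

/-- The functions that a program can evaluate by a query: entity number, `y`, capacity. -/
structure Oracle where
  util : ℕ → ℝ → ℝ → ℝ
  utilIntegral : ℕ → ℝ → ℝ → ℝ

/-- The elementary instructions. -/
inductive Instr where
  | idxConst (i v : ℕ)
  | idxAdd (i j k : ℕ)
  | idxSub (i j k : ℕ)
  | const (x : Ref) (v : ℤ)
  | copy (x y : Ref)
  | add (x y z : Ref)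
  | sub (x y z : Ref)
  | mul (x y z : Ref)
  | div (x y z : Ref)
  | exp (x y : Ref)
  | log (x y : Ref)
  | queryUtil (x : Ref) (j : ℕ) (y c : Ref)
  | queryUtilIntegral (x : Ref) (j : ℕ) (y c : Ref)

/-- The effect of an elementary instruction; the first argument is the target. -/
def Instr.apply (O : Oracle) (s : State) : Instr → State
  | idxConst i v => s.setIdx i v
  | idxAdd i j k => s.setIdx i (s.idx j + s.idx k)
  | idxSub i j k => s.setIdx i (s.idx j - s.idx k)
  | const x v => s.set x v
  | copy x y => s.set x (s.get y)
  | add x y z => s.set x (s.get y + s.get z)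
  | sub x y z => s.set x (s.get y - s.get z)
  | mul x y z => s.set x (s.get y * s.get z)
  | div x y z => s.set x (s.get y / s.get z)
  | exp x y => s.set x (Real.exp (s.get y))
  | log x y => s.set x (Real.log (s.get y))
  | queryUtil x j y c => s.set x (O.util (s.idx j) (s.get y) (s.get c))
  | queryUtilIntegral x j y c => s.set x (O.utilIntegral (s.idx j) (s.get y) (s.get c))

/-- Tests: comparison of two index registers or of two real cells. -/
inductive Test where
  | idxLt (i j : ℕ)
  | realLt (x y : Ref)

/-- The truth value of a test. -/
def Test.Holds (s : State) : Test → Prop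
  | idxLt i j => s.idx i < s.idx j
  | realLt x y => s.get x < s.get y

/-- Structured programs. -/
inductive Prog where
  | instr (c : Instr)
  | seq (p q : Prog)
  | ite (t : Test) (p q : Prog)
  | loop (t : Test) (p : Prog)

/-- `Exec O p s s' k`: program `p`, started in state `s`, halts in state `s'` after `k` steps,
where every elementary instruction and every evaluation of a test is one step. The program
`loop t p` repeats `p` as long as the test `t` holds. -/
inductive Exec (O : Oracle) : Prog → State → State → ℕ → Prop
  | instr (c : Instr) (s : State) : Exec O (.instr c) s (c.apply O s) 1
  | seq {p q : Prog} {s s₁ s₂ : State} {k₁ k₂ : ℕ} :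
      Exec O p s s₁ k₁ → Exec O q s₁ s₂ k₂ → Exec O (.seq p q) s s₂ (k₁ + k₂)
  | ite_true {t : Test} {p q : Prog} {s s₁ : State} {k : ℕ} :
      t.Holds s → Exec O p s s₁ k → Exec O (.ite t p q) s s₁ (k + 1)
  | ite_false {t : Test} {p q : Prog} {s s₁ : State} {k : ℕ} :
      ¬ t.Holds s → Exec O q s s₁ k → Exec O (.ite t p q) s s₁ (k + 1)
  | loop_true {t : Test} {p : Prog} {s s₁ s₂ : State} {k₁ k₂ : ℕ} :
      t.Holds s → Exec O p s s₁ k₁ → Exec O (.loop t p) s₁ s₂ k₂ →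
        Exec O (.loop t p) s s₂ (k₁ + k₂ + 1)
  | loop_false {t : Test} {p : Prog} {s : State} :
      ¬ t.Holds s → Exec O (.loop t p) s s 1

/-- The machine is deterministic: final state and step count are determined by the start. -/
theorem Exec.unique {O : Oracle} {p : Prog} {s s₁ s₂ : State} {k₁ k₂ : ℕ}
    (h₁ : Exec O p s s₁ k₁) (h₂ : Exec O p s s₂ k₂) : s₁ = s₂ ∧ k₁ = k₂ := by
  induction h₁ generalizing s₂ k₂ with
  | instr c s => cases h₂; exact ⟨rfl, rfl⟩
  | seq _ _ ih₁ ih₂ =>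
    cases h₂ with
    | seq a b =>
      obtain ⟨rfl, rfl⟩ := ih₁ a
      obtain ⟨rfl, rfl⟩ := ih₂ b
      exact ⟨rfl, rfl⟩
  | ite_true ht _ ih =>
    cases h₂ with
    | ite_true _ a => obtain ⟨rfl, rfl⟩ := ih a; exact ⟨rfl, rfl⟩
    | ite_false hf _ => exact absurd ht hf
  | ite_false hf _ ih =>
    cases h₂ with
    | ite_true ht _ => exact absurd ht hf
    | ite_false _ a => obtain ⟨rfl, rfl⟩ := ih a; exact ⟨rfl, rfl⟩
  | loop_true ht _ _ ih₁ ih₂ =>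
    cases h₂ with
    | loop_true _ a b =>
      obtain ⟨rfl, rfl⟩ := ih₁ a
      obtain ⟨rfl, rfl⟩ := ih₂ b
      exact ⟨rfl, rfl⟩
    | loop_false hf => exact absurd ht hf
  | loop_false hf =>
    cases h₂ with
    | loop_true ht _ _ => exact absurd ht hf
    | loop_false _ => exact ⟨rfl, rfl⟩

open Classical in
/-- The answer to a query: the value itself, or `-1` if it is infinite. -/
def answer (x : ℝ≥0∞) : ℝ := if x = ∞ then -1 else x.toReal

namespace Network

variable {m n R : ℕ} (N : Network m n R)

/-- The oracle of a network evaluates the utilization functions of its logical entities and their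
integrals. -/
def oracle : Oracle where
  util j y c := if h : j < m then answer (util (N.F ⟨j, h⟩) y c) else 0
  utilIntegral j y c := if h : j < m then answer (utilIntegral (N.F ⟨j, h⟩) y c) else 0

/-- The input: index registers 0 and 1 hold `m` and `R`, array 0 holds `ν`, array 1 holds `A`,
array 2 holds `C`, array 3 holds the required accuracy `ε`; everything else is zero. -/
def input (C : Fin m → ℝ) (ε : ℝ) : State where
  idx i := if i = 0 then m else if i = 1 then R else 0
  arr a p q :=
    if a = 0 then (if h : p < R ∧ q = 0 then N.ν ⟨p, h.1⟩ else 0)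
    else if a = 1 then (if h : p < m ∧ q < R then (N.A ⟨p, h.1⟩ ⟨q, h.2⟩ : ℝ) else 0)
    else if a = 2 then (if h : p < m ∧ q = 0 then C ⟨p, h.1⟩ else 0)
    else if a = 3 then (if p = 0 ∧ q = 0 then ε else 0)
    else 0

/-- The size of the input: numbers of entities and flows, and the lengths of the offered loads, of
the demands, and of the accuracy. -/
def inputSize (ε : ℝ) : ℝ :=
  m + R + ∑ r, Real.log (1 + N.ν r) + ∑ j, ∑ r, Real.log (1 + N.A j r) + Real.log (1 + 1 / ε)

end Network

/-- The output of a computation: cell `(0, 0)` of array 4. -/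
def State.output (s : State) : ℝ := s.arr 4 0 0

/-- A single program computes `φ(C)`, for all networks and all capacity vectors `C ≥ 0`, within any
prescribed error `ε > 0`, in a number of steps that is polynomial in the size of the input
(hence in the number `log (1 / ε)` of digits). -/
def PhiPolynomialTime : Prop :=
  ∃ (P : Prog) (K d : ℕ), ∀ (m n R : ℕ) (N : Network m n R), N.Valid →
    ∀ (C : Fin m → ℝ) (ε : ℝ), 0 ≤ C → 0 < ε →
      ∃ (s : State) (k : ℕ), Exec N.oracle P (N.input C ε) s k ∧
        |s.output - N.phi C| ≤ ε ∧ (k : ℝ) ≤ K * (1 + N.inputSize ε) ^ d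

end VirtNet

end

/-!
The function `φ` is the value of a convex problem: the slopes of `y ↦ ∫_0^y U` are the values of the
nondecreasing function `U`, and the carried traffic `∑ r, ν r * exp (-∑ j, y j * A j r)` is convex.
Everything rests on the resulting inequality for subgradients, `innerObjective_subgradient`.

*Attainment and asymptotic concavity.* The integrals are lower semicontinuous, and unbounded unless
the entity has no utilization, so a minimizer exists (`exists_isMin`). As `0 ≤ φ ≤ ∑ r, ν r` with
fixed offered loads of the flows, `φ (k x) / k` tends to `0`.

*The modified problem.* With `y j = -log (1 - F j)` the fixed-point equations are the first-order
conditions of the convex problem. Hence the modified objective equals `φ` at every feasible point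
(`modifiedT_eq_phi`), and a solution of the equations is obtained from a minimizer
(`exists_fixedPoint`): if `a` is the carried load of an entity at the minimizer, its offered load
must be `a * exp y`, and `loss_eq_of_separates` shows that it has the right loss. Entities that lose
everything correspond to `y j = ∞`; they are removed together with the flows that use them.

*Polynomial time.* The problem is extended to negative `y` and solved by a cutting plane method with
simplices in place of ellipsoids (in the manner of Yamnitsky and Levin). The simplex is cut through
its centroid by a subgradient, or by the coordinate directions in which the utilization is infinite,
and contracted towards its deepest vertex, which keeps the near half (`InSimplex.contract`) and
shrinks the volume by a factor `exp (-1 / (16 (m + 1) ^ 2))` (`exp_le_prod_contract`). Losses beyond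
a logarithmic bound are irrelevant, and decreasing all losses slightly changes the objective little,
so there is a box of nearly optimal points whose width is not too small (`exists_box`); since the
simplex cannot contain it for long, a nearly optimal centroid is met after polynomially many rounds.
Volumes are measured by determinants, and compared by the bound `abs_det_le_prod_sum`.

The program consists of array assignments of expressions with bounded sums, for which a verified
translation to the machine with a bound for the number of steps is given
(`RealExpr.compile_spec`, `Assign.block_spec`). A list of assignments that never overwrites an
array which it has read or written can be read as a system of equations for the final state
(`Assign.semBlock_arr`).
-/

noncomputable section

namespace VirtNet

/-! ### Integrals of nonnegative slopes -/

theorem lintegral_Ioc_add (U : ℝ → ℝ≥0∞) {a b : ℝ} (ha : 0 ≤ a) (hab : a ≤ b) :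
    ∫⁻ z in Ioc 0 b, U z = (∫⁻ z in Ioc 0 a, U z) + ∫⁻ z in Ioc a b, U z := by
  rw [← Ioc_union_Ioc_eq_Ioc ha hab, lintegral_union measurableSet_Ioc]
  rw [Set.disjoint_left]
  intro z hz hz'
  exact absurd hz.2 (not_le.2 hz'.1)

theorem lintegral_Ioc_le {U : ℝ → ℝ≥0∞} {a b : ℝ} {M : ℝ≥0∞} (h : ∀ z < b, U z ≤ M) :
    ∫⁻ z in Ioc a b, U z ≤ M * ENNReal.ofReal (b - a) := by
  rw [← setLIntegral_congr (Ioo_ae_eq_Ioc (μ := volume) (a := a) (b := b))]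
  calc ∫⁻ z in Ioo a b, U z ≤ ∫⁻ _ in Ioo a b, M := setLIntegral_mono' measurableSet_Ioo
        fun z hz => h z hz.2
    _ = M * ENNReal.ofReal (b - a) := by rw [setLIntegral_const, Real.volume_Ioo]

theorem le_lintegral_Ioc {U : ℝ → ℝ≥0∞} {a b : ℝ} {M : ℝ≥0∞} (h : ∀ z > a, M ≤ U z) :
    M * ENNReal.ofReal (b - a) ≤ ∫⁻ z in Ioc a b, U z := by
  calc M * ENNReal.ofReal (b - a) = ∫⁻ _ in Ioc a b, M := by
        rw [setLIntegral_const, Real.volume_Ioc]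
    _ ≤ _ := setLIntegral_mono' measurableSet_Ioc fun z hz => h z hz.1

theorem lintegral_Ioc_mono (U : ℝ → ℝ≥0∞) : Monotone fun y => ∫⁻ z in Ioc 0 y, U z :=
  fun _ _ h => lintegral_mono_set (Ioc_subset_Ioc_right h)

theorem lintegral_Ioc_of_nonpos (U : ℝ → ℝ≥0∞) {y : ℝ} (hy : y ≤ 0) :
    ∫⁻ z in Ioc 0 y, U z = 0 := by
  rw [Ioc_eq_empty (not_lt.2 hy)]; simp

/-- A number `a` that separates the values of `U` on the left of `y` from those on the right is a
subgradient at `y` of `x ↦ ∫_0^x U`, a function which is extended by `0` to negative `x`. -/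
theorem lintegral_Ioc_subgradient {U : ℝ → ℝ≥0∞} (h0 : ∀ z < 0, U z = 0) {y a : ℝ} (ha : 0 ≤ a)
    (hlo : ∀ z < y, U z ≤ ENNReal.ofReal a) (hhi : ∀ z > y, ENNReal.ofReal a ≤ U z) :
    (∫⁻ z in Ioc 0 y, U z) ≠ ∞ ∧ ∀ x, (∫⁻ z in Ioc 0 x, U z) ≠ ∞ →
      (∫⁻ z in Ioc 0 y, U z).toReal + a * (x - y) ≤ (∫⁻ z in Ioc 0 x, U z).toReal := by
  have hfin : (∫⁻ z in Ioc 0 y, U z) ≠ ∞ :=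
    ne_top_of_le_ne_top (ENNReal.mul_ne_top ENNReal.ofReal_ne_top ENNReal.ofReal_ne_top)
      (lintegral_Ioc_le hlo)
  refine ⟨hfin, fun x hx => ?_⟩
  rcases le_or_gt y x with hyx | hxy
  · rcases lt_or_ge y 0 with hy | hy
    · have := hhi (y / 2) (by linarith)
      rw [h0 _ (by linarith)] at this
      have ha0 : a = 0 := le_antisymm (by simpa using this) ha
      rw [lintegral_Ioc_of_nonpos U hy.le, ha0]
      simp
    · have h1 : (∫⁻ z in Ioc 0 y, U z) + ENNReal.ofReal a * ENNReal.ofReal (x - y)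
          ≤ ∫⁻ z in Ioc 0 x, U z := by
        rw [lintegral_Ioc_add U hy hyx]
        exact add_le_add_right (le_lintegral_Ioc hhi) _
      have h2 := ENNReal.toReal_mono hx h1
      rwa [ENNReal.toReal_add hfin (ENNReal.mul_ne_top ENNReal.ofReal_ne_top ENNReal.ofReal_ne_top),
        ENNReal.toReal_mul, ENNReal.toReal_ofReal ha,
        ENNReal.toReal_ofReal (by linarith)] at h2
  · rcases le_or_gt y 0 with hy | hy
    · rw [lintegral_Ioc_of_nonpos U hy]
      have : a * (x - y) ≤ 0 := mul_nonpos_of_nonneg_of_nonpos ha (by linarith)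
      simpa using this.trans ENNReal.toReal_nonneg
    · have hm : (∫⁻ z in Ioc 0 (max x 0), U z) = ∫⁻ z in Ioc 0 x, U z := by
        rcases le_total x 0 with h | h
        · rw [max_eq_right h, lintegral_Ioc_of_nonpos U h, lintegral_Ioc_of_nonpos U le_rfl]
        · rw [max_eq_left h]
      have hmy : max x 0 ≤ y := max_le hxy.le hy.le
      have h1 : (∫⁻ z in Ioc 0 y, U z)
          ≤ (∫⁻ z in Ioc 0 x, U z) + ENNReal.ofReal a * ENNReal.ofReal (y - max x 0) := by
        rw [lintegral_Ioc_add U (le_max_right x 0) hmy, hm]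
        exact add_le_add_right (lintegral_Ioc_le hlo) _
      have hne := ENNReal.mul_ne_top (ENNReal.ofReal_ne_top (r := a))
        (ENNReal.ofReal_ne_top (r := y - max x 0))
      have h2 := ENNReal.toReal_mono (ENNReal.add_ne_top.2 ⟨hx, hne⟩) h1
      rw [ENNReal.toReal_add hx hne, ENNReal.toReal_mul, ENNReal.toReal_ofReal ha,
        ENNReal.toReal_ofReal (by linarith)] at h2
      have h3 : a * (y - max x 0) ≤ a * (y - x) :=
        mul_le_mul_of_nonneg_left (by linarith [le_max_left x 0]) ha
      linarith

/-- `y ↦ ∫_0^y U` is lower semicontinuous, as it is nondecreasing and, by monotone convergence,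
continuous from the left. -/
theorem lowerSemicontinuous_lintegral_Ioc (U : ℝ → ℝ≥0∞) :
    LowerSemicontinuous fun y => ∫⁻ z in Ioc 0 y, U z := by
  intro y t ht
  have hU : Ioo (0 : ℝ) y = ⋃ n : ℕ, Ioc 0 (y - 1 / ((n : ℝ) + 1)) := by
    ext z
    simp only [mem_iUnion, mem_Ioo, mem_Ioc]
    constructor
    · rintro ⟨h1, h2⟩
      obtain ⟨n, hn⟩ := exists_nat_one_div_lt (sub_pos.2 h2)
      exact ⟨n, h1, by linarith⟩
    · rintro ⟨n, h1, h2⟩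
      have : (0 : ℝ) < 1 / ((n : ℝ) + 1) := by positivity
      exact ⟨h1, by linarith⟩
  have hd : Directed (· ⊆ ·) fun n : ℕ => Ioc (0 : ℝ) (y - 1 / ((n : ℝ) + 1)) := by
    refine Monotone.directed_le fun i j hij => Ioc_subset_Ioc_right ?_
    have := one_div_le_one_div_of_le (by positivity : (0 : ℝ) < (i : ℝ) + 1)
      (by exact_mod_cast Nat.succ_le_succ hij : (i : ℝ) + 1 ≤ (j : ℝ) + 1)
    linarith
  change t < ∫⁻ z in Ioc 0 y, U z at ht
  rw [← setLIntegral_congr (Ioo_ae_eq_Ioc (μ := volume)), hU,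
    setLIntegral_iUnion_of_directed _ hd, lt_iSup_iff] at ht
  obtain ⟨n, hn⟩ := ht
  have hpos : (0 : ℝ) < 1 / ((n : ℝ) + 1) := by positivity
  filter_upwards [lt_mem_nhds (show y - 1 / ((n : ℝ) + 1) < y by linarith)] with x hx
  exact hn.trans_le (lintegral_Ioc_mono U hx.le)

/-! ### Utilization functions -/

theorem util_mono (F : ℝ → ℝ → ℝ) (c : ℝ) : Monotone fun z => util F z c := by
  intro z z' h
  refine iSup₂_le fun ρ hρ => ?_
  refine le_iSup₂ (f := fun σ (_ : σ ∈ {σ : ℝ | 0 ≤ σ ∧ F σ c ≤ 1 - Real.exp (-z')}) =>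
    ENNReal.ofReal (carriedLoad F c σ)) ρ ⟨hρ.1, hρ.2.trans ?_⟩
  have := Real.exp_le_exp.2 (neg_le_neg h)
  linarith

theorem le_util {F : ℝ → ℝ → ℝ} {z c ρ : ℝ} (h0 : 0 ≤ ρ) (h : F ρ c ≤ 1 - Real.exp (-z)) :
    ENNReal.ofReal (carriedLoad F c ρ) ≤ util F z c :=
  le_iSup₂ (f := fun σ (_ : σ ∈ {σ : ℝ | 0 ≤ σ ∧ F σ c ≤ 1 - Real.exp (-z)}) =>
    ENNReal.ofReal (carriedLoad F c σ)) ρ ⟨h0, h⟩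

theorem util_le {F : ℝ → ℝ → ℝ} {z c a : ℝ}
    (h : ∀ ρ, 0 ≤ ρ → F ρ c ≤ 1 - Real.exp (-z) → carriedLoad F c ρ ≤ a) :
    util F z c ≤ ENNReal.ofReal a :=
  iSup₂_le fun ρ hρ => ENNReal.ofReal_le_ofReal (h ρ hρ.1 hρ.2)

/-- The largest carried load at a loss below that of the offered load `ρ` is at most the carried
load of `ρ`. -/
theorem util_le_carriedLoad {F : ℝ → ℝ → ℝ} {z c ρ : ℝ} (hF : IsLossFunction F)
    (hU : UtilizationIncreasing F) (hc : 0 ≤ c) (hρ : 0 ≤ ρ) (h : 1 - Real.exp (-z) < F ρ c) :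
    util F z c ≤ ENNReal.ofReal (carriedLoad F c ρ) := by
  refine util_le fun σ hσ hσ' => hU c hc hσ hρ ?_
  by_contra hlt
  have := hF.increasing c hc hρ hσ (not_le.1 hlt).le
  simp only at this
  linarith

theorem util_of_neg {F : ℝ → ℝ → ℝ} (hF : IsLossFunction F) {c z : ℝ} (hc : 0 ≤ c) (hz : z < 0) :
    util F z c = 0 := by
  have h : util F z c ≤ ENNReal.ofReal 0 := util_le fun ρ h0 h => by
    have h1 := hF.nonneg ρ c h0 hc
    have h2 : 1 < Real.exp (-z) := Real.one_lt_exp_iff.2 (by linarith)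
    linarith
  simpa using h

/-- An entity that loses everything at some offered load has no utilization. -/
theorem util_eq_zero_of_loss_eq_one {F : ℝ → ℝ → ℝ} (hF : IsLossFunction F)
    (hU : UtilizationIncreasing F) {c ρ : ℝ} (hc : 0 ≤ c) (hρ : 0 ≤ ρ) (h1 : F ρ c = 1) (z : ℝ) :
    util F z c = 0 := by
  have h := util_le_carriedLoad hF hU (z := z) hc hρ (by rw [h1]; linarith [Real.exp_pos (-z)])
  rw [carriedLoad, h1] at h
  simpa using h

theorem exists_util_pos {F : ℝ → ℝ → ℝ} {c : ℝ} (h : ∃ ρ > 0, F ρ c < 1) :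
    ∃ z, 0 < util F z c := by
  obtain ⟨ρ, hρ, h1⟩ := h
  refine ⟨-Real.log (1 - F ρ c), lt_of_lt_of_le ?_ (le_util hρ.le ?_)⟩
  · exact ENNReal.ofReal_pos.2 (mul_pos hρ (by linarith))
  · rw [neg_neg, Real.exp_log (by linarith)]; linarith

/-- If the slope `a > 0` separates the utilization on the two sides of `y`, then `1 - exp (-y)` is
the loss at the offered load whose carried load is `a` at this loss, namely `a * exp y`. -/
theorem loss_eq_of_separates {F : ℝ → ℝ → ℝ} (hF : IsLossFunction F) (hU : UtilizationIncreasing F)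
    {c y a : ℝ} (hc : 0 ≤ c) (ha : 0 < a) (hlo : ∀ z < y, util F z c ≤ ENNReal.ofReal a)
    (hhi : ∀ z > y, ENNReal.ofReal a ≤ util F z c) :
    F (a * Real.exp y) c = 1 - Real.exp (-y) := by
  set ρ := a * Real.exp y with hρdef
  have hρ : 0 < ρ := by positivity
  have hρe : ρ * Real.exp (-y) = a := by
    rw [hρdef, mul_assoc, ← Real.exp_add]; simp
  have hcont : ContinuousAt (fun σ => F σ c) ρ := by
    have h1 : ContinuousWithinAt (fun p : ℝ × ℝ => F p.1 p.2)
        {p | 0 ≤ p.1 ∧ 0 ≤ p.2 ∧ p ≠ (0, 0)} (ρ, c) :=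
      hF.continuousOn _ ⟨hρ.le, hc, fun h => hρ.ne' (congrArg Prod.fst h)⟩
    have h2 : ContinuousWithinAt (fun σ : ℝ => (σ, c)) (Ioi 0) ρ := by fun_prop
    exact (ContinuousWithinAt.comp (f := fun σ : ℝ => (σ, c)) (x := ρ) h1 h2 fun σ hσ =>
      ⟨le_of_lt hσ, hc, fun h => (ne_of_gt hσ) (congrArg Prod.fst h)⟩).continuousAt
      (Ioi_mem_nhds hρ)
  have hexp : ContinuousAt (fun z : ℝ => 1 - Real.exp (-z)) y := by fun_prop
  rcases lt_trichotomy (F ρ c) (1 - Real.exp (-y)) with h | h | h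
  · obtain ⟨w, hw1, hw2⟩ := exists_between h
    obtain ⟨ρ', hρ'1, hρ'2⟩ :=
      ((hcont.eventually (gt_mem_nhds hw1)).filter_mono nhdsWithin_le_nhds |>.and
        (self_mem_nhdsWithin (s := Ioi ρ))).exists
    obtain ⟨z, hz1, hz2⟩ :=
      ((hexp.eventually (lt_mem_nhds hw2)).filter_mono nhdsWithin_le_nhds |>.and
        (self_mem_nhdsWithin (s := Iio y))).exists
    have hρ'0 : 0 < ρ' := hρ.trans hρ'2
    have h3 := (le_util hρ'0.le (hρ'1.trans hz1).le).trans (hlo z hz2)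
    rw [ENNReal.ofReal_le_ofReal_iff ha.le, carriedLoad, ← hρe] at h3
    have h4 : Real.exp (-y) < 1 - F ρ' c := by linarith
    have h5 : ρ * Real.exp (-y) < ρ' * (1 - F ρ' c) :=
      mul_lt_mul'' hρ'2 h4 hρ.le (Real.exp_pos _).le
    linarith
  · exact h
  · obtain ⟨w, hw1, hw2⟩ := exists_between h
    obtain ⟨ρ', ⟨hρ'1, hρ'0⟩, hρ'2⟩ :=
      (((hcont.eventually (lt_mem_nhds hw2)).and (lt_mem_nhds hρ)).filter_mono nhdsWithin_le_nhds
        |>.and (self_mem_nhdsWithin (s := Iio ρ))).exists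
    obtain ⟨z, hz1, hz2⟩ :=
      ((hexp.eventually (gt_mem_nhds hw1)).filter_mono nhdsWithin_le_nhds |>.and
        (self_mem_nhdsWithin (s := Ioi y))).exists
    have h3 := (hhi z hz2).trans
      (util_le_carriedLoad hF hU hc hρ'0.le (hz1.trans hρ'1))
    have h6 : a ≤ carriedLoad F c ρ' := (ENNReal.ofReal_le_ofReal_iff'.1 h3).resolve_right
      (not_le.2 ha)
    rw [carriedLoad, ← hρe] at h6
    have h4 : 1 - F ρ' c < Real.exp (-y) := by linarith
    have h5 : ρ' * (1 - F ρ' c) < ρ * Real.exp (-y) :=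
      (mul_lt_mul_of_pos_left h4 hρ'0).trans (mul_lt_mul_of_pos_right hρ'2 (Real.exp_pos _))
    linarith

namespace Network

variable {m n R : ℕ} (N : Network m n R)

/-! ### Convexity of the inner objective -/

/-- The carried traffic when the logarithmic losses of the entities are `y`. -/
def residual (y : Fin m → ℝ) : ℝ := ∑ r, N.ν r * Real.exp (-∑ j, y j * N.A j r)

/-- The traffic carried over entity `j` when the logarithmic losses of the entities are `y`. It is
the partial derivative of `-residual`. -/
def marginal (y : Fin m → ℝ) (j : Fin m) : ℝ :=
  ∑ r, (N.A j r : ℝ) * (N.ν r * Real.exp (-∑ l, y l * N.A l r))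

/-- The slope `a j` separates the values of the utilization of entity `j` on the left of `y j` from
those on the right, for every `j`. In other words, `a j` is a subgradient of the integral of the
utilization. -/
def Separates (C y a : Fin m → ℝ) : Prop :=
  ∀ j, (∀ z < y j, util (N.F j) z (C j) ≤ ENNReal.ofReal (a j)) ∧
    ∀ z > y j, ENNReal.ofReal (a j) ≤ util (N.F j) z (C j)

variable {N}

theorem residual_nonneg (hν : ∀ r, 0 ≤ N.ν r) (y : Fin m → ℝ) : 0 ≤ N.residual y :=
  Finset.sum_nonneg fun r _ => mul_nonneg (hν r) (Real.exp_pos _).le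

theorem marginal_nonneg (hν : ∀ r, 0 ≤ N.ν r) (y : Fin m → ℝ) (j : Fin m) : 0 ≤ N.marginal y j :=
  Finset.sum_nonneg fun r _ => mul_nonneg (Nat.cast_nonneg _)
    (mul_nonneg (hν r) (Real.exp_pos _).le)

theorem residual_subgradient (hν : ∀ r, 0 ≤ N.ν r) (y x : Fin m → ℝ) :
    N.residual y - ∑ j, N.marginal y j * (x j - y j) ≤ N.residual x := by
  have h1 : ∑ j, N.marginal y j * (x j - y j)
      = ∑ r, N.ν r * Real.exp (-∑ l, y l * N.A l r) * ∑ j, (N.A j r : ℝ) * (x j - y j) := by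
    simp only [marginal, Finset.sum_mul, Finset.mul_sum]
    rw [Finset.sum_comm]
    exact Finset.sum_congr rfl fun r _ => Finset.sum_congr rfl fun j _ => by ring
  rw [h1, residual, residual, ← Finset.sum_sub_distrib]
  refine Finset.sum_le_sum fun r _ => ?_
  have h2 : -∑ j, x j * (N.A j r : ℝ)
      = -∑ l, y l * (N.A l r : ℝ) + -∑ j, (N.A j r : ℝ) * (x j - y j) := by
    rw [← neg_add, ← Finset.sum_add_distrib]
    exact congrArg _ (Finset.sum_congr rfl fun j _ => by ring)
  rw [h2, Real.exp_add]
  have h3 := Real.add_one_le_exp (-∑ j, (N.A j r : ℝ) * (x j - y j))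
  have h4 := mul_le_mul_of_nonneg_left h3
    (mul_nonneg (hν r) (Real.exp_pos (-∑ l, y l * (N.A l r : ℝ))).le)
  linarith

theorem innerObjective_eq (C y : Fin m → ℝ) : N.innerObjective C y =
    ENNReal.ofReal (N.residual y) + ∑ j, utilIntegral (N.F j) (y j) (C j) := rfl

theorem innerObjective_ne_top {C y : Fin m → ℝ} :
    N.innerObjective C y ≠ ∞ ↔ ∀ j, utilIntegral (N.F j) (y j) (C j) ≠ ∞ := by
  simp [innerObjective_eq, ENNReal.sum_eq_top]

theorem toReal_innerObjective (hν : ∀ r, 0 ≤ N.ν r) {C y : Fin m → ℝ}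
    (h : N.innerObjective C y ≠ ∞) : (N.innerObjective C y).toReal =
      N.residual y + ∑ j, (utilIntegral (N.F j) (y j) (C j)).toReal := by
  have h' := innerObjective_ne_top.1 h
  rw [innerObjective_eq, ENNReal.toReal_add ENNReal.ofReal_ne_top
    (ENNReal.sum_ne_top.2 fun j _ => h' j), ENNReal.toReal_sum fun j _ => h' j,
    ENNReal.toReal_ofReal (residual_nonneg hν y)]

theorem innerObjective_subgradient (hν : ∀ r, 0 ≤ N.ν r) (hF : ∀ j, IsLossFunction (N.F j))
    {C y a : Fin m → ℝ} (hC : 0 ≤ C) (ha : 0 ≤ a) (h : N.Separates C y a) :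
    N.innerObjective C y ≠ ∞ ∧ ∀ x, N.innerObjective C x ≠ ∞ →
      (N.innerObjective C y).toReal + ∑ j, (a j - N.marginal y j) * (x j - y j)
        ≤ (N.innerObjective C x).toReal := by
  have hj := fun j => lintegral_Ioc_subgradient
    (fun z hz => util_of_neg (hF j) (hC j) hz) (ha j) (h j).1 (h j).2
  have hy : N.innerObjective C y ≠ ∞ := innerObjective_ne_top.2 fun j => (hj j).1
  refine ⟨hy, fun x hx => ?_⟩
  rw [toReal_innerObjective hν hy, toReal_innerObjective hν hx]
  have h1 := residual_subgradient hν y x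
  have h2 : ∑ j, ((utilIntegral (N.F j) (y j) (C j)).toReal + a j * (x j - y j))
      ≤ ∑ j, (utilIntegral (N.F j) (x j) (C j)).toReal :=
    Finset.sum_le_sum fun j _ => (hj j).2 _ (innerObjective_ne_top.1 hx j)
  rw [Finset.sum_add_distrib] at h2
  simp only [sub_mul, Finset.sum_sub_distrib]
  linarith

/-- A point where the carried traffic separates the utilizations is a minimizer. -/
theorem innerObjective_le_of_separates (hν : ∀ r, 0 ≤ N.ν r) (hF : ∀ j, IsLossFunction (N.F j))
    {C y : Fin m → ℝ} (hC : 0 ≤ C) (h : N.Separates C y (N.marginal y)) (x : Fin m → ℝ) :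
    N.innerObjective C y ≤ N.innerObjective C x := by
  obtain ⟨hy, H⟩ := innerObjective_subgradient hν hF hC (fun j => marginal_nonneg hν y j) h
  by_cases hx : N.innerObjective C x = ∞
  · simp [hx]
  · have := H x hx
    simp only [sub_self, zero_mul, Finset.sum_const_zero, add_zero] at this
    exact (ENNReal.toReal_le_toReal hy hx).1 this

@[fun_prop]
theorem continuous_residual : Continuous N.residual := by unfold residual; fun_prop

@[fun_prop]
theorem continuous_marginal (j : Fin m) : Continuous fun y => N.marginal y j := by
  unfold marginal; fun_prop

theorem innerObjective_update (C y : Fin m → ℝ) (j : Fin m) (t : ℝ) :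
    N.innerObjective C (Function.update y j t) =
      ENNReal.ofReal (N.residual (Function.update y j t)) +
        (utilIntegral (N.F j) t (C j) +
          ∑ l ∈ Finset.univ.erase j, utilIntegral (N.F l) (y l) (C l)) := by
  rw [innerObjective_eq, ← Finset.add_sum_erase _ _ (Finset.mem_univ j), Function.update_self]
  congr 2
  refine Finset.sum_congr rfl fun l hl => ?_
  rw [Function.update_of_ne (Finset.ne_of_mem_erase hl)]

/-- First-order condition: at a minimizer the carried traffic separates the utilizations. -/
theorem separates_of_isMin (hν : ∀ r, 0 ≤ N.ν r) (hF : ∀ j, IsLossFunction (N.F j))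
    {C y : Fin m → ℝ} (hC : 0 ≤ C) (hy : 0 ≤ y) (hfin : N.innerObjective C y ≠ ∞)
    (hmin : ∀ x, 0 ≤ x → N.innerObjective C y ≤ N.innerObjective C x) :
    N.Separates C y (N.marginal y) := by
  intro j
  set U : ℝ → ℝ≥0∞ := fun z => util (N.F j) z (C j)
  have hJ : ∀ t, utilIntegral (N.F j) t (C j) = ∫⁻ z in Ioc 0 t, U z := fun t => rfl
  have hJy : (∫⁻ z in Ioc 0 (y j), U z) ≠ ∞ := innerObjective_ne_top.1 hfin j
  have hUm : Monotone U := util_mono _ _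
  have key : ∀ t, 0 ≤ t → (∫⁻ z in Ioc 0 t, U z) ≠ ∞ →
      (∫⁻ z in Ioc 0 (y j), U z).toReal ≤
        (∫⁻ z in Ioc 0 t, U z).toReal + N.marginal (Function.update y j t) j * (y j - t) := by
    intro t ht hJt
    have h1 := hmin (Function.update y j t) (by
      intro l
      by_cases hl : l = j
      · subst hl; simpa using ht
      · simpa [hl] using hy l)
    have h0 := innerObjective_update (N := N) C y j (y j)
    rw [Function.update_eq_self] at h0
    rw [h0, innerObjective_update, hJ, hJ, ← add_assoc, ← add_assoc] at h1
    have hE : ∑ l ∈ Finset.univ.erase j, utilIntegral (N.F l) (y l) (C l) ≠ ∞ :=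
      ENNReal.sum_ne_top.2 fun l _ => innerObjective_ne_top.1 hfin l
    have h2 := ENNReal.toReal_mono (ENNReal.add_ne_top.2 ⟨ENNReal.ofReal_ne_top, hJt⟩)
      ((ENNReal.add_le_add_iff_right hE).1 h1)
    rw [ENNReal.toReal_add ENNReal.ofReal_ne_top hJy, ENNReal.toReal_add ENNReal.ofReal_ne_top hJt,
      ENNReal.toReal_ofReal (residual_nonneg hν _), ENNReal.toReal_ofReal (residual_nonneg hν _)]
      at h2
    have h3 := residual_subgradient hν (Function.update y j t) y
    rw [Finset.sum_eq_single j (fun l _ hl => by simp [hl]) (by simp), Function.update_self] at h3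
    linarith
  have hlim : Tendsto (fun t => N.marginal (Function.update y j t) j) (𝓝 (y j))
      (𝓝 (N.marginal y j)) := by
    have : Continuous fun t : ℝ => N.marginal (Function.update y j t) j :=
      (continuous_marginal j).comp (continuous_const.update j continuous_id)
    simpa using this.tendsto (y j)
  constructor
  · intro z hz
    rcases lt_or_ge z 0 with hz0 | hz0
    · rw [util_of_neg (hF j) (hC j) hz0]; exact zero_le
    have hb : ∀ t, z ≤ t → t < y j →
        U z ≠ ∞ ∧ (U z).toReal ≤ N.marginal (Function.update y j t) j := by
      intro t hzt hty
      have h1 : (∫⁻ z in Ioc 0 t, U z) + U z * ENNReal.ofReal (y j - t)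
          ≤ ∫⁻ z in Ioc 0 (y j), U z := by
        rw [lintegral_Ioc_add U (hz0.trans hzt) hty.le]
        exact add_le_add_right (le_lintegral_Ioc fun w hw => hUm (hzt.trans (le_of_lt hw))) _
      have h2 := ne_top_of_le_ne_top hJy h1
      rw [ENNReal.add_ne_top] at h2
      have hUz : U z ≠ ∞ := by
        intro h
        refine h2.2 ?_
        rw [h, ENNReal.top_mul]
        simpa using hty
      refine ⟨hUz, ?_⟩
      have h3 := ENNReal.toReal_mono hJy h1
      rw [ENNReal.toReal_add h2.1 h2.2, ENNReal.toReal_mul,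
        ENNReal.toReal_ofReal (by linarith)] at h3
      have h4 := key t (hz0.trans hzt) h2.1
      exact le_of_mul_le_mul_right (by linarith) (sub_pos.2 hty)
    change U z ≤ _
    rw [← ENNReal.ofReal_toReal (hb z le_rfl hz).1]
    refine ENNReal.ofReal_le_ofReal
      (ge_of_tendsto (hlim.mono_left (nhdsWithin_le_nhds (s := Iio (y j)))) ?_)
    filter_upwards [Ioo_mem_nhdsLT hz] with t ht
    exact (hb t ht.1.le ht.2).2
  · intro z hz
    by_cases hUz : U z = ∞
    · change _ ≤ U z
      rw [hUz]; exact le_top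
    change _ ≤ U z
    rw [← ENNReal.ofReal_toReal hUz]
    refine ENNReal.ofReal_le_ofReal
      (le_of_tendsto (hlim.mono_left (nhdsWithin_le_nhds (s := Ioi (y j)))) ?_)
    filter_upwards [Ioo_mem_nhdsGT hz] with t ht
    have h1 : (∫⁻ z in Ioc 0 t, U z)
        ≤ (∫⁻ z in Ioc 0 (y j), U z) + U z * ENNReal.ofReal (t - y j) := by
      rw [lintegral_Ioc_add U (hy j) ht.1.le]
      exact add_le_add_right (lintegral_Ioc_le fun w hw => hUm (hw.le.trans ht.2.le)) _
    have hne := ENNReal.add_ne_top.2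
      ⟨hJy, ENNReal.mul_ne_top hUz (ENNReal.ofReal_ne_top (r := t - y j))⟩
    have h3 := ENNReal.toReal_mono hne h1
    rw [ENNReal.toReal_add hJy (ENNReal.add_ne_top.1 hne).2, ENNReal.toReal_mul,
      ENNReal.toReal_ofReal (by linarith [ht.1])] at h3
    have h4 := key t ((hy j).trans ht.1.le) (ne_top_of_le_ne_top hne h1)
    exact le_of_mul_le_mul_right (by linarith) (sub_pos.2 ht.1)

/-! ### Existence of a minimizer -/

theorem innerObjective_zero (C : Fin m → ℝ) :
    N.innerObjective C 0 = ENNReal.ofReal (∑ r, N.ν r) := by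
  simp [innerObjective_eq, residual, utilIntegral]

theorem lowerSemicontinuous_innerObjective (C : Fin m → ℝ) :
    LowerSemicontinuous (N.innerObjective C) := by
  have h1 : LowerSemicontinuous fun y => ENNReal.ofReal (N.residual y) :=
    (ENNReal.continuous_ofReal.comp continuous_residual).lowerSemicontinuous
  have h2 : LowerSemicontinuous fun y : Fin m → ℝ =>
      ∑ j, utilIntegral (N.F j) (y j) (C j) :=
    lowerSemicontinuous_sum fun j _ =>
      (lowerSemicontinuous_lintegral_Ioc _).comp (continuous_apply j)
  exact h1.add h2

/-- The minimum is attained if every entity `j` either has some utilization, or is used by no flow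
of positive load. In the former case the integral of its utilization is unbounded, in the latter
case the objective is smallest at `y j = 0`, so the minimum can be taken over a box. -/
theorem exists_isMin (C : Fin m → ℝ)
    (h : ∀ j, (∃ ρ > 0, N.F j ρ (C j) < 1) ∨ ∀ r, N.ν r = 0 ∨ N.A j r = 0) :
    ∃ y, 0 ≤ y ∧ N.innerObjective C y ≠ ∞ ∧
      ∀ x, 0 ≤ x → N.innerObjective C y ≤ N.innerObjective C x := by
  classical
  have hM : ∀ j, ∃ M, 0 ≤ M ∧ ((∃ ρ > 0, N.F j ρ (C j) < 1) →
      N.innerObjective C 0 < utilIntegral (N.F j) M (C j)) := by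
    intro j
    by_cases hj : ∃ ρ > 0, N.F j ρ (C j) < 1
    swap
    · exact ⟨0, le_rfl, fun h => absurd h hj⟩
    obtain ⟨z, hz⟩ := exists_util_pos hj
    obtain ⟨k, hk⟩ := ENNReal.exists_nat_mul_gt hz.ne'
      (show N.innerObjective C 0 ≠ ∞ by rw [innerObjective_zero]; exact ENNReal.ofReal_ne_top)
    have h0 : 0 ≤ max z 0 := le_max_right _ _
    refine ⟨max z 0 + k, by positivity, fun _ => hk.trans_le ?_⟩
    have h1 := le_lintegral_Ioc (U := fun z => util (N.F j) z (C j)) (a := max z 0)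
      (b := max z 0 + k) (M := util (N.F j) z (C j))
      fun w hw => util_mono _ _ ((le_max_left z 0).trans (le_of_lt hw))
    rw [add_sub_cancel_left, ENNReal.ofReal_natCast, mul_comm] at h1
    exact h1.trans (lintegral_mono_set (Ioc_subset_Ioc_left h0))
  choose M hM0 hM using hM
  obtain ⟨y, hy, hmin⟩ := LowerSemicontinuousOn.exists_isMinOn (s := Icc 0 M)
    ⟨0, le_rfl, hM0⟩ isCompact_Icc
    ((lowerSemicontinuous_innerObjective (N := N) C).lowerSemicontinuousOn _)
  have hy0 : N.innerObjective C y ≤ N.innerObjective C 0 := hmin ⟨le_rfl, hM0⟩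
  refine ⟨y, hy.1, ne_top_of_le_ne_top ENNReal.ofReal_ne_top
    (hy0.trans (innerObjective_zero C).le), fun x hx => ?_⟩
  by_cases hxM : ∃ j, (∃ ρ > 0, N.F j ρ (C j) < 1) ∧ M j < x j
  · obtain ⟨j, hjU, hj⟩ := hxM
    refine hy0.trans ((hM j hjU).le.trans ?_)
    calc utilIntegral (N.F j) (M j) (C j) ≤ utilIntegral (N.F j) (x j) (C j) :=
          lintegral_Ioc_mono _ hj.le
      _ ≤ ∑ l, utilIntegral (N.F l) (x l) (C l) :=
          Finset.single_le_sum (f := fun l => utilIntegral (N.F l) (x l) (C l))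
            (fun _ _ => zero_le) (Finset.mem_univ j)
      _ ≤ _ := le_add_self
  · push Not at hxM
    set x' : Fin m → ℝ := fun j => if ∃ ρ > 0, N.F j ρ (C j) < 1 then x j else 0 with hx'
    have h1 : N.innerObjective C x' ≤ N.innerObjective C x := by
      rw [innerObjective_eq, innerObjective_eq]
      refine add_le_add (ENNReal.ofReal_le_ofReal (le_of_eq ?_))
        (Finset.sum_le_sum fun j _ => lintegral_Ioc_mono _ ?_)
      · refine Finset.sum_congr rfl fun r _ => ?_
        by_cases hr : N.ν r = 0
        · simp [hr]
        congr 3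
        refine Finset.sum_congr rfl fun j _ => ?_
        by_cases hj : ∃ ρ > 0, N.F j ρ (C j) < 1
        · rw [hx']; simp only [if_pos hj]
        · rw [(((h j).resolve_left hj) r).resolve_left hr]; simp
      · by_cases hj : ∃ ρ > 0, N.F j ρ (C j) < 1
        · rw [hx']; simp only [if_pos hj]; exact le_rfl
        · rw [hx']; simp only [if_neg hj]; exact hx j
    refine (hmin ⟨fun j => ?_, fun j => ?_⟩).trans h1
    · by_cases hj : ∃ ρ > 0, N.F j ρ (C j) < 1
      · rw [hx']; simp only [if_pos hj]; exact hx j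
      · rw [hx']; simp only [if_neg hj]; exact le_rfl
    · by_cases hj : ∃ ρ > 0, N.F j ρ (C j) < 1
      · rw [hx']; simp only [if_pos hj]; exact hxM j hj
      · rw [hx']; simp only [if_neg hj]; exact hM0 j

/-! ### The function `φ` -/

theorem iInf_innerObjective_ne_top (C : Fin m → ℝ) :
    (⨅ y ∈ Ici (0 : Fin m → ℝ), N.innerObjective C y) ≠ ∞ :=
  ne_top_of_le_ne_top (by rw [innerObjective_zero]; exact ENNReal.ofReal_ne_top)
    (iInf₂_le (0 : Fin m → ℝ) (self_mem_Ici))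

theorem ofReal_phi (C : Fin m → ℝ) : ENNReal.ofReal (N.phi C) =
    ⨅ y ∈ Ici (0 : Fin m → ℝ), N.innerObjective C y :=
  ENNReal.ofReal_toReal (iInf_innerObjective_ne_top C)

theorem phi_nonneg (C : Fin m → ℝ) : 0 ≤ N.phi C := ENNReal.toReal_nonneg

theorem ofReal_phi_le {C y : Fin m → ℝ} (hy : 0 ≤ y) :
    ENNReal.ofReal (N.phi C) ≤ N.innerObjective C y := by
  rw [ofReal_phi]; exact iInf₂_le y hy

theorem phi_le_sum (hν : ∀ r, 0 ≤ N.ν r) (C : Fin m → ℝ) : N.phi C ≤ ∑ r, N.ν r := by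
  have h := ofReal_phi_le (N := N) (C := C) le_rfl
  rw [innerObjective_zero] at h
  exact (ENNReal.ofReal_le_ofReal_iff (Finset.sum_nonneg fun r _ => hν r)).1 h

theorem isLeast_phi {C : Fin m → ℝ} (h : ∀ j, ∃ ρ > 0, N.F j ρ (C j) < 1) :
    IsLeast (N.innerObjective C '' Ici 0) (ENNReal.ofReal (N.phi C)) := by
  obtain ⟨y, hy, -, hmin⟩ := exists_isMin C fun j => Or.inl (h j)
  have : ENNReal.ofReal (N.phi C) = N.innerObjective C y :=
    le_antisymm (ofReal_phi_le hy) (by rw [ofReal_phi]; exact le_iInf₂ hmin)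
  rw [this]
  refine ⟨⟨y, hy, rfl⟩, ?_⟩
  rintro _ ⟨x, hx, rfl⟩
  exact hmin x hx

/-- As the offered loads of the flows do not grow with the capacities, `φ` is bounded by their sum,
and its asymptotic slope vanishes. -/
theorem asymptoticallyConcave_phi (hν : ∀ r, 0 ≤ N.ν r) : AsymptoticallyConcave N.phi := by
  refine ⟨fun _ => 0, fun x _ => ?_, concaveOn_const 0 (convex_Ici 1)⟩
  refine squeeze_zero (g := fun k : ℕ => (1 / (k : ℝ)) * ∑ r, N.ν r)
    (fun k => mul_nonneg (by positivity) (phi_nonneg _))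
    (fun k => mul_le_mul_of_nonneg_left (phi_le_sum hν _) (by positivity)) ?_
  simpa using tendsto_one_div_atTop_nhds_zero_nat.mul_const (∑ r, N.ν r)

/-! ### Fixed points and minimizers -/

open Classical in
/-- The network in which the flows that use an entity of the set `D` have no load. -/
def cut (N : Network m n R) (D : Set (Fin m)) : Network m n R :=
  { N with ν := fun r => if ∃ j ∈ D, N.A j r ≠ 0 then 0 else N.ν r }

theorem cut_load_nonneg (hν : ∀ r, 0 ≤ N.ν r) (D : Set (Fin m)) (r : Fin R) :
    0 ≤ (N.cut D).ν r := by
  simp only [cut]; split_ifs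
  · exact le_rfl
  · exact hν r

theorem cut_load_le (hν : ∀ r, 0 ≤ N.ν r) (D : Set (Fin m)) (r : Fin R) :
    (N.cut D).ν r ≤ N.ν r := by
  simp only [cut]; split_ifs
  · exact hν r
  · exact le_rfl

theorem cut_load_of_mem {D : Set (Fin m)} {j : Fin m} (hj : j ∈ D) {r : Fin R}
    (h : N.A j r ≠ 0) : (N.cut D).ν r = 0 := if_pos ⟨j, hj, h⟩

theorem innerObjective_cut_le (hν : ∀ r, 0 ≤ N.ν r) (D : Set (Fin m)) (C y : Fin m → ℝ) :
    (N.cut D).innerObjective C y ≤ N.innerObjective C y := by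
  rw [innerObjective_eq, innerObjective_eq]
  refine add_le_add_left (ENNReal.ofReal_le_ofReal (Finset.sum_le_sum fun r _ => ?_)) _
  exact mul_le_mul_of_nonneg_right (cut_load_le hν D r) (Real.exp_pos _).le

theorem flowCarried_eq_cut {D : Set (Fin m)} {C ρ y : Fin m → ℝ} (r : Fin R)
    (hD : ∀ j ∈ D, N.F j (ρ j) (C j) = 1)
    (hy : (N.cut D).ν r ≠ 0 → ∀ j ∉ D, N.A j r ≠ 0 →
      1 - N.F j (ρ j) (C j) = Real.exp (-y j)) :
    N.flowCarried C ρ r = (N.cut D).ν r * Real.exp (-∑ j, y j * N.A j r) := by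
  by_cases h : ∃ j ∈ D, N.A j r ≠ 0
  · obtain ⟨j, hj, hA⟩ := h
    rw [cut_load_of_mem hj hA, flowCarried, Finset.prod_eq_zero (Finset.mem_univ j)]
    · simp
    · rw [hD j hj, sub_self, zero_pow hA]
  · have hν : (N.cut D).ν r = N.ν r := if_neg h
    by_cases h0 : (N.cut D).ν r = 0
    · rw [h0, flowCarried, ← hν, h0]; simp
    rw [hν, flowCarried, ← Finset.sum_neg_distrib, Real.exp_sum]
    congr 1
    refine Finset.prod_congr rfl fun j _ => ?_
    by_cases hA : N.A j r = 0
    · simp [hA]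
    · rw [hy h0 j (fun hj => h ⟨j, hj, hA⟩) hA, ← Real.exp_nat_mul]
      congr 1; ring

/-- At every solution of the fixed-point equations the modified objective is `φ`. The fixed-point
equations say that the logarithmic losses `y` satisfy the first-order conditions of the convex
problem that defines `φ`. Entities that lose everything have `y j = ∞`; they are dealt with by
removing the flows that use them, and approached by letting `y j` tend to infinity. -/
theorem modifiedT_eq_phi (hN : N.Valid) {C ρ : Fin m → ℝ} (hC : 0 ≤ C) (hρ : 0 ≤ ρ)
    (h : N.FixedPoint C ρ) : N.modifiedT C ρ = ENNReal.ofReal (N.phi C) := by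
  classical
  set D : Set (Fin m) := {j | N.F j (ρ j) (C j) = 1}
  have hU0 : ∀ j ∈ D, ∀ z, util (N.F j) z (C j) = 0 := fun j hj z =>
    util_eq_zero_of_loss_eq_one (hN.loss j) (hN.util_increasing j) (hC j) (hρ j) hj z
  have hlt : ∀ j ∉ D, N.F j (ρ j) (C j) < 1 := fun j hj =>
    lt_of_le_of_ne ((hN.loss j).le_one _ _ (hρ j) (hC j)) hj
  set y : Fin m → ℝ := fun j => if j ∈ D then 0 else -Real.log (1 - N.F j (ρ j) (C j))
  have hyD : ∀ j ∈ D, y j = 0 := fun j hj => if_pos hj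
  have hyn : ∀ j ∉ D, y j = -Real.log (1 - N.F j (ρ j) (C j)) := fun j hj => if_neg hj
  have hexp : ∀ j ∉ D, Real.exp (-y j) = 1 - N.F j (ρ j) (C j) := fun j hj => by
    rw [hyn j hj, neg_neg, Real.exp_log (by linarith [hlt j hj])]
  have hflow : ∀ r, N.flowCarried C ρ r =
      (N.cut D).ν r * Real.exp (-∑ j, y j * N.A j r) := fun r =>
    flowCarried_eq_cut r (fun j hj => hj) fun _ j hj _ => (hexp j hj).symm
  have hres : (N.cut D).residual y = N.T C ρ :=
    Finset.sum_congr rfl fun r _ => (hflow r).symm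
  have hmarg : ∀ j, (N.cut D).marginal y j = carriedLoad (N.F j) (C j) (ρ j) := fun j => by
    rw [carriedLoad, h j]
    exact Finset.sum_congr rfl fun r _ => by rw [hflow r]; rfl
  have hsep : (N.cut D).Separates C y ((N.cut D).marginal y) := by
    intro j
    rw [hmarg j]
    change (∀ z < y j, util (N.F j) z (C j) ≤ _) ∧ ∀ z > y j, _ ≤ util (N.F j) z (C j)
    by_cases hj : j ∈ D
    · have h0 : carriedLoad (N.F j) (C j) (ρ j) = 0 := by
        rw [carriedLoad, show N.F j (ρ j) (C j) = 1 from hj]; simp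
      simp [hU0 j hj, h0]
    · refine ⟨fun z hz => ?_, fun z hz => ?_⟩
      · refine util_le_carriedLoad (hN.loss j) (hN.util_increasing j) (hC j) (hρ j) ?_
        have := Real.exp_lt_exp.2 (neg_lt_neg hz)
        rw [hexp j hj] at this
        linarith
      · refine le_util (hρ j) ?_
        have := Real.exp_lt_exp.2 (neg_lt_neg hz)
        rw [hexp j hj] at this
        linarith
  have hobj : (N.cut D).innerObjective C y = N.modifiedT C ρ := by
    rw [innerObjective_eq, hres, modifiedT]
    congr 1
    refine Finset.sum_congr rfl fun j _ => ?_
    change utilIntegral (N.F j) (y j) (C j) = _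
    by_cases hj : j ∈ D
    · rw [utilMeasure, if_pos (show N.F j (ρ j) (C j) = 1 from hj), utilIntegral]
      simp [hU0 j hj]
    · rw [utilMeasure, if_neg (show ¬ N.F j (ρ j) (C j) = 1 from hj), hyn j hj]
  refine le_antisymm ?_ ?_
  · rw [ofReal_phi, ← hobj]
    exact le_iInf₂ fun x _ => (innerObjective_le_of_separates (cut_load_nonneg hN.load_nonneg D)
      hN.loss hC hsep x).trans (innerObjective_cut_le hN.load_nonneg D C x)
  · -- The losses of the entities in `D` are set to `t`, and `t` tends to infinity.
    have hlim : Tendsto (fun t : ℝ => N.modifiedT C ρ +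
        ENNReal.ofReal ((∑ r, N.ν r) * Real.exp (-t))) atTop (𝓝 (N.modifiedT C ρ)) := by
      have h1 : Tendsto (fun t : ℝ => (∑ r, N.ν r) * Real.exp (-t)) atTop (𝓝 0) := by
        simpa using Real.tendsto_exp_neg_atTop_nhds_zero.const_mul (∑ r, N.ν r)
      have h2 := (ENNReal.tendsto_ofReal h1).const_add (N.modifiedT C ρ)
      simpa using h2
    refine ge_of_tendsto hlim ?_
    filter_upwards [eventually_ge_atTop 0] with t ht
    set x : Fin m → ℝ := fun j => if j ∈ D then t else y j with hx
    have hxD : ∀ j ∈ D, x j = t := fun j hj => if_pos hj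
    have hxn : ∀ j ∉ D, x j = y j := fun j hj => if_neg hj
    have hx0 : 0 ≤ x := by
      intro j
      by_cases hj : j ∈ D
      · rw [hxD j hj]; exact ht
      · rw [hxn j hj, hyn j hj]
        have := Real.log_nonpos (x := 1 - N.F j (ρ j) (C j)) (by linarith [hlt j hj])
          (by linarith [(hN.loss j).nonneg _ _ (hρ j) (hC j)])
        change (0 : ℝ) ≤ _
        linarith
    refine (ofReal_phi_le hx0).trans ?_
    rw [← hobj, innerObjective_eq, innerObjective_eq, add_right_comm,
      ← ENNReal.ofReal_add (residual_nonneg (cut_load_nonneg hN.load_nonneg D) y)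
        (mul_nonneg (Finset.sum_nonneg fun r _ => hN.load_nonneg r) (Real.exp_pos _).le)]
    refine add_le_add (ENNReal.ofReal_le_ofReal ?_) (Finset.sum_le_sum fun j _ => ?_)
    · rw [residual, residual, Finset.sum_mul, ← Finset.sum_add_distrib]
      refine Finset.sum_le_sum fun r _ => ?_
      by_cases hr : ∃ j ∈ D, N.A j r ≠ 0
      · obtain ⟨j, hj, hA⟩ := hr
        rw [cut_load_of_mem hj hA, zero_mul, zero_add]
        refine mul_le_mul_of_nonneg_left (Real.exp_le_exp.2 (neg_le_neg ?_)) (hN.load_nonneg r)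
        calc t = x j * 1 := by rw [hxD j hj, mul_one]
          _ ≤ x j * N.A j r := mul_le_mul_of_nonneg_left
              (by exact_mod_cast Nat.one_le_iff_ne_zero.2 hA) (hx0 j)
          _ ≤ _ := Finset.single_le_sum (f := fun l => x l * (N.A l r : ℝ))
              (fun l _ => mul_nonneg (hx0 l) (Nat.cast_nonneg _)) (Finset.mem_univ j)
      · have hν : (N.cut D).ν r = N.ν r := if_neg hr
        have : ∑ j, x j * (N.A j r : ℝ) = ∑ j, y j * ((N.cut D).A j r : ℝ) := by
          refine Finset.sum_congr rfl fun j _ => ?_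
          change _ = y j * (N.A j r : ℝ)
          by_cases hj : j ∈ D
          · have : N.A j r = 0 := by_contra fun hA => hr ⟨j, hj, hA⟩
            simp [this]
          · rw [hxn j hj]
        rw [this, hν]
        exact le_add_of_nonneg_right (mul_nonneg (hN.load_nonneg r) (Real.exp_pos _).le)
    · change _ ≤ utilIntegral (N.F j) (y j) (C j)
      by_cases hj : j ∈ D
      · rw [utilIntegral]; simp [hU0 j hj]
      · rw [hxn j hj]

/-- The fixed-point equations have a solution. A minimizer of the inner objective gives the losses
and the carried loads of the entities, hence their offered loads; entities that lose everything are
first removed together with the flows that use them. -/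
theorem exists_fixedPoint (hN : N.Valid) {C : Fin m → ℝ} (hC : 0 ≤ C) :
    ∃ ρ, 0 ≤ ρ ∧ N.FixedPoint C ρ := by
  classical
  set D : Set (Fin m) := {j | ¬ ∃ ρ > 0, N.F j ρ (C j) < 1}
  have hD1 : ∀ j ∈ D, N.F j 1 (C j) = 1 := fun j hj =>
    le_antisymm ((hN.loss j).le_one _ _ zero_le_one (hC j))
      (not_lt.1 fun h => hj ⟨1, one_pos, h⟩)
  have hν' := cut_load_nonneg hN.load_nonneg D
  obtain ⟨y, hy, hfin, hmin⟩ := exists_isMin (N := N.cut D) C fun j => by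
    by_cases hj : j ∈ D
    · refine Or.inr fun r => ?_
      by_cases hA : N.A j r = 0
      · exact Or.inr hA
      · exact Or.inl (cut_load_of_mem hj hA)
    · exact Or.inl (not_not.1 hj)
  have hsep := separates_of_isMin hν' hN.loss hC hy hfin hmin
  set a := (N.cut D).marginal y
  have ha : ∀ j, 0 ≤ a j := fun j => marginal_nonneg hν' y j
  have haD : ∀ j ∈ D, a j = 0 := fun j hj => Finset.sum_eq_zero fun r _ => by
    by_cases hA : N.A j r = 0
    · change ((N.A j r : ℕ) : ℝ) * _ = 0
      simp [hA]
    · rw [cut_load_of_mem hj hA]; simp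
  set ρ : Fin m → ℝ := fun j => if j ∈ D then 1 else a j * Real.exp (y j)
  have hρD : ∀ j ∈ D, ρ j = 1 := fun j hj => if_pos hj
  have hρn : ∀ j ∉ D, ρ j = a j * Real.exp (y j) := fun j hj => if_neg hj
  have hF : ∀ j, 0 < a j → N.F j (ρ j) (C j) = 1 - Real.exp (-y j) := fun j hj => by
    rw [hρn j fun h => hj.ne' (haD j h)]
    exact loss_eq_of_separates (hN.loss j) (hN.util_increasing j) (hC j) hj
      (hsep j).1 (hsep j).2
  refine ⟨ρ, fun j => ?_, fun j => ?_⟩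
  · by_cases hj : j ∈ D
    · rw [hρD j hj]; exact zero_le_one
    · rw [hρn j hj]; exact mul_nonneg (ha j) (Real.exp_pos _).le
  · have hflow : ∀ r, N.flowCarried C ρ r =
        (N.cut D).ν r * Real.exp (-∑ j, y j * N.A j r) := fun r => by
      refine flowCarried_eq_cut r (fun j hj => by rw [hρD j hj, hD1 j hj]) fun h0 j _ hA => ?_
      rw [hF j, sub_sub_cancel]
      have hpos : 0 < (N.A j r : ℝ) * ((N.cut D).ν r * Real.exp (-∑ l, y l * N.A l r)) :=
        mul_pos (Nat.cast_pos.2 (Nat.pos_of_ne_zero hA))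
          (mul_pos (lt_of_le_of_ne (hν' r) h0.symm) (Real.exp_pos _))
      exact hpos.trans_le (Finset.single_le_sum
        (f := fun r => (N.A j r : ℝ) * ((N.cut D).ν r * Real.exp (-∑ l, y l * N.A l r)))
        (fun r _ => mul_nonneg (Nat.cast_nonneg _) (mul_nonneg (hν' r) (Real.exp_pos _).le))
        (Finset.mem_univ r))
    have hsum : ∑ r, (N.A j r : ℝ) * N.flowCarried C ρ r = a j :=
      Finset.sum_congr rfl fun r _ => by rw [hflow r]; rfl
    rw [hsum]
    rcases (ha j).eq_or_lt with h0 | h0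
    · by_cases hj : j ∈ D
      · rw [hρD j hj, hD1 j hj, ← h0]; simp
      · rw [hρn j hj, ← h0]; simp
    · rw [hF j h0, hρn j fun h => h0.ne' (haD j h), sub_sub_cancel, mul_assoc, ← Real.exp_add]
      simp

theorem isModifiedOptimal_of_isMaxOn (hN : N.Valid) {C : Fin m → ℝ} (hC : C ∈ N.polytope)
    (hmax : IsMaxOn N.phi N.polytope C) : N.IsModifiedOptimal C := by
  obtain ⟨ρ, hρ, hfix⟩ := exists_fixedPoint hN hC.2
  refine ⟨⟨ρ, hC, hρ, hfix⟩, fun σ hσ C' ρ' h' => ?_⟩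
  rw [modifiedT_eq_phi hN hC.2 hσ.2.1 hσ.2.2, modifiedT_eq_phi hN h'.1.2 h'.2.1 h'.2.2]
  exact ENNReal.ofReal_le_ofReal (hmax h'.1)

end Network

/-! ### Shrinking simplices -/

/-- The sum over the permutations in the determinant is part of the expansion of the product of the
row sums. -/
theorem abs_det_le_prod_sum {ι : Type*} [Fintype ι] [DecidableEq ι] (A : Matrix ι ι ℝ) :
    |A.det| ≤ ∏ i, ∑ j, |A i j| := by
  rw [← Matrix.det_transpose, Matrix.det_apply']
  refine (Finset.abs_sum_le_sum_abs _ _).trans ?_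
  rw [Finset.prod_univ_sum]
  have h1 : ∀ σ : Equiv.Perm ι,
      |((Equiv.Perm.sign σ : ℤ) : ℝ) * ∏ i, A.transpose (σ i) i| = ∏ i, |A i (σ i)| := by
    intro σ
    rw [abs_mul, Finset.abs_prod]
    rcases Int.units_eq_one_or (Equiv.Perm.sign σ) with h | h <;> simp [h]
  rw [Finset.sum_congr rfl fun σ _ => h1 σ]
  have h2 : ∑ σ : Equiv.Perm ι, ∏ i, |A i (σ i)| =
      ∑ f ∈ Finset.univ.map ⟨fun σ : Equiv.Perm ι => (σ : ι → ι), DFunLike.coe_injective⟩,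
        ∏ i, |A i (f i)| := by
    rw [Finset.sum_map]; rfl
  rw [h2]
  refine Finset.sum_le_sum_of_subset_of_nonneg (fun f _ => ?_)
    fun f _ _ => Finset.prod_nonneg fun i _ => abs_nonneg _
  simp

section Simplex

variable {m : ℕ}

/-- The matrix whose rows are the vertices of a simplex in homogeneous coordinates. Its determinant
is, up to a constant factor, the volume of the simplex. -/
def homMatrix (v : Fin (m + 1) → Fin m → ℝ) : Matrix (Fin (m + 1)) (Fin (m + 1)) ℝ :=
  Matrix.of fun i => Fin.cons 1 (v i)

/-- The point `p` is a convex combination of the vertices `v i`. -/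
def InSimplex (v : Fin (m + 1) → Fin m → ℝ) (p : Fin m → ℝ) : Prop :=
  ∃ w : Fin (m + 1) → ℝ, (∀ i, 0 ≤ w i) ∧ ∑ i, w i = 1 ∧ ∀ j, ∑ i, w i * v i j = p j

/-- The vertices of a right-angled simplex with legs `η` in the coordinate directions. -/
def corner (b : Fin m → ℝ) (η : ℝ) (i : Fin (m + 1)) (l : Fin m) : ℝ :=
  b l + if i = l.succ then η else 0

theorem det_homMatrix_corner (b : Fin m → ℝ) (η : ℝ) : (homMatrix (corner b η)).det = η ^ m := by
  set B : Matrix (Fin (m + 1)) (Fin (m + 1)) ℝ := Matrix.of fun i =>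
    Fin.cons (if i = 0 then 1 else 0)
      (fun l => if i = 0 then b l else if i = l.succ then η else 0) with hB
  have h1 : (homMatrix (corner b η)).det = B.det := by
    refine Matrix.det_eq_of_forall_row_eq_smul_add_const (fun i => if i = 0 then 0 else 1) 0
      (by simp) fun i j => ?_
    refine Fin.cases ?_ (fun l => ?_) j
    · by_cases hi : i = 0 <;> simp [homMatrix, hB, hi]
    · by_cases hi : i = 0
      · subst hi
        have h0 : ¬ (0 : Fin (m + 1)) = l.succ := (Fin.succ_ne_zero l).symm
        simp [homMatrix, hB, corner, h0]
      · simp [homMatrix, hB, corner, hi, add_comm]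
  rw [h1, Matrix.det_of_isUpperTriangular]
  · simp [Fin.prod_univ_succ, hB]
  · intro i j hij
    change j < i at hij
    have hi : i ≠ 0 := fun h => by subst h; exact absurd hij (Fin.not_lt_zero j)
    revert hij
    refine Fin.cases ?_ (fun l => ?_) j
    · intro _; simp [hB, hi]
    · intro hij
      simp [hB, hi, hij.ne']

/-- A simplex that contains a right-angled simplex with legs `η` is at least as large. -/
theorem pow_le_abs_det_homMatrix {v : Fin (m + 1) → Fin m → ℝ} {b : Fin m → ℝ} {η : ℝ} (hη : 0 ≤ η)
    (h : ∀ i, InSimplex v (corner b η i)) : η ^ m ≤ |(homMatrix v).det| := by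
  choose w hw0 hw1 hw using h
  have hmul : homMatrix (corner b η) = Matrix.of w * homMatrix v := by
    ext i j
    rw [Matrix.mul_apply]
    refine Fin.cases ?_ (fun l => ?_) j
    · simp [homMatrix, hw1]
    · simp [homMatrix, hw]
  have h1 := det_homMatrix_corner b η
  rw [hmul, Matrix.det_mul] at h1
  have h2 : |(Matrix.of w).det| ≤ 1 := by
    refine (abs_det_le_prod_sum _).trans (le_of_eq ?_)
    refine Finset.prod_eq_one fun i _ => ?_
    rw [← hw1 i]
    exact Finset.sum_congr rfl fun j _ => abs_of_nonneg (hw0 i j)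
  rw [← abs_of_nonneg (pow_nonneg hη m), ← h1, abs_mul]
  exact mul_le_of_le_one_left (abs_nonneg _) h2

theorem det_homMatrix_contract (v : Fin (m + 1) → Fin m → ℝ) (k : Fin (m + 1))
    (t : Fin (m + 1) → ℝ) (ht : ∀ i, t i ≠ 0) :
    (homMatrix fun i j => v k j + (v i j - v k j) * t i).det =
      (∏ i ∈ Finset.univ.erase k, t i) * (homMatrix v).det := by
  set t' : Fin (m + 1) → ℝ := Function.update t k 1 with ht'
  have ht'0 : ∀ i, t' i ≠ 0 := fun i => by
    by_cases hi : i = k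
    · subst hi; simp [ht']
    · simp [ht', hi, ht i]
  set B : Matrix (Fin (m + 1)) (Fin (m + 1)) ℝ := Matrix.of fun i j =>
    homMatrix v i j + ((1 - t' i) / t' i) * homMatrix v k j with hB
  have h1 : (homMatrix fun i j => v k j + (v i j - v k j) * t i) =
      Matrix.of fun i j => t' i * B i j := by
    ext i j
    rw [hB]
    have e := ht'0 i
    refine Fin.cases ?_ (fun l => ?_) j
    · simp only [homMatrix, Matrix.of_apply, Fin.cons_zero]
      field_simp; ring
    · simp only [homMatrix, Matrix.of_apply, Fin.cons_succ]
      by_cases hi : i = k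
      · subst hi; simp [ht']
      · have : t' i = t i := by simp [ht', hi]
        rw [this] at e ⊢
        field_simp; ring
  rw [h1, Matrix.det_mul_column t' B,
    Matrix.det_eq_of_forall_row_eq_smul_add_const (A := B) (B := homMatrix v)
      (fun i => (1 - t' i) / t' i) k (by simp [ht']) fun i j => rfl,
    ← Finset.mul_prod_erase _ _ (Finset.mem_univ k)]
  congr 1
  rw [show t' k = 1 by simp [ht'], one_mul]
  refine Finset.prod_congr rfl fun i hi => ?_
  simp [ht', Finset.ne_of_mem_erase hi]

/-- The simplex contracted towards its vertex `k` still contains the points of the half simplex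
`∑ i, w i * β i ≤ 0`: add `s` times this inequality to the inequality `w k ≥ 0`. -/
theorem InSimplex.contract {v : Fin (m + 1) → Fin m → ℝ} {k : Fin (m + 1)} {s : ℝ}
    {β : Fin (m + 1) → ℝ} (hs0 : 0 ≤ s) (hs1 : s < 1) (hβ : ∀ i, -1 ≤ β i) (hk : β k = -1)
    {p : Fin m → ℝ} {w : Fin (m + 1) → ℝ} (hw0 : ∀ i, 0 ≤ w i) (hw1 : ∑ i, w i = 1)
    (hwp : ∀ j, ∑ i, w i * v i j = p j) (hwβ : ∑ i, w i * β i ≤ 0) :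
    InSimplex (fun i j => v k j + (v i j - v k j) * (1 / (1 + s * β i))) p := by
  have hpos : ∀ i, 0 < 1 + s * β i := fun i => by nlinarith [hβ i]
  set u : Fin (m + 1) → ℝ := fun i => w i * (1 + s * β i) with hu
  have hu0 : ∀ i, 0 ≤ u i := fun i => mul_nonneg (hw0 i) (hpos i).le
  have husum : ∑ i, u i = 1 + s * ∑ i, w i * β i := by
    rw [← hw1, Finset.mul_sum, ← Finset.sum_add_distrib]
    exact Finset.sum_congr rfl fun i _ => by rw [hu]; ring
  refine ⟨fun i => u i + if i = k then 1 - ∑ i, u i else 0, fun i => ?_, ?_, fun j => ?_⟩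
  · have : 0 ≤ 1 - ∑ i, u i := by rw [husum]; nlinarith
    dsimp only
    split_ifs
    · exact add_nonneg (hu0 i) this
    · simpa using hu0 i
  · simp [Finset.sum_add_distrib]
  · have h1 : ∀ i, (u i + if i = k then 1 - ∑ i, u i else 0) *
        (v k j + (v i j - v k j) * (1 / (1 + s * β i))) =
        u i * v k j + (w i * v i j - w i * v k j) + if i = k then (1 - ∑ i, u i) * v k j else 0 := by
      intro i
      have h2 : u i * (1 / (1 + s * β i)) = w i := by
        rw [hu]; have := (hpos i).ne'; field_simp
      split_ifs with hi
      · subst hi; rw [sub_self]; ring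
      · rw [add_zero, add_zero, mul_add, ← h2]; ring
    rw [Finset.sum_congr rfl fun i _ => h1 i, Finset.sum_add_distrib, Finset.sum_add_distrib,
      Finset.sum_sub_distrib, ← Finset.sum_mul, ← Finset.sum_mul, hw1, hwp]
    simp
    ring

/-- The contraction factors of the volume. The quantity `β i` lies between `-1` and `m`, which
bounds its squares. -/
theorem exp_le_prod_contract {k : Fin (m + 1)} {s : ℝ} {β : Fin (m + 1) → ℝ}
    (hs : s = 1 / (8 * ((m : ℝ) + 1) ^ 2)) (hβ : ∀ i, -1 ≤ β i) (hk : β k = -1)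
    (hsum : ∑ i, β i = 0) :
    Real.exp (s / 2) ≤ ∏ i ∈ Finset.univ.erase k, (1 + s * β i) := by
  have hm : (0 : ℝ) ≤ m := Nat.cast_nonneg m
  have hs0 : 0 < s := by rw [hs]; positivity
  have hs8 : s * (8 * ((m : ℝ) + 1) ^ 2) = 1 := by rw [hs]; field_simp
  have hs1 : s ≤ 1 / 8 := by nlinarith [mul_nonneg hs0.le hm, mul_nonneg hs0.le (mul_nonneg hm hm)]
  have hsum' : ∑ i ∈ Finset.univ.erase k, β i = 1 := by
    have := Finset.add_sum_erase Finset.univ β (Finset.mem_univ k)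
    rw [hsum, hk] at this
    linarith
  have hcard : ((Finset.univ.erase k).card : ℝ) = m := by
    rw [Finset.card_erase_of_mem (Finset.mem_univ k)]; simp
  have hup : ∀ i ∈ Finset.univ.erase k, β i ≤ m := by
    intro i hi
    have h1 := Finset.add_sum_erase _ β hi
    have h2 : ∑ l ∈ (Finset.univ.erase k).erase i, (-1 : ℝ) ≤
        ∑ l ∈ (Finset.univ.erase k).erase i, β l := Finset.sum_le_sum fun l _ => hβ l
    have h3 : (((Finset.univ.erase k).erase i).card : ℝ) + 1 = m := by
      rw [← hcard]
      exact_mod_cast Finset.card_erase_add_one hi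
    rw [Finset.sum_const, nsmul_eq_mul] at h2
    linarith
  have hfac : ∀ i ∈ Finset.univ.erase k,
      Real.exp (s * β i - 2 * s ^ 2 * ((m - 1) * β i + m)) ≤ 1 + s * β i := by
    intro i hi
    have hx : -(1 / 8) ≤ s * β i := by nlinarith [hβ i]
    have hpos : 0 < 1 + s * β i := by linarith
    have hsq : β i ^ 2 ≤ (m - 1) * β i + m := by nlinarith [hβ i, hup i hi]
    rw [← Real.le_log_iff_exp_le hpos]
    refine le_trans ?_ (Real.one_sub_inv_le_log_of_pos hpos)
    -- `log (1 + x) ≥ x - 2 x ^ 2` for `x ≥ -1/2`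
    have h1 : (s * β i) - 2 * (s * β i) ^ 2 ≤ 1 - (1 + s * β i)⁻¹ := by
      rw [← sub_nonneg]
      have : 1 - (1 + s * β i)⁻¹ - (s * β i - 2 * (s * β i) ^ 2) =
          (s * β i) ^ 2 * (1 + 2 * (s * β i)) / (1 + s * β i) := by
        field_simp; ring
      rw [this]
      exact div_nonneg (mul_nonneg (sq_nonneg _) (by linarith)) hpos.le
    nlinarith [mul_le_mul_of_nonneg_left hsq (sq_nonneg s)]
  refine le_trans ?_ (Finset.prod_le_prod (fun i _ => (Real.exp_pos _).le) hfac)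
  rw [← Real.exp_sum, Real.exp_le_exp, Finset.sum_sub_distrib, ← Finset.mul_sum, ← Finset.mul_sum,
    Finset.sum_add_distrib, ← Finset.mul_sum, hsum', Finset.sum_const, nsmul_eq_mul, hcard]
  nlinarith [mul_nonneg hs0.le hm, mul_nonneg hs0.le (mul_nonneg hm hm)]

/-- One step of the simplex cutting method. The simplex `v` is cut through its centroid `c` by the
hyperplane with normal `a`. Either one of the points `p i` lies on the far side of the hyperplane,
or all of them lie in a new simplex of smaller volume, obtained by contraction towards the vertex
`k` that is deepest in the near side. -/
theorem simplex_cut {v : Fin (m + 1) → Fin m → ℝ} {a c : Fin m → ℝ} {α : Fin (m + 1) → ℝ}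
    {k : Fin (m + 1)} {s δ : ℝ} {ι : Type*} [Nonempty ι] {p : ι → Fin m → ℝ}
    (hc : ∀ j, c j = (∑ i, v i j) / ((m : ℝ) + 1))
    (hα : ∀ i, α i = ∑ j, a j * (v i j - c j)) (hk : ∀ i, α k ≤ α i)
    (hs : s = 1 / (8 * ((m : ℝ) + 1) ^ 2)) (hp : ∀ i, InSimplex v (p i))
    (hδ : |(homMatrix v).det| ≤ δ) :
    (∃ i, 0 ≤ ∑ j, a j * (p i j - c j)) ∨
      (∀ i, InSimplex (fun i j => v k j + (v i j - v k j) / (1 + s * (α i / -α k))) (p i)) ∧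
      |(homMatrix fun i j => v k j + (v i j - v k j) / (1 + s * (α i / -α k))).det|
        ≤ δ * Real.exp (-(s / 2)) := by
  have hm : (0 : ℝ) ≤ m := Nat.cast_nonneg m
  have hs0 : 0 < s := by rw [hs]; positivity
  have hs8 : s * (8 * ((m : ℝ) + 1) ^ 2) = 1 := by rw [hs]; field_simp
  have hs1 : s < 1 := by nlinarith [mul_nonneg hs0.le hm, mul_nonneg hs0.le (mul_nonneg hm hm)]
  by_cases hfar : ∃ i, 0 ≤ ∑ j, a j * (p i j - c j)
  · exact Or.inl hfar
  push Not at hfar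
  right
  have hval : ∀ (w : Fin (m + 1) → ℝ) (q : Fin m → ℝ), ∑ i, w i = 1 →
      (∀ j, ∑ i, w i * v i j = q j) → ∑ i, w i * α i = ∑ j, a j * (q j - c j) := by
    intro w q hw1 hwq
    simp only [hα, Finset.mul_sum]
    rw [Finset.sum_comm]
    refine Finset.sum_congr rfl fun j _ => ?_
    have h1 : q j - c j = ∑ i, w i * (v i j - c j) := by
      simp only [mul_sub, Finset.sum_sub_distrib, ← Finset.sum_mul, hw1, hwq, one_mul]
    rw [h1, Finset.mul_sum]
    exact Finset.sum_congr rfl fun i _ => by ring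
  have hsum : ∑ i, α i = 0 := by
    have hne : ((m : ℝ) + 1) ≠ 0 := by positivity
    have h := hval (fun _ => 1 / ((m : ℝ) + 1)) c (by simp [hne]) fun j => by
      rw [hc j, ← Finset.mul_sum]; ring
    rw [← Finset.mul_sum] at h
    simp only [sub_self, mul_zero, Finset.sum_const_zero] at h
    exact (mul_eq_zero.1 h).resolve_left (by positivity)
  have hαk : α k < 0 := by
    obtain ⟨i₀⟩ := ‹Nonempty ι›
    obtain ⟨w, hw0, hw1, hwp⟩ := hp i₀
    have h1 := hfar i₀
    rw [← hval w _ hw1 hwp] at h1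
    by_contra h
    exact absurd h1 (not_lt.2 (Finset.sum_nonneg fun i _ =>
      mul_nonneg (hw0 i) ((not_lt.1 h).trans (hk i))))
  have hβ : ∀ i, -1 ≤ α i / -α k := fun i => by
    rw [le_div_iff₀ (by linarith)]; linarith [hk i]
  have hβk : α k / -α k = -1 := by rw [div_neg, div_self hαk.ne]
  have hβsum : ∑ i, α i / -α k = 0 := by rw [← Finset.sum_div, hsum, zero_div]
  have hpos : ∀ i, 0 < 1 + s * (α i / -α k) := fun i => by nlinarith [hβ i]
  simp only [div_eq_mul_one_div (_ - _ : ℝ)]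
  refine ⟨fun i => ?_, ?_⟩
  · obtain ⟨w, hw0, hw1, hwp⟩ := hp i
    refine InSimplex.contract hs0.le hs1 hβ hβk hw0 hw1 hwp ?_
    have h1 : ∑ i, w i * (α i / -α k) = (∑ i, w i * α i) / -α k := by
      rw [Finset.sum_div]; exact Finset.sum_congr rfl fun i _ => by ring
    rw [h1, hval w _ hw1 hwp]
    exact div_nonpos_of_nonpos_of_nonneg (hfar i).le (by linarith)
  · rw [det_homMatrix_contract v k _ fun i => (one_div_pos.2 (hpos i)).ne', abs_mul,
      Finset.abs_prod, mul_comm]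
    refine mul_le_mul hδ ?_ (Finset.prod_nonneg fun i _ => abs_nonneg _) ((abs_nonneg _).trans hδ)
    have h1 : ∏ i ∈ Finset.univ.erase k, |1 / (1 + s * (α i / -α k))| =
        (∏ i ∈ Finset.univ.erase k, (1 + s * (α i / -α k)))⁻¹ := by
      rw [← Finset.prod_inv_distrib]
      exact Finset.prod_congr rfl fun i _ => by
        rw [abs_of_pos (one_div_pos.2 (hpos i)), one_div]
    rw [h1, Real.exp_neg]
    exact inv_anti₀ (Real.exp_pos _) (exp_le_prod_contract hs hβ hβk hβsum)

end Simplex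

/-! ### Running programs -/

/-- Program `P`, started in state `s`, halts after at most `K` steps in a state that satisfies
`Q`. -/
def Runs (O : Oracle) (P : Prog) (s : State) (K : ℕ) (Q : State → Prop) : Prop :=
  ∃ s' k, Exec O P s s' k ∧ k ≤ K ∧ Q s'

theorem Runs.mono {O : Oracle} {P : Prog} {s : State} {K K' : ℕ} {Q Q' : State → Prop}
    (h : Runs O P s K Q) (hK : K ≤ K') (hQ : ∀ s', Q s' → Q' s') : Runs O P s K' Q' := by
  obtain ⟨s', k, he, hk, hq⟩ := h
  exact ⟨s', k, he, hk.trans hK, hQ s' hq⟩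

theorem Runs.instr {O : Oracle} {c : Instr} {s : State} {Q : State → Prop} (h : Q (c.apply O s)) :
    Runs O (.instr c) s 1 Q := ⟨_, _, .instr c s, le_rfl, h⟩

theorem Runs.seq {O : Oracle} {P P' : Prog} {s : State} {K K' : ℕ} {Q Q' : State → Prop}
    (h : Runs O P s K Q) (h' : ∀ s', Q s' → Runs O P' s' K' Q') :
    Runs O (.seq P P') s (K + K') Q' := by
  obtain ⟨s', k, he, hk, hq⟩ := h
  obtain ⟨s'', k', he', hk', hq'⟩ := h' s' hq
  exact ⟨s'', _, .seq he he', add_le_add hk hk', hq'⟩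

/-- A loop with a loop invariant that determines the number of remaining rounds. -/
theorem Runs.loop {O : Oracle} {t : Test} {P : Prog} {K n : ℕ} {I : ℕ → State → Prop}
    (ht : ∀ x s, I x s → (t.Holds s ↔ x < n))
    (hP : ∀ x s, x < n → I x s → Runs O P s K (I (x + 1))) :
    ∀ {x s}, x ≤ n → I x s → Runs O (.loop t P) s ((n - x) * (K + 1) + 1) (I n) := by
  intro x s hx hI
  obtain ⟨r, hr⟩ : ∃ r, n = x + r := ⟨n - x, by omega⟩
  induction r generalizing x s with
  | zero =>
    have h : ¬ t.Holds s := fun h => by have := (ht x s hI).1 h; omega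
    refine ⟨s, 1, .loop_false h, by omega, ?_⟩
    rw [hr, add_zero]; exact hI
  | succ r ih =>
    have hlt : x < n := by omega
    obtain ⟨s', k, he, hk, hI'⟩ := hP x s hlt hI
    obtain ⟨s'', k', he', hk', hI''⟩ := ih (x := x + 1) (by omega) hI' (by omega)
    refine ⟨s'', _, .loop_true ((ht x s hI).2 hlt) he he', ?_, hI''⟩
    have h1 : n - x = n - (x + 1) + 1 := by omega
    rw [h1, add_mul]
    omega

/-- Repeat a program for the values of register `i` from `0` up to the content of register `b`, and
reset register `i`. Register `2` is supposed to hold `1`. -/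
def forLoop (i b : ℕ) (P : Prog) : Prog :=
  .seq (.loop (.idxLt i b) (.seq P (.instr (.idxAdd i i 2)))) (.instr (.idxConst i 0))

theorem Runs.forLoop {O : Oracle} {i b : ℕ} {P : Prog} {K n : ℕ} {I : ℕ → State → Prop} {s : State}
    (hi : ∀ x s, I x s → s.idx i = x ∧ s.idx b = n)
    (hP : ∀ x s, x < n → I x s → Runs O P s K fun s' => I (x + 1) ((Instr.idxAdd i i 2).apply O s'))
    (hs : I 0 s) {Q : State → Prop} (hQ : ∀ s', I n s' → Q (s'.setIdx i 0)) :
    Runs O (forLoop i b P) s (n * (K + 2) + 2) Q := by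
  have h := Runs.loop (O := O) (t := .idxLt i b) (P := .seq P (.instr (.idxAdd i i 2)))
    (K := K + 1) (n := n) (I := I)
    (fun x s hI => by
      obtain ⟨h1, h2⟩ := hi x s hI
      change s.idx i < s.idx b ↔ _
      rw [h1, h2])
    (fun x s hx hI => (hP x s hx hI).seq fun s' h => Runs.instr h) (Nat.zero_le n) hs
  exact (h.seq fun s' h' => Runs.instr (hQ s' h')).mono (by simp) fun _ h => h

/-! ### Expressions

Expressions with bounded sums are evaluated by programs that leave the index registers unchanged.
Register `2` holds `1`, register `4` holds `0`, and the registers from `10` on, which are zero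
outside of loops, serve as summation variables: a sum under `l` other binders uses register
`10 + l`. The arrays from `100` on hold intermediate results. -/

/-- Binary operations: arithmetic, and the queries for the entity in an index register. -/
inductive Op where
  | add | sub | mul | div
  | util (j : ℕ)
  | utilIntegral (j : ℕ)

/-- The instruction that carries out an operation. -/
def Op.instr : Op → Ref → Ref → Ref → Instr
  | add => .add
  | sub => .sub
  | mul => .mul
  | div => .div
  | util j => fun x y z => .queryUtil x j y z
  | utilIntegral j => fun x y z => .queryUtilIntegral x j y z

/-- The value of an operation. -/
def Op.eval (O : Oracle) (s : State) : Op → ℝ → ℝ → ℝ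
  | add, y, z => y + z
  | sub, y, z => y - z
  | mul, y, z => y * z
  | div, y, z => y / z
  | util j, y, z => O.util (s.idx j) y z
  | utilIntegral j, y, z => O.utilIntegral (s.idx j) y z

/-- Real expressions. `ite a b p q` is `p` if `a < b`, and `q` otherwise. `sum b e` is the sum of
`e` over the values of the summation variable below the content of index register `b`. -/
inductive RealExpr where
  | const (v : ℤ)
  | cell (x : Ref)
  | op (o : Op) (a b : RealExpr)
  | exp (a : RealExpr)
  | log (a : RealExpr)
  | ite (a b p q : RealExpr)
  | sum (b : ℕ) (e : RealExpr)

namespace RealExpr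

open Classical in
/-- The value of an expression under `l` binders. -/
def eval (O : Oracle) : RealExpr → ℕ → State → ℝ
  | const v, _, _ => v
  | cell x, _, s => s.get x
  | op o a b, l, s => o.eval O s (a.eval O l s) (b.eval O l s)
  | exp a, l, s => Real.exp (a.eval O l s)
  | log a, l, s => Real.log (a.eval O l s)
  | ite a b p q, l, s => if a.eval O l s < b.eval O l s then p.eval O l s else q.eval O l s
  | sum b e, l, s => ∑ x ∈ Finset.range (s.idx b), e.eval O (l + 1) (s.setIdx (10 + l) x)

/-- The expression, under `l` binders, reads neither array `w` nor arrays of intermediate results,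
and the bounds of its sums are not summation variables of the same or an inner sum. -/
def wf (w : ℕ) : RealExpr → ℕ → Bool
  | const _, _ => true
  | cell x, _ => decide (x.name < 100) && decide (x.name ≠ w)
  | op _ a b, l => a.wf w l && b.wf w l
  | exp a, l => a.wf w l
  | log a, l => a.wf w l
  | ite a b p q, l => a.wf w l && b.wf w l && p.wf w l && q.wf w l
  | sum b e, l => decide (b < 10 + l) && e.wf w (l + 1)

/-- The cell for the intermediate result of depth `d`. -/
def tmp (d : ℕ) : Ref := ⟨100 + d, 4, 4⟩

/-- The program that leaves the value of an expression in cell `tmp d`. -/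
def compile : RealExpr → ℕ → ℕ → Prog
  | const v, _, d => .instr (.const (tmp d) v)
  | cell x, _, d => .instr (.copy (tmp d) x)
  | op o a b, l, d => .seq (a.compile l d)
      (.seq (b.compile l (d + 1)) (.instr (o.instr (tmp d) (tmp d) (tmp (d + 1)))))
  | exp a, l, d => .seq (a.compile l d) (.instr (.exp (tmp d) (tmp d)))
  | log a, l, d => .seq (a.compile l d) (.instr (.log (tmp d) (tmp d)))
  | ite a b p q, l, d => .seq (a.compile l d) (.seq (b.compile l (d + 1))
      (.ite (.realLt (tmp d) (tmp (d + 1))) (p.compile l d) (q.compile l d)))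
  | sum b e, l, d => .seq (.instr (.const (tmp d) 0)) (forLoop (10 + l) b
      (.seq (e.compile (l + 1) (d + 1)) (.instr (.add (tmp d) (tmp d) (tmp (d + 1))))))

/-- A bound for the running time, if all index registers are at most `B`. -/
def cost : RealExpr → ℕ → ℕ
  | const _, _ => 1
  | cell _, _ => 1
  | op _ a b, B => a.cost B + (b.cost B + 1)
  | exp a, B => a.cost B + 1
  | log a, B => a.cost B + 1
  | ite a b p q, B => a.cost B + (b.cost B + (p.cost B + q.cost B + 1))
  | sum _ e, B => 1 + (B * (e.cost B + 1 + 2) + 2)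

theorem eval_congr {O : Oracle} {w : ℕ} (e : RealExpr) {l : ℕ} {s s' : State} (he : e.wf w l)
    (hi : s'.idx = s.idx) (ha : ∀ a < 100, a ≠ w → s'.arr a = s.arr a) :
    e.eval O l s' = e.eval O l s := by
  induction e generalizing l s s' with
  | const v => rfl
  | cell x =>
    simp only [wf, Bool.and_eq_true, decide_eq_true_eq] at he
    simp only [eval, State.get, hi, ha _ he.1 he.2]
  | op o a b iha ihb =>
    simp only [wf, Bool.and_eq_true] at he
    simp only [eval, iha he.1 hi ha, ihb he.2 hi ha]
    cases o <;> simp [Op.eval, hi]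
  | exp a iha => simp only [eval, iha he hi ha]
  | log a iha => simp only [eval, iha he hi ha]
  | ite a b p q iha ihb ihp ihq =>
    simp only [wf, Bool.and_eq_true] at he
    simp only [eval, iha he.1.1.1 hi ha, ihb he.1.1.2 hi ha, ihp he.1.2 hi ha, ihq he.2 hi ha]
  | sum b e ih =>
    simp only [wf, Bool.and_eq_true] at he
    simp only [eval, hi]
    refine Finset.sum_congr rfl fun x _ => ih he.2 ?_ ha
    simp [State.setIdx, hi]

end RealExpr

/-- The conventions on the index registers under `l` binders, and a bound for them. -/
structure Ready (s : State) (l B : ℕ) : Prop where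
  one : s.idx 2 = 1
  zero : s.idx 4 = 0
  fresh : ∀ i, 10 + l ≤ i → s.idx i = 0
  le : ∀ i, s.idx i ≤ B

theorem Ready.setIdx {s : State} {l B x : ℕ} (h : Ready s l B) (hx : x ≤ B) :
    Ready (s.setIdx (10 + l) x) (l + 1) B where
  one := by simpa [State.setIdx, Function.update_of_ne (show 2 ≠ 10 + l by omega)] using h.one
  zero := by simpa [State.setIdx, Function.update_of_ne (show 4 ≠ 10 + l by omega)] using h.zero
  fresh i hi := by
    simpa [State.setIdx, Function.update_of_ne (show i ≠ 10 + l by omega)] using h.fresh i (by omega)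
  le i := by
    by_cases hi : i = 10 + l
    · subst hi; simpa [State.setIdx] using hx
    · simpa [State.setIdx, Function.update_of_ne hi] using h.le i

theorem Ready.congr {s s' : State} {l B : ℕ} (h : Ready s l B) (hi : s'.idx = s.idx) :
    Ready s' l B := by
  constructor
  · rw [hi]; exact h.one
  · rw [hi]; exact h.zero
  · rw [hi]; exact h.fresh
  · rw [hi]; exact h.le

namespace RealExpr

/-- The result of evaluating an expression of value `v` at depth `d`. -/
def Post (s : State) (d : ℕ) (v : ℝ) (s' : State) : Prop :=
  s'.idx = s.idx ∧ (∀ a < 100 + d, s'.arr a = s.arr a) ∧ s'.arr (100 + d) 0 0 = v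

theorem get_tmp {s : State} {d : ℕ} (h : s.idx 4 = 0) : s.get (tmp d) = s.arr (100 + d) 0 0 := by
  simp [State.get, tmp, h]

theorem post_set_tmp {s s' : State} {d : ℕ} {v : ℝ} (h : s.idx 4 = 0) (hi : s'.idx = s.idx)
    (ha : ∀ a < 100 + d, s'.arr a = s.arr a) : Post s d v (s'.set (tmp d) v) := by
  refine ⟨hi, fun a had => ?_, ?_⟩
  · rw [← ha a had]
    funext p q
    simp [State.set, tmp, had.ne]
  · simp [State.set, tmp, hi, h]

theorem compile_spec {O : Oracle} {w B : ℕ} (e : RealExpr) {l d : ℕ} {s : State} (he : e.wf w l)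
    (hs : Ready s l B) :
    Runs O (e.compile l d) s (e.cost B) (Post s d (e.eval O l s)) := by
  induction e generalizing l d s with
  | const v => exact Runs.instr (post_set_tmp hs.zero rfl fun _ _ => rfl)
  | cell x => exact Runs.instr (post_set_tmp hs.zero rfl fun _ _ => rfl)
  | op o a b iha ihb =>
    simp only [wf, Bool.and_eq_true] at he
    refine (iha he.1 hs).seq fun s₁ h₁ => ?_
    refine (ihb he.2 (hs.congr h₁.1)).seq fun s₂ h₂ => Runs.instr ?_
    have hi : s₂.idx = s.idx := h₂.1.trans h₁.1
    have ha : ∀ a < 100 + d, s₂.arr a = s.arr a := fun a h =>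
      (h₂.2.1 a (by omega)).trans (h₁.2.1 a h)
    have e1 : s₂.get (tmp d) = a.eval O l s := by
      rw [get_tmp (by rw [hi]; exact hs.zero), h₂.2.1 _ (by omega), h₁.2.2]
    have e2 : s₂.get (tmp (d + 1)) = b.eval O l s := by
      rw [get_tmp (by rw [hi]; exact hs.zero), h₂.2.2]
      exact eval_congr b he.2 h₁.1 fun a ha _ => h₁.2.1 a (by omega)
    have e3 : (o.instr (tmp d) (tmp d) (tmp (d + 1))).apply O s₂ =
        s₂.set (tmp d) ((op o a b).eval O l s) := by
      cases o <;> simp [Op.instr, Instr.apply, eval, Op.eval, e1, e2, hi]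
    rw [e3]
    exact post_set_tmp hs.zero hi ha
  | exp a iha =>
    refine (iha he hs).seq fun s₁ h₁ => Runs.instr ?_
    have e1 : s₁.get (tmp d) = a.eval O l s := by
      rw [get_tmp (by rw [h₁.1]; exact hs.zero), h₁.2.2]
    simp only [Instr.apply, e1]
    exact post_set_tmp hs.zero h₁.1 h₁.2.1
  | log a iha =>
    refine (iha he hs).seq fun s₁ h₁ => Runs.instr ?_
    have e1 : s₁.get (tmp d) = a.eval O l s := by
      rw [get_tmp (by rw [h₁.1]; exact hs.zero), h₁.2.2]
    simp only [Instr.apply, e1]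
    exact post_set_tmp hs.zero h₁.1 h₁.2.1
  | ite a b p q iha ihb ihp ihq =>
    simp only [wf, Bool.and_eq_true] at he
    refine (iha he.1.1.1 hs).seq fun s₁ h₁ => ?_
    refine (ihb he.1.1.2 (hs.congr h₁.1)).seq fun s₂ h₂ => ?_
    have hi : s₂.idx = s.idx := h₂.1.trans h₁.1
    have ha : ∀ a < 100 + d, s₂.arr a = s.arr a := fun a h =>
      (h₂.2.1 a (by omega)).trans (h₁.2.1 a h)
    have e1 : s₂.get (tmp d) = a.eval O l s := by
      rw [get_tmp (by rw [hi]; exact hs.zero), h₂.2.1 _ (by omega), h₁.2.2]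
    have e2 : s₂.get (tmp (d + 1)) = b.eval O l s := by
      rw [get_tmp (by rw [hi]; exact hs.zero), h₂.2.2]
      exact eval_congr b he.1.1.2 h₁.1 fun a ha _ => h₁.2.1 a (by omega)
    have hpost : ∀ (r : RealExpr), r.wf w l → ∀ s₃, Post s₂ d (r.eval O l s₂) s₃ →
        Post s d (r.eval O l s) s₃ := fun r hr s₃ h₃ =>
      ⟨h₃.1.trans hi, fun a h => (h₃.2.1 a h).trans (ha a h), h₃.2.2.trans
        (eval_congr r hr hi fun a h _ => ha a (by omega))⟩
    by_cases hlt : a.eval O l s < b.eval O l s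
    · obtain ⟨s₃, k, hex, hk, h₃⟩ := ihp (d := d) he.1.2 (hs.congr hi)
      refine ⟨s₃, _, .ite_true (by change s₂.get _ < s₂.get _; rwa [e1, e2]) hex, by omega, ?_⟩
      simp only [eval, if_pos hlt]
      exact hpost p he.1.2 s₃ h₃
    · obtain ⟨s₃, k, hex, hk, h₃⟩ := ihq (d := d) he.2 (hs.congr hi)
      refine ⟨s₃, _, .ite_false (by change ¬ s₂.get _ < s₂.get _; rwa [e1, e2]) hex, by omega, ?_⟩
      simp only [eval, if_neg hlt]
      exact hpost q he.2 s₃ h₃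
  | sum b e ih =>
    simp only [wf, Bool.and_eq_true, decide_eq_true_eq] at he
    refine Runs.seq (Q := fun s₁ => s₁ = s.set (tmp d) ((0 : ℤ) : ℝ)) (Runs.instr rfl) ?_
    rintro _ rfl
    have hsb : s.idx b ≤ B := hs.le b
    refine (Runs.forLoop (n := s.idx b) (K := e.cost B + 1) (I := fun x t =>
      t.idx = (s.setIdx (10 + l) x).idx ∧ (∀ a < 100 + d, t.arr a = s.arr a) ∧
      t.arr (100 + d) 0 0 =
        ∑ y ∈ Finset.range x, e.eval O (l + 1) (s.setIdx (10 + l) y)) ?_ ?_ ?_ ?_).mono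
      (by gcongr) fun _ h => h
    · rintro x t ⟨h1, -, -⟩
      rw [h1]
      refine ⟨by simp [State.setIdx], ?_⟩
      simp [State.setIdx, Function.update_of_ne he.1.ne]
    · rintro x t hx ⟨h1, h2, h3⟩
      have hr : Ready t (l + 1) B := (hs.setIdx (x := x) (by omega)).congr h1
      refine (ih (d := d + 1) he.2 hr).seq fun t' ht' => Runs.instr ?_
      have e0 : e.eval O (l + 1) t = e.eval O (l + 1) (s.setIdx (10 + l) x) :=
        eval_congr e he.2 h1 fun a ha _ => h2 a (by omega)
      have hz : t'.idx 4 = 0 := by rw [ht'.1]; exact hr.zero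
      have e1 : t'.get (tmp d) =
          ∑ y ∈ Finset.range x, e.eval O (l + 1) (s.setIdx (10 + l) y) := by
        rw [get_tmp hz, ht'.2.1 _ (by omega), h3]
      have e2 : t'.get (tmp (d + 1)) = e.eval O (l + 1) (s.setIdx (10 + l) x) := by
        rw [get_tmp hz, ht'.2.2, e0]
      have hp := post_set_tmp (s := t) (s' := t') (d := d)
        (v := ∑ y ∈ Finset.range (x + 1), e.eval O (l + 1) (s.setIdx (10 + l) y)) hr.zero ht'.1
        fun a ha => ht'.2.1 a (by omega)
      simp only [Instr.apply, e1, e2, ← Finset.sum_range_succ]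
      refine ⟨?_, fun a ha => (hp.2.1 a ha).trans (h2 a ha), hp.2.2⟩
      have hi : t'.idx = Function.update s.idx (10 + l) x := ht'.1.trans h1
      change Function.update t'.idx (10 + l) (t'.idx (10 + l) + t'.idx 2) =
        Function.update s.idx (10 + l) (x + 1)
      rw [hi]
      simp [Function.update_of_ne (show 2 ≠ 10 + l by omega), hs.one]
    · refine ⟨?_, fun a ha => ?_, ?_⟩
      · simp [State.set, State.setIdx, ← hs.fresh (10 + l) le_rfl]
      · exact (post_set_tmp hs.zero rfl fun _ _ => rfl : Post s d _ _).2.1 a ha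
      · have := (post_set_tmp hs.zero rfl fun _ _ => rfl :
          Post s d ((0 : ℤ) : ℝ) (s.set (tmp d) ((0 : ℤ) : ℝ))).2.2
        rw [this]; simp
    · rintro t ⟨h1, h2, h3⟩
      refine ⟨?_, h2, h3⟩
      simp [State.setIdx, h1, ← hs.fresh (10 + l) le_rfl]

end RealExpr

/-! ### Array assignments -/

/-- The assignment of the values of `e` to the cells of array `name`, where the rows and columns
range below the contents of two index registers. In `e`, registers `10` and `11` hold the row and
the column. -/
structure Assign where
  name : ℕ
  rows : ℕ
  cols : ℕ
  e : RealExpr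

namespace Assign

/-- The expression does not depend on the array that is being written. -/
def wf (A : Assign) : Bool :=
  decide (A.name < 100) && decide (A.rows < 10) && decide (A.cols < 10) && A.e.wf A.name 2

/-- The value assigned to row `p` and column `q`. -/
def val (A : Assign) (O : Oracle) (s : State) (p q : ℕ) : ℝ :=
  A.e.eval O 2 ((s.setIdx 10 p).setIdx 11 q)

open Classical in
/-- The state after the assignment. -/
def sem (A : Assign) (O : Oracle) (s : State) : State :=
  { s with arr := fun a p q =>
      if a = A.name ∧ p < s.idx A.rows ∧ q < s.idx A.cols then A.val O s p q else s.arr a p q }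

/-- The program that carries out an assignment. -/
def compile (A : Assign) : Prog :=
  forLoop 10 A.rows (forLoop 11 A.cols
    (.seq (A.e.compile 2 0) (.instr (.copy ⟨A.name, 10, 11⟩ (RealExpr.tmp 0)))))

/-- A bound for the running time, if all index registers are at most `B`. -/
def cost (A : Assign) (B : ℕ) : ℕ := B * (B * (A.e.cost B + 1 + 2) + 2 + 2) + 2

end Assign

/-- Equality of states up to intermediate results. -/
def State.Agree (s t : State) : Prop := s.idx = t.idx ∧ ∀ a < 100, s.arr a = t.arr a

namespace Assign

theorem compile_spec {O : Oracle} {B : ℕ} {A : Assign} {s : State} (hA : A.wf)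
    (hs : Ready s 0 B) : Runs O A.compile s (A.cost B) fun s' => s'.Agree (A.sem O s) := by
  classical
  simp only [wf, Bool.and_eq_true, decide_eq_true_eq] at hA
  obtain ⟨⟨⟨hname, hrows⟩, hcols⟩, he⟩ := hA
  have hrB := hs.le A.rows
  have hcB := hs.le A.cols
  have hf10 : s.idx 10 = 0 := hs.fresh 10 (by omega)
  have hf11 : s.idx 11 = 0 := hs.fresh 11 (by omega)
  refine (Runs.forLoop (n := s.idx A.rows)
    (K := s.idx A.cols * (A.e.cost B + 1 + 2) + 2) (I := fun x t =>
    t.idx = (s.setIdx 10 x).idx ∧ (∀ a < 100, a ≠ A.name → t.arr a = s.arr a) ∧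
    ∀ p q, t.arr A.name p q =
      if p < x ∧ q < s.idx A.cols then A.val O s p q else s.arr A.name p q) ?_ ?_ ?_ ?_).mono
    (by unfold cost; gcongr) fun _ h => h
  · rintro x t ⟨h1, -, -⟩
    rw [h1]
    refine ⟨by simp [State.setIdx], ?_⟩
    simp [State.setIdx, Function.update_of_ne (show A.rows ≠ 10 by omega)]
  · rintro x t hx ⟨h1, h2, h3⟩
    refine Runs.forLoop (n := s.idx A.cols) (K := A.e.cost B + 1) (I := fun y t =>
      t.idx = ((s.setIdx 10 x).setIdx 11 y).idx ∧ (∀ a < 100, a ≠ A.name → t.arr a = s.arr a) ∧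
      ∀ p q, t.arr A.name p q =
        if (p < x ∧ q < s.idx A.cols) ∨ (p = x ∧ q < y) then A.val O s p q
        else s.arr A.name p q) ?_ ?_ ?_ ?_
    · rintro y t' ⟨h1, -, -⟩
      rw [h1]
      refine ⟨by simp [State.setIdx], ?_⟩
      simp [State.setIdx, Function.update_of_ne (show A.cols ≠ 10 by omega),
        Function.update_of_ne (show A.cols ≠ 11 by omega)]
    · rintro y t' hy ⟨h1', h2', h3'⟩
      have hr0 : Ready ((s.setIdx 10 x).setIdx 11 y) 2 B :=
        (hs.setIdx (x := x) (by omega)).setIdx (x := y) (by omega)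
      have hr : Ready t' 2 B := hr0.congr h1'
      refine (RealExpr.compile_spec A.e (d := 0) he hr).seq fun t'' ht'' => Runs.instr ?_
      have e0 : A.e.eval O 2 t' = A.val O s x y := RealExpr.eval_congr A.e he h1' h2'
      have hi : t''.idx = ((s.setIdx 10 x).setIdx 11 y).idx := ht''.1.trans h1'
      have e1 : t''.get (RealExpr.tmp 0) = A.val O s x y := by
        rw [RealExpr.get_tmp (by rw [hi]; exact hr0.zero), ht''.2.2, e0]
      have h10 : t''.idx 10 = x := by rw [hi]; simp [State.setIdx]
      have h11 : t''.idx 11 = y := by rw [hi]; simp [State.setIdx]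
      simp only [Instr.apply, e1]
      refine ⟨?_, fun a ha hne => ?_, fun p q => ?_⟩
      · simp only [State.setIdx, State.set, hi]
        simp [hs.one]
      · rw [← h2' a ha hne, ← ht''.2.1 a ha]
        funext p q
        simp [State.set, State.setIdx, hne]
      · have := h3' p q
        rw [← ht''.2.1 _ hname] at this
        simp only [State.set, State.setIdx, h10, h11, true_and, this]
        by_cases hp : p = x
        · subst hp
          by_cases hq : q = y
          · subst hq; simp
          · have : q < y + 1 ↔ q < y := by omega
            simp [hq, this]
        · simp [hp]
    · refine ⟨?_, h2, fun p q => ?_⟩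
      · rw [h1]
        have : (s.setIdx 10 x).idx 11 = 0 := by simp [State.setIdx, hf11]
        simp only [State.setIdx] at this ⊢
        rw [← this]; simp
      · rw [h3 p q]; simp
    · rintro t' ⟨h1', h2', h3'⟩
      refine ⟨?_, h2', fun p q => ?_⟩
      · simp only [Instr.apply, State.setIdx, h1']
        funext i
        by_cases h10 : i = 10
        · subst h10; simp [hs.one]
        · by_cases h11 : i = 11
          · subst h11; simp [hf11]
          · simp [h10, h11]
      · have := h3' p q
        simp only [Instr.apply, State.setIdx, this]
        congr 1
        apply propext
        constructor
        · rintro (h | h)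
          · exact ⟨by omega, h.2⟩
          · exact ⟨by omega, h.2⟩
        · rintro ⟨h, h'⟩
          rcases Nat.lt_succ_iff_lt_or_eq.1 h with h | h
          · exact Or.inl ⟨h, h'⟩
          · exact Or.inr ⟨h, h'⟩
  · refine ⟨?_, fun _ _ _ => rfl, fun p q => by simp⟩
    simp [State.setIdx, ← hf10]
  · rintro t ⟨h1, h2, h3⟩
    refine ⟨?_, fun a ha => ?_⟩
    · simp [State.setIdx, h1, sem, ← hf10]
    · funext p q
      by_cases hne : a = A.name
      · subst hne
        simp only [State.setIdx, sem, h3 p q, true_and]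
      · simp only [State.setIdx, sem, h2 a ha hne, hne, false_and, if_false]

theorem sem_agree {O : Oracle} {A : Assign} {s t : State} (hA : A.wf) (h : s.Agree t) :
    (A.sem O s).Agree (A.sem O t) := by
  simp only [wf, Bool.and_eq_true, decide_eq_true_eq] at hA
  refine ⟨h.1, fun a ha => ?_⟩
  funext p q
  have : A.val O s p q = A.val O t p q := by
    refine RealExpr.eval_congr A.e hA.2 ?_ fun a ha _ => h.2 a ha
    simp [State.setIdx, h.1]
  simp only [sem, h.1, h.2 a ha, this]

/-- The program that carries out a list of assignments. The empty list is represented by an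
instruction without effect. -/
def block : List Assign → Prog
  | [] => .instr (.idxConst 4 0)
  | A :: L => .seq A.compile (block L)

/-- The state after a list of assignments. -/
def semBlock (O : Oracle) (L : List Assign) (s : State) : State := L.foldl (fun s A => A.sem O s) s

/-- A bound for the running time, if all index registers are at most `B`. -/
def costBlock (L : List Assign) (B : ℕ) : ℕ := (L.map fun A => A.cost B).sum + 1

theorem semBlock_agree {O : Oracle} {L : List Assign} {s t : State} (hL : ∀ A ∈ L, A.wf)
    (h : s.Agree t) : (semBlock O L s).Agree (semBlock O L t) := by
  induction L generalizing s t with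
  | nil => exact h
  | cons A L ih =>
    exact ih (fun A' h' => hL A' (List.mem_cons_of_mem _ h'))
      (sem_agree (hL A List.mem_cons_self) h)

theorem block_spec {O : Oracle} {B : ℕ} {L : List Assign} {s : State} (hL : ∀ A ∈ L, A.wf)
    (hs : Ready s 0 B) :
    Runs O (block L) s (costBlock L B) fun s' => s'.Agree (semBlock O L s) := by
  induction L generalizing s with
  | nil =>
    refine Runs.mono (Runs.instr (Q := fun s' => s'.Agree s) ⟨?_, fun _ _ => rfl⟩)
      (by simp [costBlock]) fun _ h => h
    simp [Instr.apply, State.setIdx, ← hs.zero]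
  | cons A L ih =>
    have hL' : ∀ A' ∈ L, A'.wf := fun A' h' => hL A' (List.mem_cons_of_mem _ h')
    refine Runs.mono (K := A.cost B + costBlock L B) ((compile_spec (hL A List.mem_cons_self) hs).seq
      fun s₁ h₁ => (ih hL' (hs.congr h₁.1)).mono le_rfl fun s₂ h₂ => ?_)
      (by simp [costBlock, add_assoc]) fun _ h => h
    have h₃ := semBlock_agree (O := O) hL' h₁
    exact ⟨h₂.1.trans h₃.1, fun a ha => (h₂.2 a ha).trans (h₃.2 a ha)⟩

end Assign

/-! ### Polynomial bounds -/

/-- The function is bounded by a polynomial. -/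
def PolyBounded (f : ℕ → ℕ) : Prop := ∃ K d, ∀ B, f B ≤ K * (1 + B) ^ d

theorem PolyBounded.const (c : ℕ) : PolyBounded fun _ => c := ⟨c, 0, fun B => by simp⟩

theorem PolyBounded.id : PolyBounded fun B => B := ⟨1, 1, fun B => by simp⟩

theorem PolyBounded.add {f g : ℕ → ℕ} (hf : PolyBounded f) (hg : PolyBounded g) :
    PolyBounded fun B => f B + g B := by
  obtain ⟨K, d, h⟩ := hf
  obtain ⟨K', d', h'⟩ := hg
  refine ⟨K + K', max d d', fun B => ?_⟩
  rw [add_mul]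
  refine add_le_add ((h B).trans ?_) ((h' B).trans ?_)
  · exact Nat.mul_le_mul_left _ (Nat.pow_le_pow_right (by omega) (le_max_left _ _))
  · exact Nat.mul_le_mul_left _ (Nat.pow_le_pow_right (by omega) (le_max_right _ _))

theorem PolyBounded.mul {f g : ℕ → ℕ} (hf : PolyBounded f) (hg : PolyBounded g) :
    PolyBounded fun B => f B * g B := by
  obtain ⟨K, d, h⟩ := hf
  obtain ⟨K', d', h'⟩ := hg
  refine ⟨K * K', d + d', fun B => (Nat.mul_le_mul (h B) (h' B)).trans (le_of_eq ?_)⟩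
  ring

theorem RealExpr.polyBounded_cost (e : RealExpr) : PolyBounded e.cost := by
  induction e with
  | const v => exact .const 1
  | cell x => exact .const 1
  | op o a b iha ihb => exact iha.add (ihb.add (.const 1))
  | exp a iha => exact iha.add (.const 1)
  | log a iha => exact iha.add (.const 1)
  | ite a b p q iha ihb ihp ihq => exact iha.add (ihb.add ((ihp.add ihq).add (.const 1)))
  | sum b e ih =>
    exact (PolyBounded.const 1).add ((PolyBounded.id.mul ((ih.add (.const 1)).add (.const 2))).add
      (.const 2))

theorem Assign.polyBounded_costBlock (L : List Assign) : PolyBounded (costBlock L) := by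
  refine PolyBounded.add ?_ (.const 1)
  induction L with
  | nil => exact .const 0
  | cons A L ih =>
    simp only [List.map_cons, List.sum_cons]
    refine PolyBounded.add ?_ ih
    exact (PolyBounded.id.mul (((PolyBounded.id.mul ((A.e.polyBounded_cost.add (.const 1)).add
      (.const 2))).add (.const 2)).add (.const 2))).add (.const 2)

/-! ### Cutting planes for the inner objective -/

theorem answer_of_ne_top {x : ℝ≥0∞} (h : x ≠ ∞) : answer x = x.toReal := if_neg h

theorem answer_neg_iff {x : ℝ≥0∞} : answer x < 0 ↔ x = ∞ := by
  by_cases h : x = ∞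
  · simp [answer, h]
  · simp [answer, h]

namespace Network

variable {m n R : ℕ} {N : Network m n R}

theorem utilIntegral_mono (F : ℝ → ℝ → ℝ) (c : ℝ) : Monotone fun y => utilIntegral F y c :=
  lintegral_Ioc_mono _

theorem residual_anti (hν : ∀ r, 0 ≤ N.ν r) : Antitone N.residual := by
  intro x y hxy
  refine Finset.sum_le_sum fun r _ => mul_le_mul_of_nonneg_left (Real.exp_le_exp.2 (neg_le_neg ?_))
    (hν r)
  exact Finset.sum_le_sum fun j _ => mul_le_mul_of_nonneg_right (hxy j) (Nat.cast_nonneg _)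

/-- Negative coordinates do not make the inner objective smaller than `φ`. -/
theorem ofReal_phi_le_innerObjective (hν : ∀ r, 0 ≤ N.ν r) (C y : Fin m → ℝ) :
    ENNReal.ofReal (N.phi C) ≤ N.innerObjective C y := by
  refine (ofReal_phi_le (N := N) (C := C) (y := y ⊔ 0) le_sup_right).trans ?_
  rw [innerObjective_eq, innerObjective_eq]
  refine add_le_add (ENNReal.ofReal_le_ofReal (residual_anti hν le_sup_left))
    (Finset.sum_le_sum fun j _ => ?_)
  rcases le_total (y j) 0 with h | h
  · have h1 : (y ⊔ 0) j = 0 := by simp [h]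
    rw [h1, utilIntegral, lintegral_Ioc_of_nonpos _ le_rfl]
    exact zero_le
  · have h1 : (y ⊔ 0) j = y j := by simp [h]
    rw [h1]

/-- The number of entities whose utilization at `c` is infinite. -/
def infCount (N : Network m n R) (C c : Fin m → ℝ) : ℝ :=
  ∑ j, if answer (util (N.F j) (c j) (C j)) < 0 then 1 else 0

/-- The normal of the cutting plane through `c`: a subgradient of the inner objective, or the sum of
the unit vectors of the coordinates in which the utilization is infinite. -/
def cutNormal (N : Network m n R) (C c : Fin m → ℝ) (j : Fin m) : ℝ :=
  if 0 < N.infCount C c then (if answer (util (N.F j) (c j) (C j)) < 0 then 1 else 0)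
  else answer (util (N.F j) (c j) (C j)) - N.marginal c j

/-- The smaller one of `best` and the value of the inner objective at `c`. Points with infinite
utilization are disregarded. -/
def improve (N : Network m n R) (C c : Fin m → ℝ) (best : ℝ) : ℝ :=
  if 0 < N.infCount C c then best
  else if N.residual c + ∑ j, answer (utilIntegral (N.F j) (c j) (C j)) < best then
    N.residual c + ∑ j, answer (utilIntegral (N.F j) (c j) (C j)) else best

theorem infCount_pos_iff {C c : Fin m → ℝ} :
    0 < N.infCount C c ↔ ∃ j, util (N.F j) (c j) (C j) = ∞ := by
  have h0 : ∀ j ∈ Finset.univ, (0 : ℝ) ≤ if answer (util (N.F j) (c j) (C j)) < 0 then 1 else 0 :=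
    fun j _ => by split_ifs <;> norm_num
  rw [infCount, Finset.sum_pos_iff_of_nonneg h0]
  constructor
  · rintro ⟨j, -, hj⟩
    refine ⟨j, answer_neg_iff.1 ?_⟩
    by_contra h
    simp [h] at hj
  · rintro ⟨j, hj⟩
    exact ⟨j, Finset.mem_univ j, by simp [answer_neg_iff.2 hj]⟩

theorem improve_le (C c : Fin m → ℝ) (best : ℝ) : N.improve C c best ≤ best := by
  unfold improve; split_ifs with h h'
  · exact le_rfl
  · exact h'.le
  · exact le_rfl

theorem separates_util {C c : Fin m → ℝ} (h : ∀ j, util (N.F j) (c j) (C j) ≠ ∞) :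
    N.Separates C c fun j => (util (N.F j) (c j) (C j)).toReal := by
  intro j
  rw [ENNReal.ofReal_toReal (h j)]
  exact ⟨fun z hz => util_mono _ _ (le_of_lt hz), fun z hz => util_mono _ _ (le_of_lt hz)⟩

/-- If the utilizations at `c` are finite, then so is the inner objective, and the cutting plane is
given by a subgradient. -/
theorem innerObjective_cut (hN : N.Valid) {C c : Fin m → ℝ} (hC : 0 ≤ C)
    (h : ¬ 0 < N.infCount C c) :
    (N.residual c + ∑ j, answer (utilIntegral (N.F j) (c j) (C j)) =
      (N.innerObjective C c).toReal) ∧ N.innerObjective C c ≠ ∞ ∧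
    ∀ x, N.innerObjective C x ≠ ∞ → (N.innerObjective C c).toReal +
      ∑ j, N.cutNormal C c j * (x j - c j) ≤ (N.innerObjective C x).toReal := by
  have hu : ∀ j, util (N.F j) (c j) (C j) ≠ ∞ := fun j hj => h (infCount_pos_iff.2 ⟨j, hj⟩)
  obtain ⟨h1, h2⟩ := innerObjective_subgradient hN.load_nonneg hN.loss hC
    (fun j => ENNReal.toReal_nonneg) (separates_util hu)
  refine ⟨?_, h1, fun x hx => ?_⟩
  · rw [toReal_innerObjective hN.load_nonneg h1]
    congr 1
    exact Finset.sum_congr rfl fun j _ => answer_of_ne_top (innerObjective_ne_top.1 h1 j)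
  · refine le_trans (le_of_eq ?_) (h2 x hx)
    congr 1
    refine Finset.sum_congr rfl fun j _ => ?_
    rw [cutNormal, if_neg h, answer_of_ne_top (hu j)]

theorem phi_le_improve (hN : N.Valid) {C c : Fin m → ℝ} (hC : 0 ≤ C) {best : ℝ}
    (h : N.phi C ≤ best) : N.phi C ≤ N.improve C c best := by
  unfold improve
  split_ifs with h0 h1
  · exact h
  · obtain ⟨h2, h3, -⟩ := innerObjective_cut hN hC h0
    rw [h2, ← ENNReal.ofReal_le_iff_le_toReal h3]
    exact ofReal_phi_le_innerObjective hN.load_nonneg C c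
  · exact h

/-- Points strictly below a point of finite objective that lie on the far side of the cutting plane
have a larger objective than `c`. The strictness excludes that such a point lies on a cutting plane
that is due to an infinite utilization. -/
theorem improve_le_of_far (hN : N.Valid) {C c p y : Fin m → ℝ} (hC : 0 ≤ C) {best : ℝ}
    (hy : N.innerObjective C y ≠ ∞) (hpy : ∀ j, p j < y j)
    (hfar : 0 ≤ ∑ j, N.cutNormal C c j * (p j - c j)) :
    N.improve C c best ≤ (N.innerObjective C p).toReal := by
  have hp : N.innerObjective C p ≠ ∞ := innerObjective_ne_top.2 fun j =>
    ne_top_of_le_ne_top (innerObjective_ne_top.1 hy j) (utilIntegral_mono _ _ (hpy j).le)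
  by_cases h : 0 < N.infCount C c
  · exfalso
    have hlt : ∀ j, util (N.F j) (c j) (C j) = ∞ → p j < c j := by
      intro j hj
      by_contra hle
      have hc0 : 0 ≤ c j := by
        by_contra hneg
        rw [util_of_neg (hN.loss j) (hC j) (not_le.1 hneg)] at hj
        exact ENNReal.zero_ne_top hj
      have h1 := le_lintegral_Ioc (U := fun z => util (N.F j) z (C j)) (a := c j) (b := y j)
        (M := ∞) fun z hz => by
          rw [← hj]; exact util_mono _ _ (le_of_lt hz)
      have h2 : c j < y j := (not_lt.1 hle).trans_lt (hpy j)
      rw [ENNReal.top_mul (by simpa using h2)] at h1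
      exact innerObjective_ne_top.1 hy j (top_le_iff.1 (h1.trans
        (lintegral_mono_set (Ioc_subset_Ioc_left hc0))))
    refine absurd hfar (not_le.2 ?_)
    obtain ⟨j, hj⟩ := infCount_pos_iff.1 h
    refine Finset.sum_neg' (fun l _ => ?_) ⟨j, Finset.mem_univ j, ?_⟩
    · rw [cutNormal, if_pos h]
      split_ifs with hl
      · linarith [hlt l (answer_neg_iff.1 hl)]
      · simp
    · rw [cutNormal, if_pos h, if_pos (answer_neg_iff.2 hj)]
      linarith [hlt j hj]
  · obtain ⟨h2, -, h4⟩ := innerObjective_cut hN hC h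
    have h5 := h4 p hp
    unfold improve
    rw [if_neg h, h2]
    split_ifs <;> linarith

/-- There is a box of nearly optimal points below a point `y` whose coordinates are at most `log G`.
Its width is of the order of `1 / ((1 + Q) G)`, where `Q` is the sum of all demands, so that the
exponents in the carried traffic vary so little that the latter varies by at most `ε / 4`. -/
theorem exists_box (hN : N.Valid) {C : Fin m → ℝ} {ε V Q G η : ℝ} (hε : 0 < ε)
    (hV : V = ∑ r, N.ν r) (hQ : Q = ∑ j, ∑ r, (N.A j r : ℝ)) (hG : G = 2 + 16 * V / ε)
    (hη : η = 1 / ((1 + Q) * G)) :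
    ∃ y, 0 ≤ y ∧ (∀ j, y j ≤ Real.log G) ∧ N.innerObjective C y ≠ ∞ ∧
      ∀ p, (∀ j, y j - 2 * η ≤ p j ∧ p j < y j) →
        (N.innerObjective C p).toReal ≤ N.phi C + ε := by
  have hV0 : 0 ≤ V := hV ▸ Finset.sum_nonneg fun r _ => hN.load_nonneg r
  have hQ0 : 0 ≤ Q := hQ ▸ Finset.sum_nonneg fun j _ => Finset.sum_nonneg fun r _ =>
    Nat.cast_nonneg _
  have hG2 : 2 ≤ G := by rw [hG]; have : 0 ≤ 16 * V / ε := by positivity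
                         linarith
  have hVG : 16 * V ≤ ε * G := by
    rw [hG, mul_add, mul_div_cancel₀ _ hε.ne']; linarith
  have hη0 : 0 < η := by rw [hη]; positivity
  have hηQ : 2 * η * Q ≤ 1 := by
    rw [hη]
    rw [show 2 * (1 / ((1 + Q) * G)) * Q = 2 * Q / ((1 + Q) * G) by ring, div_le_one (by positivity)]
    nlinarith
  have hηV : V * (2 * (2 * η * Q)) ≤ ε / 4 := by
    rw [hη, show V * (2 * (2 * (1 / ((1 + Q) * G)) * Q)) = 4 * V * Q / ((1 + Q) * G) by ring,
      div_le_iff₀ (by positivity)]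
    nlinarith [mul_le_mul_of_nonneg_right hVG hQ0, mul_nonneg hQ0 hV0]
  have hG0 : 0 < G := by linarith
  have hL0 : 0 ≤ Real.log G := Real.log_nonneg (by linarith)
  have hex : ∃ y ∈ Ici (0 : Fin m → ℝ),
      N.innerObjective C y < ENNReal.ofReal (N.phi C + ε / 4) := by
    by_contra hno
    push Not at hno
    have h1 : ENNReal.ofReal (N.phi C + ε / 4) ≤ ENNReal.ofReal (N.phi C) := by
      rw [ofReal_phi]; exact le_iInf₂ hno
    rw [ENNReal.ofReal_le_ofReal_iff (phi_nonneg C)] at h1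
    linarith
  obtain ⟨x, hx0, hx⟩ := hex
  have hxfin : N.innerObjective C x ≠ ∞ := ne_top_of_lt hx
  have hxR : (N.innerObjective C x).toReal ≤ N.phi C + ε / 4 :=
    ENNReal.toReal_le_of_le_ofReal (by linarith [phi_nonneg (N := N) C]) hx.le
  -- Truncating the losses at `log G` increases the carried traffic by at most `V / G`.
  set y : Fin m → ℝ := fun j => min (x j) (Real.log G) with hy
  have hyx : ∀ j, y j ≤ x j := fun j => min_le_left _ _
  have hy0 : 0 ≤ y := fun j => le_min (hx0 j) hL0
  have hyfin : N.innerObjective C y ≠ ∞ := innerObjective_ne_top.2 fun j =>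
    ne_top_of_le_ne_top (innerObjective_ne_top.1 hxfin j) (utilIntegral_mono _ _ (hyx j))
  have hres : N.residual y ≤ N.residual x + V * (1 / G) := by
    rw [hV, residual, residual, Finset.sum_mul, ← Finset.sum_add_distrib]
    refine Finset.sum_le_sum fun r _ => ?_
    rw [← mul_add]
    refine mul_le_mul_of_nonneg_left ?_ (hN.load_nonneg r)
    by_cases hr : ∃ j, N.A j r ≠ 0 ∧ Real.log G < x j
    · obtain ⟨j, hA, hj⟩ := hr
      have h1 : Real.log G ≤ ∑ j, y j * (N.A j r : ℝ) := calc
        Real.log G = y j * 1 := by rw [mul_one, hy]; exact (min_eq_right hj.le).symm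
        _ ≤ y j * N.A j r := mul_le_mul_of_nonneg_left
            (by exact_mod_cast Nat.one_le_iff_ne_zero.2 hA) (hy0 j)
        _ ≤ _ := Finset.single_le_sum (f := fun l => y l * (N.A l r : ℝ))
            (fun l _ => mul_nonneg (hy0 l) (Nat.cast_nonneg _)) (Finset.mem_univ j)
      have h2 : Real.exp (-∑ j, y j * (N.A j r : ℝ)) ≤ 1 / G := by
        rw [one_div, ← Real.exp_log hG0, ← Real.exp_neg]
        exact Real.exp_le_exp.2 (neg_le_neg h1)
      linarith [Real.exp_pos (-∑ j, x j * (N.A j r : ℝ))]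
    · push Not at hr
      have h1 : ∑ j, y j * (N.A j r : ℝ) = ∑ j, x j * (N.A j r : ℝ) := by
        refine Finset.sum_congr rfl fun j _ => ?_
        by_cases hA : N.A j r = 0
        · simp [hA]
        · rw [show y j = x j from min_eq_left (hr j hA)]
      rw [h1]
      have : 0 < 1 / G := by positivity
      linarith
  have hVG' : V * (1 / G) ≤ ε / 16 := by
    rw [mul_one_div, div_le_iff₀ hG0]; linarith
  refine ⟨y, hy0, fun j => min_le_right _ _, hyfin, fun p hp => ?_⟩
  have hpfin : N.innerObjective C p ≠ ∞ := innerObjective_ne_top.2 fun j =>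
    ne_top_of_le_ne_top (innerObjective_ne_top.1 hyfin j) (utilIntegral_mono _ _ (hp j).2.le)
  have hresp : N.residual p ≤ N.residual y + V * (2 * (2 * η * Q)) := by
    rw [hV, residual, residual, Finset.sum_mul, ← Finset.sum_add_distrib]
    refine Finset.sum_le_sum fun r _ => ?_
    rw [← mul_add]
    refine mul_le_mul_of_nonneg_left ?_ (hN.load_nonneg r)
    have hS : ∑ j, (N.A j r : ℝ) ≤ Q := by
      rw [hQ]
      exact Finset.sum_le_sum fun j _ => Finset.single_le_sum (f := fun r => (N.A j r : ℝ))
        (fun _ _ => Nat.cast_nonneg _) (Finset.mem_univ r)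
    have h1 : ∑ j, y j * (N.A j r : ℝ) - 2 * η * Q ≤ ∑ j, p j * (N.A j r : ℝ) := by
      have h2 : ∑ j, (y j - 2 * η) * (N.A j r : ℝ) ≤ ∑ j, p j * (N.A j r : ℝ) :=
        Finset.sum_le_sum fun j _ => mul_le_mul_of_nonneg_right (hp j).1 (Nat.cast_nonneg _)
      simp only [sub_mul, Finset.sum_sub_distrib, ← Finset.mul_sum] at h2
      nlinarith
    have h3 : Real.exp (-∑ j, p j * (N.A j r : ℝ)) ≤
        Real.exp (-∑ j, y j * (N.A j r : ℝ)) * Real.exp (2 * η * Q) := by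
      rw [← Real.exp_add]
      exact Real.exp_le_exp.2 (by linarith)
    have h4 : Real.exp (2 * η * Q) ≤ 1 + 2 * (2 * η * Q) := by
      have h5 : 0 ≤ 2 * η * Q := by positivity
      have := Real.abs_exp_sub_one_le (x := 2 * η * Q) (by rw [abs_of_nonneg h5]; exact hηQ)
      rw [abs_of_nonneg h5] at this
      linarith [le_abs_self (Real.exp (2 * η * Q) - 1)]
    have h6 : Real.exp (-∑ j, y j * (N.A j r : ℝ)) ≤ 1 := by
      rw [Real.exp_le_one_iff, neg_nonpos]
      exact Finset.sum_nonneg fun j _ => mul_nonneg (hy0 j) (Nat.cast_nonneg _)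
    have h7 : 0 ≤ 2 * (2 * η * Q) := by positivity
    nlinarith [Real.exp_pos (-∑ j, y j * (N.A j r : ℝ))]
  have hint : ∀ q : Fin m → ℝ, (∀ j, q j ≤ x j) → ∑ j, (utilIntegral (N.F j) (q j) (C j)).toReal ≤
      ∑ j, (utilIntegral (N.F j) (x j) (C j)).toReal := fun q hq =>
    Finset.sum_le_sum fun j _ => ENNReal.toReal_mono (innerObjective_ne_top.1 hxfin j)
      (utilIntegral_mono _ _ (hq j))
  rw [toReal_innerObjective hN.load_nonneg hpfin]
  rw [toReal_innerObjective hN.load_nonneg hxfin] at hxR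
  have := hint p fun j => (hp j).2.le.trans (hyx j)
  linarith

end Network

/-! ### The initial simplex -/

section InitialSimplex

variable {m : ℕ}

/-- The vertices `-1 + W e_i` and `-1`, where `1` is the vector with coordinates one. -/
def initialSimplex (W : ℝ) (i : Fin (m + 1)) (j : Fin m) : ℝ :=
  if (i : ℕ) = j then W - 1 else -1

theorem inSimplex_initial {W L : ℝ} (hW : 0 < W) (hmW : m * (L + 1) ≤ W) {p : Fin m → ℝ}
    (h1 : ∀ j, -1 ≤ p j) (h2 : ∀ j, p j ≤ L) : InSimplex (initialSimplex W) p := by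
  have hsum : ∑ j, (p j + 1) / W ≤ 1 := by
    rw [← Finset.sum_div, div_le_one hW]
    calc ∑ j, (p j + 1) ≤ ∑ _j : Fin m, (L + 1) :=
          Finset.sum_le_sum fun j _ => by linarith [h2 j]
      _ ≤ W := by
          rw [Finset.sum_const, nsmul_eq_mul, Finset.card_univ, Fintype.card_fin]; exact hmW
  refine ⟨Fin.snoc (fun j => (p j + 1) / W) (1 - ∑ j, (p j + 1) / W), fun i => ?_, ?_, fun j => ?_⟩
  · refine Fin.lastCases ?_ (fun j => ?_) i
    · simpa using hsum
    · simpa using div_nonneg (by linarith [h1 j]) hW.le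
  · rw [Fin.sum_univ_castSucc]; simp
  · rw [Fin.sum_univ_castSucc]
    have h3 : ∀ l : Fin m, (p l + 1) / W * initialSimplex W l.castSucc j =
        (if l = j then p j + 1 else 0) - (p l + 1) / W := by
      intro l
      by_cases hl : l = j
      · subst hl
        simp only [initialSimplex, Fin.val_castSucc, if_true]
        field_simp
      · have : (l : ℕ) ≠ j := fun h => hl (Fin.ext h)
        simp [initialSimplex, this, hl]
    have h4 : ¬ m = (j : ℕ) := j.2.ne'
    simp only [Fin.snoc_castSucc, Fin.snoc_last, h3, Finset.sum_sub_distrib]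
    simp [initialSimplex, h4]

theorem abs_det_initialSimplex_le {W : ℝ} (hW : 1 ≤ W) :
    |(homMatrix (initialSimplex (m := m) W)).det| ≤ (((m : ℝ) + 1) * W) ^ (m + 1) := by
  refine (abs_det_le_prod_sum _).trans ?_
  have h : ∀ i, ∑ j, |homMatrix (initialSimplex (m := m) W) i j| ≤ ((m : ℝ) + 1) * W := by
    intro i
    calc ∑ j, |homMatrix (initialSimplex (m := m) W) i j| ≤ ∑ _j : Fin (m + 1), W := by
          refine Finset.sum_le_sum fun j _ => ?_
          refine Fin.cases ?_ (fun l => ?_) j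
          · simpa [homMatrix] using hW
          · simp only [homMatrix, Matrix.of_apply, Fin.cons_succ, initialSimplex]
            split_ifs
            · rw [abs_of_nonneg (by linarith)]; linarith
            · simpa using hW
      _ = _ := by simp
  calc _ ≤ ∏ _i : Fin (m + 1), ((m : ℝ) + 1) * W :=
        Finset.prod_le_prod (fun i _ => Finset.sum_nonneg fun j _ => abs_nonneg _) fun i _ => h i
    _ = _ := by simp

end InitialSimplex

/-! ### Single-assignment blocks -/

namespace Assign

theorem semBlock_idx (O : Oracle) (L : List Assign) (s : State) : (semBlock O L s).idx = s.idx := by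
  induction L generalizing s with
  | nil => rfl
  | cons A L ih => exact (ih (A.sem O s)).trans rfl

theorem semBlock_arr_of_ne {O : Oracle} {L : List Assign} {s : State} {a : ℕ}
    (h : ∀ A ∈ L, A.name ≠ a) : (semBlock O L s).arr a = s.arr a := by
  induction L generalizing s with
  | nil => rfl
  | cons A L ih =>
    refine (ih fun A' h' => h A' (List.mem_cons_of_mem _ h')).trans ?_
    funext p q
    simp [sem, (h A List.mem_cons_self).symm]

/-- If no array is overwritten after it has been written or read, then the final state satisfies
the assignments as equations. -/
theorem semBlock_arr {O : Oracle} {L : List Assign} {s : State} (hL : ∀ A ∈ L, A.wf)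
    (hp : L.Pairwise fun A A' => A'.name ≠ A.name ∧ A.e.wf A'.name 2) {A : Assign} (hA : A ∈ L)
    {p q : ℕ} (hr : p < s.idx A.rows) (hc : q < s.idx A.cols) :
    (semBlock O L s).arr A.name p q = A.val O (semBlock O L s) p q := by
  induction L generalizing s with
  | nil => simp at hA
  | cons A' L ih =>
    rw [List.pairwise_cons] at hp
    rcases List.mem_cons.1 hA with rfl | hA'
    · have h1 : (semBlock O (A :: L) s).arr A.name = (A.sem O s).arr A.name :=
        semBlock_arr_of_ne (s := A.sem O s) fun A' h' => (hp.1 A' h').1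
      rw [h1]
      simp only [sem, hr, hc, and_self, if_true]
      -- The arrays that are read by the assignment are not changed by it or later.
      have key : ∀ (L' : List Assign) (s : State), (∀ A' ∈ L', A.e.wf A'.name 2) →
          A.val O s p q = A.val O (semBlock O L' s) p q := by
        intro L'
        induction L' with
        | nil => intro s _; rfl
        | cons A' L' ih =>
          intro s h
          refine Eq.trans ?_ (ih (A'.sem O s) fun B hB => h B (List.mem_cons_of_mem _ hB))
          refine (RealExpr.eval_congr (w := A'.name) (s := (s.setIdx 10 p).setIdx 11 q)
            (s' := ((A'.sem O s).setIdx 10 p).setIdx 11 q) A.e (h A' List.mem_cons_self) rfl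
            fun a _ hne => ?_).symm
          funext p q
          simp [sem, State.setIdx, hne]
      refine key (A :: L) s fun A' h' => ?_
      rcases List.mem_cons.1 h' with rfl | h'
      · have := hL A' List.mem_cons_self
        simp only [wf, Bool.and_eq_true] at this
        exact this.2
      · exact (hp.1 A' h').2
    · exact ih (s := A'.sem O s) (fun B hB => hL B (List.mem_cons_of_mem _ hB)) hp.2 hA' hr hc

end Assign

/-! ### The program -/

namespace RealExpr

instance : Add RealExpr := ⟨.op .add⟩
instance : Sub RealExpr := ⟨.op .sub⟩
instance : Mul RealExpr := ⟨.op .mul⟩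
instance : Div RealExpr := ⟨.op .div⟩

variable (O : Oracle) (a b : RealExpr) (l : ℕ) (s : State)

theorem eval_add : (a + b).eval O l s = a.eval O l s + b.eval O l s := rfl
theorem eval_sub : (a - b).eval O l s = a.eval O l s - b.eval O l s := rfl
theorem eval_mul : (a * b).eval O l s = a.eval O l s * b.eval O l s := rfl
theorem eval_div : (a / b).eval O l s = a.eval O l s / b.eval O l s := rfl

/-- The entry `(i, j)` of an array. -/
def mat (a i j : ℕ) : RealExpr := .cell ⟨a, i, j⟩

/-- The entry `i` of a vector. -/
def vec (a i : ℕ) : RealExpr := .cell ⟨a, i, 4⟩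

/-- A scalar variable. -/
def scalar (a : ℕ) : RealExpr := .cell ⟨a, 4, 4⟩

/-- The content of an index register as a real number. -/
def ofIdx (b : ℕ) : RealExpr := .sum b (.const 1)

end RealExpr

open RealExpr

/-- The initialization. Besides the input in arrays `0` to `3` the variables are: `4` the best value
so far; `5` the sum `V` of the offered loads; `6` the sum `Q` of the demands; `7` the number `G`;
`8` the number of vertices; `9` the size `W` of the initial simplex; `10` the number of rounds;
`11` the vertices of the simplex. The round counter `12` is initially zero. -/
def initBlock : List Assign :=
  [⟨5, 2, 2, .sum 1 (vec 0 12)⟩,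
   ⟨6, 2, 2, .sum 0 (.sum 1 (mat 1 12 13))⟩,
   ⟨7, 2, 2, .const 2 + .const 16 * scalar 5 / scalar 3⟩,
   ⟨8, 2, 2, ofIdx 3⟩,
   ⟨9, 2, 2, .const 2 * scalar 8 * (.log (scalar 7) + .const 1)⟩,
   ⟨10, 2, 2, .const 16 * scalar 8 * scalar 8 * scalar 8 *
      .log (scalar 8 * scalar 9 * ((.const 1 + scalar 6) * scalar 7))⟩,
   ⟨11, 3, 0, .ite (ofIdx 10) (ofIdx 11) (.const (-1))
      (.ite (ofIdx 11) (ofIdx 10) (.const (-1)) (scalar 9 - .const 1))⟩,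
   ⟨4, 2, 2, scalar 5⟩]

/-- The computations of a round: `13` the centroid `c`; `14` the utilizations at `c`; `15` the
carried loads of the flows; `16` the number of infinite utilizations; `17` the normal of the cutting
plane; `18` the new best value; `19` the position of the vertices relative to the cutting plane;
`20` their rank, with ties broken by the number of the vertex; `21` the deepest vertex;
`22` its depth; `23` the new vertices; `24` the new round counter. -/
def roundBlock : List Assign :=
  [⟨13, 0, 2, .sum 3 (mat 11 12 10) / scalar 8⟩,
   ⟨14, 0, 2, .op (.util 10) (vec 13 10) (vec 2 10)⟩,
   ⟨15, 1, 2, vec 0 10 * .exp (.const 0 - .sum 0 (vec 13 12 * mat 1 12 10))⟩,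
   ⟨16, 2, 2, .sum 0 (.ite (vec 14 12) (.const 0) (.const 1) (.const 0))⟩,
   ⟨17, 0, 2, .ite (.const 0) (scalar 16) (.ite (vec 14 10) (.const 0) (.const 1) (.const 0))
      (vec 14 10 - .sum 1 (mat 1 10 12 * vec 15 12))⟩,
   ⟨18, 2, 2, .ite (.const 0) (scalar 16) (scalar 4)
      (.ite (.sum 1 (vec 15 12) + .sum 0 (.op (.utilIntegral 12) (vec 13 12) (vec 2 12)))
        (scalar 4)
        (.sum 1 (vec 15 12) + .sum 0 (.op (.utilIntegral 12) (vec 13 12) (vec 2 12)))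
        (scalar 4))⟩,
   ⟨19, 3, 2, .sum 0 (vec 17 12 * (mat 11 10 12 - vec 13 12))⟩,
   ⟨20, 3, 2, .sum 3 (.ite (vec 19 12) (vec 19 10) (.const 1) (.const 0)) +
      .sum 10 (.ite (vec 19 10) (vec 19 12) (.const 0) (.const 1))⟩,
   ⟨21, 0, 2, .sum 3 (.ite (.const 0) (vec 20 12) (.const 0) (mat 11 12 10))⟩,
   ⟨22, 2, 2, .sum 3 (.ite (.const 0) (vec 20 12) (.const 0) (.const 0 - vec 19 12))⟩,
   ⟨23, 3, 0, vec 21 11 + (mat 11 10 11 - vec 21 11) /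
      (.const 1 + .const 1 / (.const 8 * scalar 8 * scalar 8) * (vec 19 10 / scalar 22))⟩,
   ⟨24, 2, 2, scalar 12 + .const 1⟩]

/-- The updates at the end of a round. -/
def commitBlock : List Assign :=
  [⟨4, 2, 2, scalar 18⟩, ⟨11, 3, 0, mat 23 10 11⟩, ⟨12, 2, 2, scalar 24⟩]

/-- The program: the simplex cutting method for the inner objective. -/
def phiProgram : Prog :=
  .seq (.instr (.idxConst 2 1)) (.seq (.instr (.idxAdd 3 0 2)) (.seq (Assign.block initBlock)
    (.loop (.realLt ⟨12, 4, 4⟩ ⟨10, 4, 4⟩)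
      (.seq (Assign.block roundBlock) (Assign.block commitBlock)))))

theorem wf_initBlock : ∀ A ∈ initBlock, A.wf := by decide
theorem wf_roundBlock : ∀ A ∈ roundBlock, A.wf := by decide
theorem wf_commitBlock : ∀ A ∈ commitBlock, A.wf := by decide

theorem pairwise_initBlock :
    initBlock.Pairwise fun A A' => A'.name ≠ A.name ∧ A.e.wf A'.name 2 := by decide
theorem pairwise_roundBlock :
    roundBlock.Pairwise fun A A' => A'.name ≠ A.name ∧ A.e.wf A'.name 2 := by decide
theorem pairwise_commitBlock :
    commitBlock.Pairwise fun A A' => A'.name ≠ A.name ∧ A.e.wf A'.name 2 := by decide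

/-- The content of the index registers between the assignments of the program. Register `3` holds
the number `m + 1` of vertices. -/
def registers (m R i : ℕ) : ℕ :=
  if i = 0 then m else if i = 1 then R else if i = 2 then 1 else if i = 3 then m + 1 else 0

theorem ready_registers {m R : ℕ} {s : State} (h : s.idx = registers m R) :
    Ready s 0 (m + R + 1) where
  one := by simp [h, registers]
  zero := by simp [h, registers]
  fresh i hi := by
    rw [h, registers, if_neg (by omega), if_neg (by omega), if_neg (by omega), if_neg (by omega)]
  le i := by
    rw [h, registers]; split_ifs <;> omega

/-- A minimum can be found by counting: exactly one index `k` has rank zero, if ties are broken in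
favour of smaller indices. -/
theorem exists_rank_zero (α : ℕ → ℝ) {M : ℕ} (hM : 0 < M) : ∃ k < M, (∀ i < M, α k ≤ α i) ∧
    ∀ i < M, (0 < (∑ x ∈ Finset.range M, if α x < α i then (1 : ℝ) else 0) +
      ∑ x ∈ Finset.range i, if α i < α x then (0 : ℝ) else 1) ↔ i ≠ k := by
  classical
  have hex : ∃ k, k < M ∧ ∀ i < M, α k ≤ α i := by
    obtain ⟨k, hk, h⟩ := Finset.exists_min_image (Finset.range M) α ⟨0, Finset.mem_range.2 hM⟩
    exact ⟨k, Finset.mem_range.1 hk, fun i hi => h i (Finset.mem_range.2 hi)⟩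
  have hk := Nat.find_spec hex
  have hmin := fun i => Nat.find_min (m := i) hex
  set k := Nat.find hex
  refine ⟨k, hk.1, hk.2, fun i hi => ?_⟩
  have h1 : ∀ x ∈ Finset.range M, (0 : ℝ) ≤ if α x < α i then (1 : ℝ) else 0 :=
    fun x _ => by split_ifs <;> norm_num
  have h2 : ∀ x ∈ Finset.range i, (0 : ℝ) ≤ if α i < α x then (0 : ℝ) else 1 :=
    fun x _ => by split_ifs <;> norm_num
  constructor
  · rintro hpos rfl
    refine hpos.ne' ?_
    rw [Finset.sum_eq_zero, Finset.sum_eq_zero, add_zero]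
    · intro x hx
      refine if_pos ?_
      have hxk := Finset.mem_range.1 hx
      by_contra hle
      exact hmin x hxk ⟨hxk.trans hi, fun j hj => (not_lt.1 hle).trans (hk.2 j hj)⟩
    · intro x hx
      exact if_neg (not_lt.2 (hk.2 x (Finset.mem_range.1 hx)))
  · intro hne
    rcases (hk.2 i hi).lt_or_eq with hlt | heq
    · refine add_pos_of_pos_of_nonneg ?_ (Finset.sum_nonneg h2)
      exact Finset.sum_pos' h1 ⟨k, Finset.mem_range.2 hk.1, by simp [hlt]⟩
    · refine add_pos_of_nonneg_of_pos (Finset.sum_nonneg h1) ?_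
      have hki : k < i := by
        rcases lt_or_ge i k with h | h
        · exact absurd ⟨hi, fun j hj => heq ▸ hk.2 j hj⟩ (hmin i h)
        · exact lt_of_le_of_ne h hne.symm
      exact Finset.sum_pos' h2 ⟨k, Finset.mem_range.2 hki, by simp [heq]⟩

namespace Network

variable {m n R : ℕ} {N : Network m n R}

/-- The state holds the index registers and the input data. -/
structure Holds (N : Network m n R) (C : Fin m → ℝ) (s : State) : Prop where
  idx : s.idx = registers m R
  load : ∀ r : Fin R, s.arr 0 r 0 = N.ν r
  demand : ∀ (j : Fin m) (r : Fin R), s.arr 1 j r = N.A j r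
  capacity : ∀ j : Fin m, s.arr 2 j 0 = C j

theorem Holds.congr {C : Fin m → ℝ} {s t : State} (h : N.Holds C s) (hi : t.idx = s.idx)
    (ha : ∀ a < 3, t.arr a = s.arr a) : N.Holds C t where
  idx := hi.trans h.idx
  load := by rw [ha 0 (by omega)]; exact h.load
  demand := by rw [ha 1 (by omega)]; exact h.demand
  capacity := by rw [ha 2 (by omega)]; exact h.capacity

theorem initBlock_spec {C : Fin m → ℝ} {s t : State} {ε V Q G W : ℝ} (hs : N.Holds C s)
    (hε : s.arr 3 0 0 = ε) (ht : t = Assign.semBlock N.oracle initBlock s)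
    (hV : V = ∑ r, N.ν r) (hQ : Q = ∑ j, ∑ r, (N.A j r : ℝ)) (hG : G = 2 + 16 * V / ε)
    (hW : W = 2 * ((m : ℝ) + 1) * (Real.log G + 1)) :
    N.Holds C t ∧ t.arr 4 0 0 = V ∧ t.arr 8 0 0 = (m : ℝ) + 1 ∧ t.arr 12 0 0 = s.arr 12 0 0 ∧
    t.arr 10 0 0 = 16 * ((m : ℝ) + 1) ^ 3 * Real.log (((m : ℝ) + 1) * W * ((1 + Q) * G)) ∧
    ∀ (i : Fin (m + 1)) (j : Fin m), t.arr 11 i j = initialSimplex W i j := by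
  have H := fun A hA p q => Assign.semBlock_arr (O := N.oracle) (s := s) wf_initBlock
    pairwise_initBlock (A := A) hA (p := p) (q := q)
  have hti : t.idx = s.idx := by rw [ht]; exact Assign.semBlock_idx _ _ _
  have hne : ∀ a, (∀ A ∈ initBlock, A.name ≠ a) → t.arr a = s.arr a := fun a h => by
    rw [ht]; exact Assign.semBlock_arr_of_ne h
  rw [← ht, hs.idx] at H
  have hD : N.Holds C t := hs.congr hti fun a ha => hne a (by interval_cases a <;> decide)
  have hti' : t.idx = registers m R := hD.idx
  have e5 := H _ (List.getElem_mem (n := 0) (by decide)) 0 0 Nat.one_pos Nat.one_pos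
  have e6 := H _ (List.getElem_mem (n := 1) (by decide)) 0 0 Nat.one_pos Nat.one_pos
  have e7 := H _ (List.getElem_mem (n := 2) (by decide)) 0 0 Nat.one_pos Nat.one_pos
  have e8 := H _ (List.getElem_mem (n := 3) (by decide)) 0 0 Nat.one_pos Nat.one_pos
  have e9 := H _ (List.getElem_mem (n := 4) (by decide)) 0 0 Nat.one_pos Nat.one_pos
  have e10 := H _ (List.getElem_mem (n := 5) (by decide)) 0 0 Nat.one_pos Nat.one_pos
  have e11 := H _ (List.getElem_mem (n := 6) (by decide))
  have e4 := H _ (List.getElem_mem (n := 7) (by decide)) 0 0 Nat.one_pos Nat.one_pos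
  simp [initBlock, Assign.val, eval, Op.eval, RealExpr.eval_add, RealExpr.eval_sub,
    RealExpr.eval_mul, RealExpr.eval_div, vec, mat, scalar, ofIdx, State.get, State.setIdx, hti',
    registers] at e5 e6 e7 e8 e9 e10 e11 e4
  have e3 : t.arr 3 0 0 = ε := by rw [hne 3 (by decide), hε]
  have h5 : t.arr 5 0 0 = V := by
    rw [e5, Finset.sum_range, hV]; exact Finset.sum_congr rfl fun r _ => hD.load r
  have h6 : t.arr 6 0 0 = Q := by
    rw [e6, Finset.sum_range, hQ]
    refine Finset.sum_congr rfl fun j _ => ?_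
    rw [Finset.sum_range]; exact Finset.sum_congr rfl fun r _ => hD.demand j r
  have h7 : t.arr 7 0 0 = G := by rw [e7, h5, e3, hG]
  have h9 : t.arr 9 0 0 = W := by rw [e9, e8, h7, hW]
  refine ⟨hD, e4.trans h5, e8, by rw [hne 12 (by decide)], ?_, fun i j => ?_⟩
  · rw [e10, e8, h9, h6, h7]; ring
  · rw [e11 i j (by omega) j.2, h9, initialSimplex]
    split_ifs <;> first | rfl | omega

theorem roundBlock_spec {C : Fin m → ℝ} {s t : State} {v : Fin (m + 1) → Fin m → ℝ} {c : Fin m → ℝ}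
    (hs : N.Holds C s) (h8 : s.arr 8 0 0 = (m : ℝ) + 1)
    (hv : ∀ (i : Fin (m + 1)) (j : Fin m), s.arr 11 i j = v i j)
    (hc : ∀ j, c j = (∑ i, v i j) / ((m : ℝ) + 1))
    (ht : t = Assign.semBlock N.oracle roundBlock s) :
    N.Holds C t ∧ t.arr 8 0 0 = (m : ℝ) + 1 ∧ t.arr 10 = s.arr 10 ∧
    t.arr 18 0 0 = N.improve C c (s.arr 4 0 0) ∧ t.arr 24 0 0 = s.arr 12 0 0 + 1 ∧
    ∃ (α : Fin (m + 1) → ℝ) (k : Fin (m + 1)),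
      (∀ i, α i = ∑ j, N.cutNormal C c j * (v i j - c j)) ∧ (∀ i, α k ≤ α i) ∧
      ∀ (i : Fin (m + 1)) (j : Fin m), t.arr 23 i j =
        v k j + (v i j - v k j) / (1 + 1 / (8 * ((m : ℝ) + 1) ^ 2) * (α i / -α k)) := by
  have H := fun A hA p q => Assign.semBlock_arr (O := N.oracle) (s := s) wf_roundBlock
    pairwise_roundBlock (A := A) hA (p := p) (q := q)
  have hti : t.idx = s.idx := by rw [ht]; exact Assign.semBlock_idx _ _ _
  have hne : ∀ a, (∀ A ∈ roundBlock, A.name ≠ a) → t.arr a = s.arr a := fun a h => by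
    rw [ht]; exact Assign.semBlock_arr_of_ne h
  rw [← ht, hs.idx] at H
  have hD : N.Holds C t := hs.congr hti fun a ha => hne a (by interval_cases a <;> decide)
  have hti' : t.idx = registers m R := hD.idx
  have e13 := fun p hp => H _ (List.getElem_mem (n := 0) (by decide)) p 0 hp Nat.one_pos
  have e14 := fun p hp => H _ (List.getElem_mem (n := 1) (by decide)) p 0 hp Nat.one_pos
  have e15 := fun p hp => H _ (List.getElem_mem (n := 2) (by decide)) p 0 hp Nat.one_pos
  have e16 := H _ (List.getElem_mem (n := 3) (by decide)) 0 0 Nat.one_pos Nat.one_pos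
  have e17 := fun p hp => H _ (List.getElem_mem (n := 4) (by decide)) p 0 hp Nat.one_pos
  have e18 := H _ (List.getElem_mem (n := 5) (by decide)) 0 0 Nat.one_pos Nat.one_pos
  have e19 := fun p hp => H _ (List.getElem_mem (n := 6) (by decide)) p 0 hp Nat.one_pos
  have e20 := fun p hp => H _ (List.getElem_mem (n := 7) (by decide)) p 0 hp Nat.one_pos
  have e21 := fun p hp => H _ (List.getElem_mem (n := 8) (by decide)) p 0 hp Nat.one_pos
  have e22 := H _ (List.getElem_mem (n := 9) (by decide)) 0 0 Nat.one_pos Nat.one_pos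
  have e23 := H _ (List.getElem_mem (n := 10) (by decide))
  have e24 := H _ (List.getElem_mem (n := 11) (by decide)) 0 0 Nat.one_pos Nat.one_pos
  simp [roundBlock, Assign.val, eval, Op.eval, RealExpr.eval_add, RealExpr.eval_sub,
    RealExpr.eval_mul, RealExpr.eval_div, vec, mat, scalar, State.get, State.setIdx, hti',
    registers, -one_div, -Finset.sum_boole]
    at e13 e14 e15 e16 e17 e18 e19 e20 e21 e22 e23 e24
  have h8' : t.arr 8 0 0 = (m : ℝ) + 1 := by rw [hne 8 (by decide), h8]
  have hv' : ∀ (i : Fin (m + 1)) (j : Fin m), t.arr 11 i j = v i j := by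
    rw [hne 11 (by decide)]; exact hv
  have h13 : ∀ j : Fin m, t.arr 13 j 0 = c j := fun j => by
    rw [e13 j j.2, h8', hc j, Finset.sum_range]
    simp only [hv']
  have h14 : ∀ j : Fin m, t.arr 14 j 0 = answer (util (N.F j) (c j) (C j)) := fun j => by
    rw [e14 j j.2, h13, hD.capacity]
    simp [oracle]
  have h15 : ∀ r : Fin R, t.arr 15 r 0 = N.ν r * Real.exp (-∑ l, c l * N.A l r) := fun r => by
    rw [e15 r r.2, hD.load, Finset.sum_range]
    simp only [h13, hD.demand]
  have h16 : t.arr 16 0 0 = N.infCount C c := by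
    rw [e16, Finset.sum_range, infCount]
    simp only [h14]
  have h17 : ∀ j : Fin m, t.arr 17 j 0 = N.cutNormal C c j := fun j => by
    rw [e17 j j.2, h16, h14, cutNormal, marginal, Finset.sum_range]
    simp only [hD.demand, h15]
  have h18 : t.arr 18 0 0 = N.improve C c (s.arr 4 0 0) := by
    have hI : ∑ x ∈ Finset.range m, N.oracle.utilIntegral x (t.arr 13 x 0) (t.arr 2 x 0) =
        ∑ j, answer (utilIntegral (N.F j) (c j) (C j)) := by
      rw [Finset.sum_range]
      refine Finset.sum_congr rfl fun j _ => ?_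
      rw [h13, hD.capacity]
      simp [oracle]
    have hR : ∑ x ∈ Finset.range R, t.arr 15 x 0 = N.residual c := by
      rw [Finset.sum_range]; exact Finset.sum_congr rfl fun r _ => h15 r
    rw [e18, h16, hI, hR, hne 4 (by decide), improve]
  have h19 : ∀ i : Fin (m + 1), t.arr 19 i 0 = ∑ j, N.cutNormal C c j * (v i j - c j) := fun i => by
    rw [e19 i (by omega), Finset.sum_range]
    simp only [h17, hv', h13]
  obtain ⟨k, hk, hmin, hrank⟩ := exists_rank_zero (fun i => t.arr 19 i 0) (Nat.succ_pos m)
  have h20 : ∀ i < m + 1, 0 < t.arr 20 i 0 ↔ i ≠ k := fun i hi => by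
    rw [e20 i (by omega)]; exact hrank i hi
  have hsel : ∀ f : ℕ → ℝ,
      (∑ x ∈ Finset.range (m + 1), if 0 < t.arr 20 x 0 then 0 else f x) = f k := by
    intro f
    rw [Finset.sum_eq_single k]
    · exact if_neg (by rw [h20 k hk]; simp)
    · intro x hx hne
      exact if_pos ((h20 x (Finset.mem_range.1 hx)).2 hne)
    · intro h; exact absurd (Finset.mem_range.2 hk) h
  have h21 : ∀ j : Fin m, t.arr 21 j 0 = v ⟨k, hk⟩ j := fun j => by
    rw [e21 j j.2, hsel]; exact hv' ⟨k, hk⟩ j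
  refine ⟨hD, h8', hne 10 (by decide), h18, by rw [e24, hne 12 (by decide)],
    fun i => t.arr 19 i 0, ⟨k, hk⟩, h19, fun i => hmin i i.2, fun i j => ?_⟩
  rw [e23 i j (by omega) j.2, h21, hv', h8', e22, hsel]
  rw [show 8 * ((m : ℝ) + 1) * ((m : ℝ) + 1) = 8 * ((m : ℝ) + 1) ^ 2 by ring]

theorem commitBlock_spec {C : Fin m → ℝ} {s t : State} (hs : N.Holds C s)
    (ht : t = Assign.semBlock N.oracle commitBlock s) :
    N.Holds C t ∧ t.arr 8 = s.arr 8 ∧ t.arr 10 = s.arr 10 ∧ t.arr 4 0 0 = s.arr 18 0 0 ∧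
    t.arr 12 0 0 = s.arr 24 0 0 ∧
    ∀ (i : Fin (m + 1)) (j : Fin m), t.arr 11 i j = s.arr 23 i j := by
  have H := fun A hA p q => Assign.semBlock_arr (O := N.oracle) (s := s) wf_commitBlock
    pairwise_commitBlock (A := A) hA (p := p) (q := q)
  have hti : t.idx = s.idx := by rw [ht]; exact Assign.semBlock_idx _ _ _
  have hne : ∀ a, (∀ A ∈ commitBlock, A.name ≠ a) → t.arr a = s.arr a := fun a h => by
    rw [ht]; exact Assign.semBlock_arr_of_ne h
  rw [← ht, hs.idx] at H
  have hD : N.Holds C t := hs.congr hti fun a ha => hne a (by interval_cases a <;> decide)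
  have hti' : t.idx = registers m R := hD.idx
  have e4 := H _ (List.getElem_mem (n := 0) (by decide)) 0 0 Nat.one_pos Nat.one_pos
  have e11 := H _ (List.getElem_mem (n := 1) (by decide))
  have e12 := H _ (List.getElem_mem (n := 2) (by decide)) 0 0 Nat.one_pos Nat.one_pos
  simp [commitBlock, Assign.val, eval, mat, scalar, State.get, State.setIdx, hti', registers]
    at e4 e11 e12
  refine ⟨hD, hne 8 (by decide), hne 10 (by decide), ?_, ?_, fun i j => ?_⟩
  · rw [e4, hne 18 (by decide)]
  · rw [e12, hne 24 (by decide)]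
  · rw [e11 i j (by omega) j.2, hne 23 (by decide)]

/-! ### Correctness of the program -/

/-- The simplex that a state holds. -/
def vertices (m : ℕ) (s : State) (i : Fin (m + 1)) (j : Fin m) : ℝ := s.arr 11 i j

/-- The loop invariant after `x` of `K` rounds. The best value found is at least `φ`; it is at most
the objective at one of the corners of a box of nearly optimal points, or else these corners still
lie in the simplex, whose volume has decreased `x` times. -/
structure Invariant (N : Network m n R) (C b : Fin m → ℝ) (η D K : ℝ) (x : ℕ) (s : State) :
    Prop where
  holds : N.Holds C s
  count : s.arr 8 0 0 = (m : ℝ) + 1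
  rounds : s.arr 10 0 0 = K
  counter : s.arr 12 0 0 = x
  phi_le : N.phi C ≤ s.arr 4 0 0
  progress : (∃ i, s.arr 4 0 0 ≤ (N.innerObjective C (corner b η i)).toReal) ∨
    (∀ i, InSimplex (vertices m s) (corner b η i)) ∧
      |(homMatrix (vertices m s)).det| ≤ D * Real.exp (-(x / (16 * ((m : ℝ) + 1) ^ 2)))

theorem Holds.agree {C : Fin m → ℝ} {s t : State} (h : N.Holds C s) (ha : t.Agree s) :
    N.Holds C t :=
  h.congr ha.1 fun a h' => ha.2 a (by omega)

theorem Invariant.agree {C b : Fin m → ℝ} {η D K : ℝ} {x : ℕ} {s t : State}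
    (h : N.Invariant C b η D K x s) (ha : t.Agree s) : N.Invariant C b η D K x t := by
  have hv : vertices m t = vertices m s := by
    funext i j; simp only [vertices, ha.2 11 (by omega)]
  constructor
  · exact h.holds.agree ha
  · rw [ha.2 8 (by omega)]; exact h.count
  · rw [ha.2 10 (by omega)]; exact h.rounds
  · rw [ha.2 12 (by omega)]; exact h.counter
  · rw [ha.2 4 (by omega)]; exact h.phi_le
  · rw [ha.2 4 (by omega), hv]; exact h.progress

/-- A bound for the running time of a round. -/
def roundCost (B : ℕ) : ℕ := Assign.costBlock roundBlock B + Assign.costBlock commitBlock B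

theorem Invariant.round (hN : N.Valid) {C b y : Fin m → ℝ} {η D K : ℝ} (hC : 0 ≤ C)
    (hy : N.innerObjective C y ≠ ∞) (hby : ∀ i j, corner b η i j < y j) {x : ℕ} {s : State}
    (h : N.Invariant C b η D K x s) :
    Runs N.oracle (.seq (Assign.block roundBlock) (Assign.block commitBlock)) s
      (roundCost (m + R + 1)) (N.Invariant C b η D K (x + 1)) := by
  set c : Fin m → ℝ := fun j => (∑ i, vertices m s i j) / ((m : ℝ) + 1) with hc
  obtain ⟨h1, h2, h3, h4, h5, α, k, hα, hk, hv⟩ := roundBlock_spec (v := vertices m s) (c := c)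
    h.holds h.count (fun _ _ => rfl) (fun _ => rfl) rfl
  refine (Assign.block_spec wf_roundBlock (ready_registers h.holds.idx)).seq fun s₁ hs₁ => ?_
  have hH₁ := h1.agree hs₁
  refine (Assign.block_spec wf_commitBlock (ready_registers hH₁.idx)).mono le_rfl fun s₂ hs₂ => ?_
  obtain ⟨g1, g2, g3, g4, g5, g6⟩ := commitBlock_spec hH₁ rfl
  rw [hs₁.2 18 (by omega), h4] at g4
  rw [hs₁.2 24 (by omega), h5, h.counter] at g5
  refine Invariant.agree ?_ hs₂
  constructor
  · exact g1
  · rw [g2, hs₁.2 8 (by omega), h2]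
  · rw [g3, hs₁.2 10 (by omega), h3, h.rounds]
  · rw [g5]; push_cast; ring
  · rw [g4]; exact phi_le_improve hN hC h.phi_le
  · rw [g4]
    rcases h.progress with ⟨i, hi⟩ | ⟨hin, hdet⟩
    · exact Or.inl ⟨i, (improve_le C c _).trans hi⟩
    have hnew : vertices m (Assign.semBlock N.oracle commitBlock s₁) = fun i j =>
        vertices m s k j + (vertices m s i j - vertices m s k j) /
          (1 + 1 / (8 * ((m : ℝ) + 1) ^ 2) * (α i / -α k)) := by
      funext i j
      rw [vertices, g6 i j, hs₁.2 23 (by omega)]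
      exact hv i j
    rcases simplex_cut (fun _ => rfl) hα hk rfl hin hdet with ⟨i, hi⟩ | ⟨h6, h7⟩
    · exact Or.inl ⟨i, improve_le_of_far hN hC hy (hby i) hi⟩
    · refine Or.inr ?_
      rw [hnew]
      refine ⟨h6, h7.trans (le_of_eq ?_)⟩
      rw [mul_assoc, ← Real.exp_add]
      congr 2
      push_cast
      field_simp
      ring

/-- After all rounds the simplex would be too small to contain the box. -/
theorem Invariant.le_of_rounds_le {C b : Fin m → ℝ} {η W K : ℝ} {x : ℕ} {s : State}
    (hη : 0 < η) (hη1 : η < 1) (hW : 1 ≤ W)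
    (hK : K = 16 * ((m : ℝ) + 1) ^ 3 * Real.log (((m : ℝ) + 1) * W * η⁻¹))
    (h : N.Invariant C b η ((((m : ℝ) + 1) * W) ^ (m + 1)) K x s) (hx : K ≤ x) :
    ∃ i, s.arr 4 0 0 ≤ (N.innerObjective C (corner b η i)).toReal := by
  refine h.progress.resolve_right ?_
  rintro ⟨hin, hdet⟩
  have h1 := (pow_le_abs_det_homMatrix hη.le hin).trans hdet
  have hNW : 0 < ((m : ℝ) + 1) * W := by positivity
  have hX : 0 < ((m : ℝ) + 1) * W * η⁻¹ := by positivity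
  have h2 : Real.exp (-(x / (16 * ((m : ℝ) + 1) ^ 2))) ≤
      ((((m : ℝ) + 1) * W * η⁻¹) ^ (m + 1))⁻¹ := by
    have h3 : ((m + 1 : ℕ) : ℝ) * Real.log (((m : ℝ) + 1) * W * η⁻¹) ≤
        x / (16 * ((m : ℝ) + 1) ^ 2) := by
      rw [le_div_iff₀ (by positivity)]
      refine le_trans (le_of_eq ?_) hx
      rw [hK]; push_cast; ring
    calc _ ≤ Real.exp (-(((m + 1 : ℕ) : ℝ) * Real.log (((m : ℝ) + 1) * W * η⁻¹))) :=
          Real.exp_le_exp.2 (neg_le_neg h3)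
      _ = _ := by rw [Real.exp_neg, Real.exp_nat_mul, Real.exp_log hX]
  have h4 : (((m : ℝ) + 1) * W) ^ (m + 1) * ((((m : ℝ) + 1) * W * η⁻¹) ^ (m + 1))⁻¹ =
      η ^ (m + 1) := by
    rw [mul_pow _ (η⁻¹), mul_inv, ← mul_assoc, mul_inv_cancel₀ (pow_pos hNW _).ne', one_mul, inv_pow,
      inv_inv]
  have h5 := h1.trans (mul_le_mul_of_nonneg_left h2 (pow_pos hNW (m + 1)).le)
  rw [h4, pow_succ] at h5
  nlinarith [pow_pos hη m]

/-! ### The number of steps -/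

theorem log_one_add_sum_le {ι : Type*} (S : Finset ι) {f : ι → ℝ} (hf : ∀ i, 0 ≤ f i) :
    Real.log (1 + ∑ i ∈ S, f i) ≤ ∑ i ∈ S, Real.log (1 + f i) := by
  classical
  induction S using Finset.induction_on with
  | empty => simp
  | insert i S hi ih =>
    rw [Finset.sum_insert hi, Finset.sum_insert hi]
    have h0 : 0 ≤ ∑ j ∈ S, f j := Finset.sum_nonneg fun j _ => hf j
    refine le_trans ?_ (add_le_add_right ih _)
    rw [← Real.log_mul (by linarith [hf i]) (by linarith)]
    exact Real.log_le_log (by linarith [hf i]) (by nlinarith [hf i, mul_nonneg (hf i) h0])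

theorem le_inputSize (hν : ∀ r, 0 ≤ N.ν r) (ε : ℝ) :
    (m : ℝ) + R + Real.log (1 + ∑ r, N.ν r) + Real.log (1 + ∑ j, ∑ r, (N.A j r : ℝ)) +
      Real.log (1 + 1 / ε) ≤ N.inputSize ε := by
  have h1 := log_one_add_sum_le Finset.univ hν
  have h2 : Real.log (1 + ∑ j, ∑ r, (N.A j r : ℝ)) ≤ ∑ j, ∑ r, Real.log (1 + (N.A j r : ℝ)) :=
    (log_one_add_sum_le Finset.univ fun j => Finset.sum_nonneg fun r _ => Nat.cast_nonneg _).trans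
      (Finset.sum_le_sum fun j _ => log_one_add_sum_le Finset.univ fun r => Nat.cast_nonneg _)
  unfold inputSize
  linarith

/-- The number of rounds is polynomial in the size of the input. -/
theorem rounds_le (hν : ∀ r, 0 ≤ N.ν r) {ε V Q G W : ℝ} (hε : 0 < ε) (hV : V = ∑ r, N.ν r)
    (hQ : Q = ∑ j, ∑ r, (N.A j r : ℝ)) (hG : G = 2 + 16 * V / ε)
    (hW : W = 2 * ((m : ℝ) + 1) * (Real.log G + 1)) :
    16 * ((m : ℝ) + 1) ^ 3 * Real.log (((m : ℝ) + 1) * W * ((1 + Q) * G)) ≤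
      208 * (1 + N.inputSize ε) ^ 4 := by
  have hsize := le_inputSize hν ε
  have hV0 : 0 ≤ V := hV ▸ Finset.sum_nonneg fun r _ => hν r
  have hQ0 : 0 ≤ Q := hQ ▸ Finset.sum_nonneg fun j _ => Finset.sum_nonneg fun r _ =>
    Nat.cast_nonneg _
  rw [← hV, ← hQ] at hsize
  have hm0 : (0 : ℝ) ≤ m := Nat.cast_nonneg m
  have hR0 : (0 : ℝ) ≤ R := Nat.cast_nonneg R
  have hlV : 0 ≤ Real.log (1 + V) := Real.log_nonneg (by linarith)
  have hlQ : 0 ≤ Real.log (1 + Q) := Real.log_nonneg (by linarith)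
  have hlε : 0 ≤ Real.log (1 + 1 / ε) := Real.log_nonneg (by have := one_div_pos.2 hε; linarith)
  have hG2 : 2 ≤ G := by
    have : 0 ≤ 16 * V / ε := by positivity
    rw [hG]; linarith
  have hlG0 : 0 ≤ Real.log G := Real.log_nonneg (by linarith)
  have hlG : Real.log G ≤ 4 + Real.log (1 + V) + Real.log (1 + 1 / ε) := by
    have h1 : G ≤ Real.exp 4 * ((1 + V) * (1 + 1 / ε)) := by
      have h16 : (16 : ℝ) ≤ Real.exp 4 := by
        have h2 : (2 : ℝ) ≤ Real.exp 1 := by linarith [Real.add_one_le_exp (1 : ℝ)]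
        calc (16 : ℝ) = 2 ^ 4 := by norm_num
          _ ≤ Real.exp 1 ^ 4 := by gcongr
          _ = Real.exp 4 := by rw [← Real.exp_nat_mul]; norm_num
      have h3 : 0 ≤ (1 + V) * (1 + 1 / ε) := by positivity
      refine le_trans ?_ (mul_le_mul_of_nonneg_right h16 h3)
      rw [hG, show (16 : ℝ) * ((1 + V) * (1 + 1 / ε)) = 16 + 16 * V + 16 * (1 / ε) + 16 * V / ε by
        ring]
      have := one_div_pos.2 hε
      linarith
    have h4 : 0 < 1 + 1 / ε := by positivity
    refine (Real.log_le_log (by linarith) h1).trans (le_of_eq ?_)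
    rw [Real.log_mul (Real.exp_pos _).ne' (by positivity), Real.log_exp,
      Real.log_mul (by positivity) h4.ne']
    ring
  have hX : Real.log (((m : ℝ) + 1) * W * ((1 + Q) * G)) ≤ 13 * (1 + N.inputSize ε) := by
    rw [hW, show ((m : ℝ) + 1) * (2 * ((m : ℝ) + 1) * (Real.log G + 1)) * ((1 + Q) * G) =
      2 * ((m : ℝ) + 1) * ((m : ℝ) + 1) * (Real.log G + 1) * (1 + Q) * G by ring,
      Real.log_mul (by positivity) (by positivity), Real.log_mul (by positivity) (by positivity),
      Real.log_mul (by positivity) (by positivity), Real.log_mul (by positivity) (by positivity),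
      Real.log_mul (by positivity) (by positivity)]
    have h1 := Real.log_le_sub_one_of_pos (show (0 : ℝ) < 2 by norm_num)
    have h2 := Real.log_le_sub_one_of_pos (show (0 : ℝ) < (m : ℝ) + 1 by positivity)
    have h3 := Real.log_le_sub_one_of_pos (show (0 : ℝ) < Real.log G + 1 by positivity)
    linarith
  have hm1 : (m : ℝ) + 1 ≤ 1 + N.inputSize ε := by linarith
  have hz : 0 ≤ 1 + N.inputSize ε := by linarith
  calc 16 * ((m : ℝ) + 1) ^ 3 * Real.log (((m : ℝ) + 1) * W * ((1 + Q) * G))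
      ≤ 16 * ((m : ℝ) + 1) ^ 3 * (13 * (1 + N.inputSize ε)) := by gcongr
    _ ≤ 16 * (1 + N.inputSize ε) ^ 3 * (13 * (1 + N.inputSize ε)) := by gcongr
    _ = _ := by ring

theorem holds_input (C : Fin m → ℝ) (ε : ℝ) :
    N.Holds C ((Instr.idxAdd 3 0 2).apply N.oracle
      ((Instr.idxConst 2 1).apply N.oracle (N.input C ε))) where
  idx := by
    funext i
    by_cases h3 : i = 3
    · subst h3; simp [Instr.apply, State.setIdx, input, registers]
    · by_cases h2 : i = 2
      · subst h2; simp [Instr.apply, State.setIdx, input, registers]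
      · simp [Instr.apply, State.setIdx, input, registers, h2, h3]
  load r := by simp [Instr.apply, State.setIdx, input]
  demand j r := by simp [Instr.apply, State.setIdx, input]
  capacity j := by simp [Instr.apply, State.setIdx, input]

/-- The program computes `φ`. -/
theorem runs_phiProgram (hN : N.Valid) {C : Fin m → ℝ} {ε V Q G W : ℝ} (hC : 0 ≤ C) (hε : 0 < ε)
    (hV : V = ∑ r, N.ν r) (hQ : Q = ∑ j, ∑ r, (N.A j r : ℝ)) (hG : G = 2 + 16 * V / ε)
    (hW : W = 2 * ((m : ℝ) + 1) * (Real.log G + 1)) :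
    Runs N.oracle phiProgram (N.input C ε)
      (1 + (1 + (Assign.costBlock initBlock (m + R + 1) +
        (⌈16 * ((m : ℝ) + 1) ^ 3 * Real.log (((m : ℝ) + 1) * W * ((1 + Q) * G))⌉₊ *
          (roundCost (m + R + 1) + 1) + 1))))
      fun s => |s.output - N.phi C| ≤ ε := by
  have hV0 : 0 ≤ V := hV ▸ Finset.sum_nonneg fun r _ => hN.load_nonneg r
  have hQ0 : 0 ≤ Q := hQ ▸ Finset.sum_nonneg fun j _ => Finset.sum_nonneg fun r _ =>
    Nat.cast_nonneg _
  have hm0 : (0 : ℝ) ≤ m := Nat.cast_nonneg m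
  have hG2 : 2 ≤ G := by
    have : 0 ≤ 16 * V / ε := by positivity
    rw [hG]; linarith
  have hlG0 : 0 ≤ Real.log G := Real.log_nonneg (by linarith)
  set H := (1 + Q) * G with hH
  have hH2 : 2 ≤ H := by nlinarith
  set η := 1 / H with hη
  have hη0 : 0 < η := by positivity
  have hη2 : η ≤ 1 / 2 := one_div_le_one_div_of_le (by norm_num) hH2
  have hηH : η⁻¹ = H := by rw [hη, one_div, inv_inv]
  set K := 16 * ((m : ℝ) + 1) ^ 3 * Real.log (((m : ℝ) + 1) * W * H) with hK
  obtain ⟨y, hy0, hyL, hyfin, hy⟩ := exists_box hN (C := C) hε hV hQ hG hη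
  -- The corners lie strictly below `y`, as `improve_le_of_far` requires.
  set b : Fin m → ℝ := fun j => y j - 2 * η with hb
  have hcor : ∀ i j, y j - 2 * η ≤ corner b η i j ∧ corner b η i j < y j := by
    intro i j
    simp only [corner, hb]
    split_ifs <;> constructor <;> linarith
  have hW2 : 2 ≤ W := by rw [hW]; nlinarith [mul_nonneg hm0 hlG0]
  refine Runs.seq (Q := fun s => s = _) (Runs.instr rfl) ?_
  rintro _ rfl
  refine Runs.seq (Q := fun s => s = _) (Runs.instr rfl) ?_
  rintro _ rfl
  have hs := holds_input (N := N) C ε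
  have hloop : ∀ s, N.Invariant C b η ((((m : ℝ) + 1) * W) ^ (m + 1)) K 0 s →
      Runs N.oracle (.loop (.realLt ⟨12, 4, 4⟩ ⟨10, 4, 4⟩)
        (.seq (Assign.block roundBlock) (Assign.block commitBlock))) s
        (⌈K⌉₊ * (roundCost (m + R + 1) + 1) + 1)
        (N.Invariant C b η ((((m : ℝ) + 1) * W) ^ (m + 1)) K ⌈K⌉₊) := by
    intro s hI
    refine Runs.loop (n := ⌈K⌉₊) (I := N.Invariant C b η ((((m : ℝ) + 1) * W) ^ (m + 1)) K)
      (fun x s hI => ?_) (fun x s _ hI => hI.round hN hC hyfin fun i j => (hcor i j).2)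
      (Nat.zero_le _) hI
    have h4 : s.idx 4 = 0 := by rw [hI.holds.idx]; rfl
    change s.arr 12 (s.idx 4) (s.idx 4) < s.arr 10 (s.idx 4) (s.idx 4) ↔ _
    rw [h4, hI.counter, hI.rounds, Nat.lt_ceil]
  refine (Assign.block_spec wf_initBlock (ready_registers hs.idx)).seq fun s hsI => ?_
  refine (hloop s (Invariant.agree ?_ hsI)).mono le_rfl fun t ht => ?_
  · obtain ⟨g1, g2, g3, g4, g5, g6⟩ := initBlock_spec (ε := ε) hs
      (by simp [Instr.apply, State.setIdx, input]) rfl hV hQ hG hW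
    have hv : vertices m (Assign.semBlock N.oracle initBlock _) = initialSimplex W :=
      funext fun i => funext fun j => g6 i j
    refine ⟨g1, g3, g5, ?_, ?_, Or.inr ⟨fun i => ?_, ?_⟩⟩
    · rw [g4]; simp [Instr.apply, State.setIdx, input]
    · rw [g2, hV]; exact phi_le_sum hN.load_nonneg C
    · rw [hv]
      refine inSimplex_initial (L := Real.log G) (by linarith) (by rw [hW]; nlinarith)
        (fun j => ?_) fun j => ?_
      · have := hy0 j
        simp only [Pi.zero_apply] at this
        linarith [(hcor i j).1]
      · linarith [(hcor i j).2, hyL j]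
    · rw [hv]
      simpa using abs_det_initialSimplex_le (m := m) (W := W) (by linarith)
  · obtain ⟨i, hi⟩ := ht.le_of_rounds_le hη0 (by linarith) (by linarith) (by rw [hηH])
      (Nat.le_ceil K)
    have h1 := hi.trans (hy _ (hcor i))
    rw [State.output, abs_le]
    constructor <;> linarith [ht.phi_le]

end Network

theorem phiPolynomialTime : PhiPolynomialTime := by
  obtain ⟨K₁, d₁, h₁⟩ := Assign.polyBounded_costBlock initBlock
  obtain ⟨K₂, d₂, h₂⟩ : PolyBounded Network.roundCost :=
    (Assign.polyBounded_costBlock roundBlock).add (Assign.polyBounded_costBlock commitBlock)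
  refine ⟨phiProgram, 3 + K₁ * 2 ^ d₁ + 209 * (K₂ * 2 ^ d₂ + 1), d₁ + d₂ + 4,
    fun m n R N hN C ε hC hε => ?_⟩
  obtain ⟨s, k, hex, hk, hs⟩ := Network.runs_phiProgram hN hC hε rfl rfl rfl rfl
  refine ⟨s, k, hex, hs, ?_⟩
  have hK := Network.rounds_le (N := N) hN.load_nonneg hε rfl rfl rfl rfl
  set K := 16 * ((m : ℝ) + 1) ^ 3 * Real.log (((m : ℝ) + 1) *
    (2 * ((m : ℝ) + 1) * (Real.log (2 + 16 * (∑ r, N.ν r) / ε) + 1)) *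
      ((1 + ∑ j, ∑ r, (N.A j r : ℝ)) * (2 + 16 * (∑ r, N.ν r) / ε)))
  set z := 1 + N.inputSize ε with hz
  have hV0 : 0 ≤ ∑ r, N.ν r := Finset.sum_nonneg fun r _ => hN.load_nonneg r
  have hQ0 : 0 ≤ ∑ j, ∑ r, (N.A j r : ℝ) := Finset.sum_nonneg fun j _ =>
    Finset.sum_nonneg fun r _ => Nat.cast_nonneg _
  have hsize : (m : ℝ) + R + 1 ≤ z := by
    have h1 := Network.le_inputSize hN.load_nonneg ε
    have h2 := Real.log_nonneg (show 1 ≤ 1 + ∑ r, N.ν r by linarith)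
    have h3 := Real.log_nonneg (show 1 ≤ 1 + ∑ j, ∑ r, (N.A j r : ℝ) by linarith)
    have h4 := Real.log_nonneg (show 1 ≤ 1 + 1 / ε by have := one_div_pos.2 hε; linarith)
    linarith
  have hz1 : 1 ≤ z := by
    have := Nat.cast_nonneg (α := ℝ) m
    have := Nat.cast_nonneg (α := ℝ) R
    linarith
  have hB : ((1 + (m + R + 1) : ℕ) : ℝ) ≤ 2 * z := by push_cast; linarith
  have hpow : ∀ (L d : ℕ), ((L * (1 + (m + R + 1)) ^ d : ℕ) : ℝ) ≤ L * 2 ^ d * z ^ d := by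
    intro L d
    rw [Nat.cast_mul, Nat.cast_pow, mul_assoc, ← mul_pow]
    gcongr
  have c₁ : ((Assign.costBlock initBlock (m + R + 1) : ℕ) : ℝ) ≤ K₁ * 2 ^ d₁ * z ^ d₁ :=
    (Nat.cast_le.2 (h₁ (m + R + 1))).trans (hpow K₁ d₁)
  have c₂ : ((Network.roundCost (m + R + 1) : ℕ) : ℝ) ≤ K₂ * 2 ^ d₂ * z ^ d₂ :=
    (Nat.cast_le.2 (h₂ (m + R + 1))).trans (hpow K₂ d₂)
  have hceil : (⌈K⌉₊ : ℝ) ≤ 209 * z ^ 4 := by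
    have h1 : (⌈K⌉₊ : ℝ) ≤ ⌈208 * z ^ 4⌉₊ := Nat.cast_le.2 (Nat.ceil_mono hK)
    have h2 := (Nat.ceil_lt_add_one (show 0 ≤ 208 * z ^ 4 by positivity)).le
    have h3 : 1 ≤ z ^ 4 := one_le_pow₀ hz1
    linarith
  have hz4 : ∀ d, d ≤ d₁ + d₂ + 4 → z ^ d ≤ z ^ (d₁ + d₂ + 4) := fun d hd =>
    pow_le_pow_right₀ hz1 hd
  have hk' : (k : ℝ) ≤ 3 + (Assign.costBlock initBlock (m + R + 1) : ℕ) +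
      (⌈K⌉₊ : ℝ) * ((Network.roundCost (m + R + 1) : ℕ) + 1) := by
    refine (Nat.cast_le.2 hk).trans (le_of_eq ?_)
    push_cast; ring
  have hprod : (⌈K⌉₊ : ℝ) * ((Network.roundCost (m + R + 1) : ℕ) + 1) ≤
      209 * (K₂ * 2 ^ d₂ + 1) * z ^ (d₁ + d₂ + 4) := by
    have h1 : ((Network.roundCost (m + R + 1) : ℕ) : ℝ) + 1 ≤ (K₂ * 2 ^ d₂ + 1) * z ^ d₂ := by
      have : 1 ≤ z ^ d₂ := one_le_pow₀ hz1
      linarith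
    calc (⌈K⌉₊ : ℝ) * ((Network.roundCost (m + R + 1) : ℕ) + 1)
        ≤ 209 * z ^ 4 * ((K₂ * 2 ^ d₂ + 1) * z ^ d₂) := by gcongr
      _ = 209 * (K₂ * 2 ^ d₂ + 1) * z ^ (d₂ + 4) := by ring
      _ ≤ _ := mul_le_mul_of_nonneg_left (hz4 (d₂ + 4) (by omega)) (by positivity)
  have hinit : (K₁ : ℝ) * 2 ^ d₁ * z ^ d₁ ≤ K₁ * 2 ^ d₁ * z ^ (d₁ + d₂ + 4) :=
    mul_le_mul_of_nonneg_left (hz4 d₁ (by omega)) (by positivity)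
  have h3 : (3 : ℝ) ≤ 3 * z ^ (d₁ + d₂ + 4) := by
    have := hz4 0 (by omega); rw [pow_zero] at this; linarith
  push_cast
  linarith

end VirtNet

end

theorem theorem2 :
    (∀ (m n R : ℕ) (N : VirtNet.Network m n R), N.Valid →
      -- the minimum in the definition of `φ` is attained, unless some entity loses everything
      (∀ C : Fin m → ℝ, 0 ≤ C → (∀ j, ∃ ρ > 0, N.F j ρ (C j) < 1) →
        IsLeast (N.innerObjective C '' Set.Ici 0) (ENNReal.ofReal (N.phi C))) ∧
      -- asymptotic concavity
      VirtNet.AsymptoticallyConcave N.phi ∧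
      -- maximizers of `φ` under the linear constraints solve the modified problem
      (∀ C ∈ N.polytope, IsMaxOn N.phi N.polytope C → N.IsModifiedOptimal C)) ∧
    -- computability in polynomial time
    VirtNet.PhiPolynomialTime :=
  ⟨fun _ _ _ _ hN => ⟨fun _ _ h => VirtNet.Network.isLeast_phi h,
    VirtNet.Network.asymptoticallyConcave_phi hN.load_nonneg,
    fun _ hC hmax => VirtNet.Network.isModifiedOptimal_of_isMaxOn hN hC hmax⟩,
    VirtNet.phiPolynomialTime⟩
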